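/- **Theorem.** Let $p$ be a prime, let $k$ be a perfect (commutative) ring of characteristic $p$ (i.e. the Frobenius map $x\mapsto x^p$ is bijective on $k$), and let $e,m\ge 1$. Let $W=(W_1,\dots,W_e)$ be an $e$-dimensional formal group law over $k$, that is, power series in $k[[\mathbf X,\mathbf Y]]$, $\mathbf X=(X_1,\dots,X_e)$, $\mathbf Y=(Y_1,\dots,Y_e)$, with $W(\mathbf X,0)=\mathbf X$, $W(0,\mathbf Y)=\mathbf Y$, $W(W(\mathbf X,\mathbf Y),\mathbf Z)=W(\mathbf X,W(\mathbf Y,\mathbf Z))$. Let $\mathfrak g=W[m]$ be its $m$-th truncation: the group scheme $\operatorname{Spec} k[\mathbf X]/(X_1^{p^m},\dots,X_e^{p^m})$ with comultiplication $\mathbf X\mapsto W(\mathbf v,\mathbf w)$, where $\mathbf v,\mathbf w$ are the coordinates on the first and the second factor. Put $[p^m]=\{0,\dots,p^m-1\}$ and, for $\mathbf i,\mathbf j,\mathbf l\in[p^m]^e$, let $c_{\mathbf i,\mathbf j}^{\mathbf l}\in k$ be the coefficient of $\mathbf v^{\mathbf i}\mathbf w^{\mathbf j}$ in $W(\mathbf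 v,\mathbf w)^{\mathbf l}=\prod_a W_a(\mathbf v,\mathbf w)^{l_a}$. A *$\mathfrak g$-field* is a field $K$ that is a $k$-algebra, together with $k$-linear maps $D_{\mathbf i}:K\to K$ ($\mathbf i\in[p^m]^e$) such that $D_{\mathbf 0}=\mathrm{id}$, $D_{\mathbf i}(xy)=\sum_{\mathbf j+\mathbf l=\mathbf i}D_{\mathbf j}(x)D_{\mathbf l}(y)$ and $D_{\mathbf j}\circ D_{\mathbf i}=\sum_{\mathbf l}c_{\mathbf i,\mathbf j}^{\mathbf l}D_{\mathbf l}$ (equivalently, an action of $\mathfrak g$ on $\operatorname{Spec}K$ over $k$). It is *strict* if the common kernel of $D_{(1,0,\dots,0)},\dots,D_{(0,\dots,0,1)}$ is $K^p$. The field $K$ has *imperfection degree $e$* if $[K:K^p]=p^e$. Let $\lambda:K\to K$ be the function with $\lambda(x)=x^{1/p}$ for $x\in K^p$ and $\lambda(x)=0$ for $x\notin K^p$. Let $L_{e,m}$ be the language of rings with a constant symbol for each element of $k$ and a unary function symbol for each $D_{\mathbf i}$, and let $L^\lambda_{e,m}$ be $L_{e,m}$ with a further unary function symbol $\lambda$.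 Let $\mathfrak g$-DF be the $L_{e,m}$-theory of $\mathfrak g$-fields; $\mathfrak g$-DCF the $L_{e,m}$-theory of strict $\mathfrak g$-fields that are separably closed of imperfection degree $e$; $\mathfrak g$-DF$_\lambda$ the $L^\lambda_{e,m}$-theory of strict $\mathfrak g$-fields with the above $\lambda$; and $\mathfrak g$-DCF$_\lambda$ the $L^\lambda_{e,m}$-theory of models of $\mathfrak g$-DCF with the above $\lambda$. Then: 1. $\mathfrak g$-DCF$_\lambda$ has quantifier elimination in $L^\lambda_{e,m}$. 2. Each model of $\mathfrak g$-DF embeds into a model of $\mathfrak g$-DCF. 3. $\mathfrak g$-DCF is a model companion of $\mathfrak g$-DF: every model of either theory embeds into a model of the other, and every embedding between models of $\mathfrak g$-DCF is elementary. 4. $\mathfrak g$-DCF$_\lambda$ is a model completion of $\mathfrak g$-DF$_\lambda$: every model of $\mathfrak g$-DCF$_\lambda$ is a model of $\mathfrak g$-DF$_\lambda$, every model of $\mathfrak g$-DF$_\lambda$ embeds into a model of $\mathfrak g$-DCF$_\lambda$, and for each model $M$ of $\mathfrak g$-DF$_\lambda$ the theory $\mathfrak g$-DCF$_\lambda\cup\operatorname{Diag}(M)$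 is complete. -/

import Mathlib

open FirstOrder

universe u v w

namespace GDCF

noncomputable section

/-! ### Formal group laws and their truncations -/

/-- An `e`-dimensional formal group law over `k`: an `e`-tuple of power series
`W(X, Y) = (W₁, …, W_e)` in the `2e` variables `X = (X₁, …, X_e)` (the `Sum.inl` variables) and
`Y = (Y₁, …, Y_e)` (the `Sum.inr` variables) with `W(X, 0) = X`, `W(0, Y) = Y` and
`W(W(X, Y), Z) = W(X, W(Y, Z))`. (An inverse power series then exists automatically.) -/
structure FormalGroupLaw (e : ℕ) (k : Type*) [CommRing k] where
  toSeries : Fin e → MvPowerSeries (Fin e ⊕ Fin e) k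
  right_id : ∀ l, MvPowerSeries.subst
      (Sum.elim MvPowerSeries.X 0 : Fin e ⊕ Fin e → MvPowerSeries (Fin e) k) (toSeries l)
    = MvPowerSeries.X l
  left_id : ∀ l, MvPowerSeries.subst
      (Sum.elim 0 MvPowerSeries.X : Fin e ⊕ Fin e → MvPowerSeries (Fin e) k) (toSeries l)
    = MvPowerSeries.X l
  assoc : ∀ l,
    MvPowerSeries.subst
      (Sum.elim
        (fun a => MvPowerSeries.subst
          (Sum.elim (fun b => MvPowerSeries.X (Sum.inl b)) (fun b => MvPowerSeries.X (Sum.inr (Sum.inl b))) :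
            Fin e ⊕ Fin e → MvPowerSeries (Fin e ⊕ (Fin e ⊕ Fin e)) k) (toSeries a))
        (fun a => MvPowerSeries.X (Sum.inr (Sum.inr a))) :
        Fin e ⊕ Fin e → MvPowerSeries (Fin e ⊕ (Fin e ⊕ Fin e)) k) (toSeries l)
    = MvPowerSeries.subst
      (Sum.elim
        (fun a => MvPowerSeries.X (Sum.inl a))
        (fun a => MvPowerSeries.subst
          (Sum.elim (fun b => MvPowerSeries.X (Sum.inr (Sum.inl b)))
            (fun b => MvPowerSeries.X (Sum.inr (Sum.inr b))) :
            Fin e ⊕ Fin e → MvPowerSeries (Fin e ⊕ (Fin e ⊕ Fin e)) k) (toSeries a)) :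
        Fin e ⊕ Fin e → MvPowerSeries (Fin e ⊕ (Fin e ⊕ Fin e)) k) (toSeries l)

/-- The multi-indices `[p^m]^e`. The monomials `v^i` with `i` in this set form the standard basis of
`k[v_m] = k[X₁, …, X_e]/(X₁^(p^m), …, X_e^(p^m))`. -/
abbrev Idx (e p m : ℕ) : Type := Fin e → Fin (p ^ m)

/-- The truncated group scheme `W[m]` is `Spec k[v_m]` with the comultiplication
`c : k[v_m] → k[v_m, w_m]` sending the coordinates `v` to `W(v, w)` modulo the `p^m`-th powers of
the variables. `W.structConst p m i j l` is the matrix entry of `c` in the standard bases, i.e. the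
coefficient of `v^i w^j` in `c(v^l) = W(v, w)^l`. -/
def FormalGroupLaw.structConst {e : ℕ} {k : Type*} [CommRing k] (W : FormalGroupLaw e k)
    (p m : ℕ) (i j l : Idx e p m) : k :=
  MvPowerSeries.coeff
    (Finsupp.equivFunOnFinite.symm (Sum.elim (fun a => (i a : ℕ)) (fun a => (j a : ℕ))))
    (∏ a, W.toSeries a ^ (l a : ℕ))

/-! ### Languages -/

/-- The symbols added to the ring language: a constant for each element of `k`
and a unary function symbol `D_i` for each multi-index `i`. -/
inductive OpFunc (k : Type u) (ι : Type) : ℕ → Type u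
  | const (c : k) : OpFunc k ι 0
  | der (i : ι) : OpFunc k ι 1

/-- The language consisting of the symbols `OpFunc`. -/
def opLang (k : Type u) (ι : Type) : FirstOrder.Language.{u, 0} := ⟨OpFunc k ι, fun _ => Empty⟩

/-- The language `L_{e,m}` of `k`-algebras with `m`-truncated `e`-dimensional HS-derivations. -/
def hsLang (k : Type u) (e p m : ℕ) : FirstOrder.Language.{u, 0} :=
  Language.ring.sum (opLang k (Idx e p m))

/-- The unary function symbol `λ`. -/
inductive LamFunc : ℕ → Type
  | lam : LamFunc 1

/-- The language with `λ` as its only symbol. -/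
def lamLang : FirstOrder.Language.{0, 0} := ⟨LamFunc, fun _ => Empty⟩

/-- The language `L^λ_{e,m}`. -/
def hsLamLang (k : Type u) (e p m : ℕ) : FirstOrder.Language.{u, 0} := (hsLang k e p m).sum lamLang

/-! ### Terms -/

section Terms

variable {k : Type u} {e p m : ℕ} {α : Type*}

/-- The constant symbol of `c : k`, as a term. -/
def cst (c : k) : (hsLang k e p m).Term α :=
  Language.Constants.term (L := hsLang k e p m) (Sum.inr (OpFunc.const c))

/-- The term `D_i(t)`. -/
def der (i : Idx e p m) (t : (hsLang k e p m).Term α) : (hsLang k e p m).Term α :=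
  Language.Functions.apply₁ (L := hsLang k e p m) (Sum.inr (OpFunc.der i)) t

instance : Zero ((hsLang k e p m).Term α) :=
  ⟨Language.Constants.term (L := hsLang k e p m) (Sum.inl ringFunc.zero)⟩

instance : One ((hsLang k e p m).Term α) :=
  ⟨Language.Constants.term (L := hsLang k e p m) (Sum.inl ringFunc.one)⟩

instance : Add ((hsLang k e p m).Term α) :=
  ⟨Language.Functions.apply₂ (L := hsLang k e p m) (Sum.inl ringFunc.add)⟩

instance : Mul ((hsLang k e p m).Term α) :=
  ⟨Language.Functions.apply₂ (L := hsLang k e p m) (Sum.inl ringFunc.mul)⟩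

/-- The term `t ^ n`. -/
def tpow (n : ℕ) (t : (hsLang k e p m).Term α) : (hsLang k e p m).Term α := npowRec n t

/-- The sum of the terms `t b`, `b ∈ s` (in some order). -/
def sumT {β : Type*} (s : Finset β) (t : β → (hsLang k e p m).Term α) :
    (hsLang k e p m).Term α :=
  (s.toList.map t).sum

end Terms

/-! ### Axioms -/

section Axioms

open Language Term

variable {k : Type u} [CommRing k] {e : ℕ}

/-- `k → K` preserves addition. -/
def constAddAx (e p m : ℕ) (c d : k) : (hsLang k e p m).Sentence :=
  cst (c + d) =' (cst c + cst d)

/-- `k → K` preserves multiplication. -/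
def constMulAx (e p m : ℕ) (c d : k) : (hsLang k e p m).Sentence :=
  cst (c * d) =' (cst c * cst d)

/-- `k → K` preserves `1`. -/
def constOneAx (k : Type u) [CommRing k] (e p m : ℕ) : (hsLang k e p m).Sentence :=
  cst (1 : k) =' 1

/-- `D_i(x) = x` if `i = 0` (no condition on `x` if `i ≠ 0`). -/
def derZeroAx (k : Type u) (e p m : ℕ) (i : Idx e p m) : (hsLang k e p m).Sentence :=
  open scoped Classical in
  if ∀ a, (i a : ℕ) = 0 then ∀' (der i &0 =' &0) else ⊤

/-- `D_i(x + y) = D_i(x) + D_i(y)`. -/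
def derAddAx (k : Type u) {e p m : ℕ} (i : Idx e p m) : (hsLang k e p m).Sentence :=
  ∀' ∀' (der i (&0 + &1) =' (der i &0 + der i &1))

/-- `D_i(c x) = c D_i(x)` for `c` in `k`. -/
def derSMulAx {p m : ℕ} (i : Idx e p m) (c : k) : (hsLang k e p m).Sentence :=
  ∀' (der i (cst c * &0) =' (cst c * der i &0))

/-- `D_i(x y) = ∑_{j + l = i} D_j(x) D_l(y)`. -/
def derMulAx (k : Type u) {e p m : ℕ} (i : Idx e p m) : (hsLang k e p m).Sentence :=
  ∀' ∀' (der i (&0 * &1) ='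
    sumT (Finset.univ.filter fun jl : Idx e p m × Idx e p m =>
        ∀ a, (jl.1 a : ℕ) + (jl.2 a : ℕ) = (i a : ℕ))
      fun jl => der jl.1 &0 * der jl.2 &1)

/-- `W[m]`-iterativity: `D_j(D_i(x)) = ∑_l c_{i,j}^l D_l(x)`, where `(c_{i,j}^l)` is the matrix of
the comultiplication of `W[m]`. -/
def iterAx (W : FormalGroupLaw e k) {p m : ℕ} (i j : Idx e p m) : (hsLang k e p m).Sentence :=
  ∀' (der j (der i &0) =' sumT Finset.univ fun l => cst (W.structConst p m i j l) * der l &0)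

/-- The multi-index `(0, …, 0, 1, 0, …, 0)`, with `1` at the place `a`. -/
def unitIdx {e p m : ℕ} [NeZero p] (a : Fin e) : Idx e p m := Pi.single a 1

/-- Strictness: every constant, i.e. every common zero of the derivations
`D_{(1,0,…,0)}, …, D_{(0,…,0,1)}`, is a `p`-th power. (The converse holds for every HS-derivation in
characteristic `p`.) -/
def strictAx (k : Type u) (e p m : ℕ) [NeZero p] : (hsLang k e p m).Sentence :=
  ∀' ((BoundedFormula.iInf fun a : Fin e => (der (unitIdx a) &0 =' 0)) ⟹ ∃' (tpow p &1 =' &0))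

/-- Every polynomial `f = ∑_{i ≤ n} a_i X^i` with derivative `f' ≠ 0` has a root. For all `n`
together this says that the field is separably closed. -/
def sepClosedAx (k : Type u) [CommRing k] (e p m n : ℕ) : (hsLang k e p m).Sentence :=
  Formula.iAlls (Fin (n + 1))
    (((BoundedFormula.iSup fun i : Fin (n + 1) =>
        ∼((cst ((i : ℕ) : k) * var (Sum.inl (Sum.inr i))) =' 0)) ⟹
      ∃' (sumT Finset.univ (fun i : Fin (n + 1) => var (Sum.inl (Sum.inr i)) * tpow i &0) =' 0) :
        (hsLang k e p m).BoundedFormula (Empty ⊕ Fin (n + 1)) 0))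

/-- `[K : K^p] = p^e`: there are `b_1, …, b_{p^e}` in `K` that are linearly independent over `K^p`
and span `K` over `K^p`. -/
def imperfAx (k : Type u) (e p m : ℕ) : (hsLang k e p m).Sentence :=
  Formula.iExs (Fin (p ^ e))
    ((Formula.iAlls (Fin (p ^ e))
        ((sumT Finset.univ (fun i : Fin (p ^ e) =>
              tpow p (var (Sum.inl (Sum.inr i))) * var (Sum.inl (Sum.inl (Sum.inr i)))) =' 0) ⟹
          BoundedFormula.iInf fun i : Fin (p ^ e) => (var (Sum.inl (Sum.inr i)) =' 0) :
          (hsLang k e p m).BoundedFormula ((Empty ⊕ Fin (p ^ e)) ⊕ Fin (p ^ e)) 0)) ⊓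
      Formula.iAlls Unit (Formula.iExs (Fin (p ^ e))
        (sumT Finset.univ (fun i : Fin (p ^ e) =>
            tpow p (var (Sum.inl (Sum.inr i))) * var (Sum.inl (Sum.inl (Sum.inl (Sum.inr i)))))
          =' var (Sum.inl (Sum.inl (Sum.inr ()))) :
          (hsLang k e p m).BoundedFormula
            (((Empty ⊕ Fin (p ^ e)) ⊕ Unit) ⊕ Fin (p ^ e)) 0)))

/-- The natural interpretation of `λ`: for all `x` and `z = λ(x)`, either `z^p = x`, or
`z = 0` and `x` is not a `p`-th power. -/
def lamAx (k : Type u) (e p m : ℕ) : (hsLamLang k e p m).Sentence :=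
  ∀' ∀' ((Functions.apply₁ (L := hsLamLang k e p m) (Sum.inr LamFunc.lam) &0 =' &1) ⟹
    (LHom.sumInl : hsLang k e p m →ᴸ hsLamLang k e p m).onBoundedFormula
      ((tpow p &1 =' &0) ⊔ ((&1 =' 0) ⊓ ∼(∃' (tpow p &2 =' &0)))))

/-! ### Theories -/

/-- `𝔤-DF`, the theory of `𝔤`-fields, for `𝔤 = W[m]`: fields `K` with a ring homomorphism `k → K`
and an `m`-truncated `e`-dimensional HS-derivation `(D_i)` over `k` which is `𝔤`-iterative. -/
def gDF (W : FormalGroupLaw e k) (p m : ℕ) : (hsLang k e p m).Theory :=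
  (LHom.sumInl : Language.ring →ᴸ hsLang k e p m).onTheory Theory.field
  ∪ Set.range (fun cd : k × k => constAddAx e p m cd.1 cd.2)
  ∪ Set.range (fun cd : k × k => constMulAx e p m cd.1 cd.2)
  ∪ {constOneAx k e p m}
  ∪ Set.range (derZeroAx k e p m)
  ∪ Set.range (derAddAx k)
  ∪ Set.range (fun ic : Idx e p m × k => derSMulAx ic.1 ic.2)
  ∪ Set.range (derMulAx k)
  ∪ Set.range (fun ij : Idx e p m × Idx e p m => iterAx W ij.1 ij.2)

/-- `𝔤-DCF`, the theory of strict `𝔤`-fields that are separably closed of imperfection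
degree `e`. -/
def gDCF (W : FormalGroupLaw e k) (p m : ℕ) [NeZero p] : (hsLang k e p m).Theory :=
  gDF W p m ∪ {strictAx k e p m} ∪ Set.range (sepClosedAx k e p m) ∪ {imperfAx k e p m}

/-- `𝔤-DF_λ`, the theory of strict `𝔤`-fields with the natural interpretation of `λ`. -/
def gDFLam (W : FormalGroupLaw e k) (p m : ℕ) [NeZero p] : (hsLamLang k e p m).Theory :=
  (LHom.sumInl : hsLang k e p m →ᴸ hsLamLang k e p m).onTheory (gDF W p m ∪ {strictAx k e p m})
  ∪ {lamAx k e p m}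

/-- `𝔤-DCF_λ`: the models of `𝔤-DCF` with the natural interpretation of `λ`. -/
def gDCFLam (W : FormalGroupLaw e k) (p m : ℕ) [NeZero p] : (hsLamLang k e p m).Theory :=
  (LHom.sumInl : hsLang k e p m →ᴸ hsLamLang k e p m).onTheory (gDCF W p m)
  ∪ {lamAx k e p m}

end Axioms

/-! ### Model-theoretic notions -/

section ModelTheory

open Language


variable {L : FirstOrder.Language.{u, v}}

/-- Quantifier elimination: modulo `T`, every formula is equivalent to a quantifier-free formula in
the same free variables. -/
def HasQE (T : L.Theory) : Prop :=
  ∀ (n : ℕ) (φ : L.Formula (Fin n)), ∃ ψ : L.Formula (Fin n),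
    BoundedFormula.IsQF ψ ∧ T ⊨ᵇ φ.iff ψ

/-- Every model of `T` embeds into a model of `T'` (models of size at most that of the universe
`max u v w`, where `w` is arbitrary). -/
def ModelsEmbed (T T' : L.Theory) : Prop :=
  ∀ M : Theory.ModelType.{u, v, max u v w} T, ∃ N : Theory.ModelType.{u, v, max u v w} T',
    Nonempty (M ↪[L] N)

/-- `T` is model complete: every embedding between models of `T` is elementary. -/
def IsModelComplete (T : L.Theory) : Prop :=
  ∀ (M N : Theory.ModelType.{u, v, max u v w} T) (f : M ↪[L] N) (n : ℕ)
    (φ : L.Formula (Fin n)) (x : Fin n → M), φ.Realize (f ∘ x) ↔ φ.Realize x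

/-- `T'` is a model companion of `T`. -/
structure IsModelCompanion (T' T : L.Theory) : Prop where
  embed : ModelsEmbed.{u, v, w} T T'
  embed' : ModelsEmbed.{u, v, w} T' T
  modelComplete : IsModelComplete.{u, v, w} T'

/-- `T'` is a model completion of `T`: models of `T'` are models of `T`, every model of `T` embeds
into a model of `T'`, and for every model `M` of `T` the theory `T' ∪ Diag(M)` is complete, that is,
any two models `N₁`, `N₂` of `T'` with embeddings of `M` satisfy the same formulas with parameters
from `M`. -/
structure IsModelCompletion (T' T : L.Theory) : Prop where
  extend : ∀ N : Theory.ModelType.{u, v, max u v w} T', N ⊨ T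
  embed : ModelsEmbed.{u, v, w} T T'
  complete : ∀ (M : Theory.ModelType.{u, v, max u v w} T)
    (N₁ N₂ : Theory.ModelType.{u, v, max u v w} T') (f₁ : M ↪[L] N₁) (f₂ : M ↪[L] N₂)
    (n : ℕ) (φ : L.Formula (Fin n)) (x : Fin n → M),
    φ.Realize (f₁ ∘ x) ↔ φ.Realize (f₂ ∘ x)

end ModelTheory

end

end GDCF

/-!
Let `𝔤 = W[m]`. A `𝔤`-field is a field `K` with a ring homomorphism `ρ : K → K[v]/(v^(p^m))`,
`ρ(x) = ∑ D_i(x) v^i`, that is coassociative for the comultiplication `v ↦ W(v, w)`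
(`GAct`, `GAct.hom`). In this form actions extend to localizations, tensor products and free
extensions, because the elements on which `ρ` is coassociative form a subring. All four parts rest on
the following facts.

*Separability.* In a strict `𝔤`-field the common constants of the derivations `D_{(0,…,1,…,0)}` are the
`p`-th powers. Differentiating a shortest linear relation between `p`-th powers therefore shows that
every extension of a strict `𝔤`-field by a `𝔤`-field is separable in the sense of MacLane
(`GAct.eq_zero_of_sum_mul_pow`). So tensor products over a strict `𝔤`-field are reduced, and any two
extensions of it can be amalgamated (`GAct.exists_amalgam_of_ring`).

*Existence.* Every `𝔤`-field embeds into a strict separably closed one of imperfection degree `e`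
(`GAct.exists_sepClosed`). A generic extension has elements `x_1, …, x_e` with invertible Jacobian
matrix `(D_{(0,…,1,…,0)}(x_b))`. Then the monomials `x^i`, `i ∈ [p^m]^e`, are a basis over the field of
constants `C` (`GAct.exists_basis`). For an algebraic extension `E` of `C` that is maximal with the
property that `E ⊗_C K` is a field, this field is separably closed and `E` consists of `p`-th powers
(`exists_maximal_constant_extension`). Hence the monomials with exponents below `p` span it over the
`p`-th powers, and strictness and the imperfection degree follow from the Jacobian condition.

*Embeddings are elementary.* Let `M ⊆ N` be models of `𝔤-DCF`. By separability a finitely generated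
subextension of `N / M` has a separating transcendence basis, so it has points in the separably closed
field `M` (`exists_partial_hom`), and `N` embeds over `M`, as a field, into an ultrapower of `M`. As
`M` and `N` have the same finite imperfection degree, `N` is generated by `M` and its `p^m`-th powers,
on which the operators are trivial; so the embedding respects the operators (`GAct.map_comm_of_comp`),
and Robinson's test applies (`realize_comp_of_robinson`, `realize_comp_gDCF`).

*Types.* Two tuples with the same quantifier-free type in the language with `λ` generate isomorphic
substructures. These are closed under `λ`, so their constants are `p`-th powers in them, and the two
models can be amalgamated over them; the amalgam embeds into a model, and both embeddings are
elementary (`realize_of_qf_type`). This gives quantifier elimination and the completeness of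
`𝔤-DCF_λ ∪ Diag(M)`.
-/

namespace GDCF

noncomputable section

/-! ### Truncated power series rings -/

section Trunc

variable (σ : Type*) [Fintype σ] (q : ℕ) (R : Type*) [CommRing R]

/-- The ideal of the power series all of whose coefficients at exponents in `[q]^σ` vanish. It is
generated by the `q`-th powers of the variables. -/
def truncIdeal : Ideal (MvPowerSeries σ R) where
  carrier := {f | ∀ n : σ →₀ ℕ, (∀ a, n a < q) → MvPowerSeries.coeff n f = 0}
  add_mem' := fun hf hg n hn => by rw [map_add, hf n hn, hg n hn, add_zero]
  zero_mem' := fun n _ => map_zero _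
  smul_mem' := fun c f hf n hn => by
    classical
    rw [smul_eq_mul, MvPowerSeries.coeff_mul]
    refine Finset.sum_eq_zero fun x hx => ?_
    rw [Finset.HasAntidiagonal.mem_antidiagonal] at hx
    rw [hf x.2 fun a => lt_of_le_of_lt (by rw [← hx]; simp) (hn a), mul_zero]

/-- The truncated polynomial ring `R[X_a : a ∈ σ]/(X_a^q : a ∈ σ)`, realised as a quotient of the
power series ring. -/
abbrev Trunc : Type _ := MvPowerSeries σ R ⧸ truncIdeal σ q R

variable {σ q R}

/-- A multi-index in `[q]^σ` as an exponent. -/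
def expo (i : σ → Fin q) : σ →₀ ℕ := Finsupp.equivFunOnFinite.symm fun a => (i a : ℕ)

@[simp] lemma expo_apply (i : σ → Fin q) (a : σ) : expo i a = (i a : ℕ) := rfl

lemma expo_injective : Function.Injective (expo : (σ → Fin q) → σ →₀ ℕ) := fun i j h => by
  ext a
  simpa using DFunLike.congr_fun h a

lemma exists_expo {n : σ →₀ ℕ} (hn : ∀ a, n a < q) : ∃ i : σ → Fin q, expo i = n :=
  ⟨fun a => ⟨n a, hn a⟩, by ext; rfl⟩

/-- The coefficient of an element of the truncated polynomial ring at a multi-index. -/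
def tcoeff (i : σ → Fin q) : Trunc σ q R →+ R :=
  QuotientAddGroup.lift (truncIdeal σ q R).toAddSubgroup
    (MvPowerSeries.coeff (R := R) (expo i)).toAddMonoidHom fun _ hf => hf _ fun a => (i a).2

lemma tcoeff_mk (i : σ → Fin q) (f : MvPowerSeries σ R) :
    tcoeff i (Ideal.Quotient.mk (truncIdeal σ q R) f) = MvPowerSeries.coeff (expo i) f := rfl

lemma Trunc.ext {x y : Trunc σ q R} (h : ∀ i, tcoeff i x = tcoeff i y) : x = y := by
  obtain ⟨f, rfl⟩ := Ideal.Quotient.mk_surjective x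
  obtain ⟨g, rfl⟩ := Ideal.Quotient.mk_surjective y
  rw [Ideal.Quotient.eq]
  intro n hn
  obtain ⟨i, rfl⟩ := exists_expo hn
  have := h i
  rw [tcoeff_mk, tcoeff_mk] at this
  rw [map_sub, this, sub_self]

/-- The element of the truncated polynomial ring with prescribed coefficients. -/
def ofCoeffs (f : (σ → Fin q) → R) : Trunc σ q R :=
  Ideal.Quotient.mk _ (show MvPowerSeries σ R from
    fun n => if h : ∀ a, n a < q then f fun a => ⟨n a, h a⟩ else 0)

@[simp] lemma tcoeff_ofCoeffs (f : (σ → Fin q) → R) (i : σ → Fin q) :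
    tcoeff i (ofCoeffs f) = f i := by
  rw [ofCoeffs, tcoeff_mk]
  exact dif_pos fun a => (i a).2

/-- The index set of the Leibniz rule: the pairs of multi-indices with sum `i`. -/
abbrev splits {σ : Type*} [Fintype σ] [DecidableEq σ] {q : ℕ} (i : σ → Fin q) :
    Finset ((σ → Fin q) × (σ → Fin q)) :=
  Finset.univ.filter fun jl => ∀ a, (jl.1 a : ℕ) + (jl.2 a : ℕ) = (i a : ℕ)

lemma mem_splits [DecidableEq σ] {i : σ → Fin q} {x : (σ → Fin q) × (σ → Fin q)} :
    x ∈ splits i ↔ ∀ a, (x.1 a : ℕ) + (x.2 a : ℕ) = (i a : ℕ) := by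
  simp

/-- A sum over the antidiagonal of a multi-index in `[q]^σ` only involves such multi-indices. -/
lemma sum_antidiagonal_expo [DecidableEq σ] {M : Type*} [AddCommMonoid M] (i : σ → Fin q)
    (F : (σ →₀ ℕ) × (σ →₀ ℕ) → M) :
    ∑ x ∈ Finset.HasAntidiagonal.antidiagonal (expo i), F x = ∑ jl ∈ splits i, F (expo jl.1, expo jl.2) := by
  symm
  refine Finset.sum_bij (fun jl _ => (expo jl.1, expo jl.2)) ?_ ?_ ?_ ?_
  · intro jl h
    rw [Finset.mem_filter] at h
    rw [Finset.HasAntidiagonal.mem_antidiagonal]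
    ext a
    exact h.2 a
  · rintro ⟨a, b⟩ _ ⟨c, d⟩ _ h
    rw [Prod.mk.injEq] at h ⊢
    exact ⟨expo_injective h.1, expo_injective h.2⟩
  · rintro ⟨n, n'⟩ h
    rw [Finset.HasAntidiagonal.mem_antidiagonal] at h
    have h' : ∀ a, n a + n' a = i a := fun a => by rw [← expo_apply, ← h]; rfl
    obtain ⟨j, rfl⟩ := exists_expo (q := q) (n := n) fun a =>
      lt_of_le_of_lt (by have := h' a; omega) (i a).2
    obtain ⟨l, rfl⟩ := exists_expo (q := q) (n := n') fun a =>
      lt_of_le_of_lt (by have := h' a; omega) (i a).2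
    exact ⟨(j, l), by simpa using h', rfl⟩
  · intros; rfl

lemma tcoeff_mul [DecidableEq σ] (i : σ → Fin q) (x y : Trunc σ q R) :
    tcoeff i (x * y) = ∑ jl ∈ splits i, tcoeff jl.1 x * tcoeff jl.2 y := by
  obtain ⟨f, rfl⟩ := Ideal.Quotient.mk_surjective x
  obtain ⟨g, rfl⟩ := Ideal.Quotient.mk_surjective y
  rw [← map_mul, tcoeff_mk, MvPowerSeries.coeff_mul, sum_antidiagonal_expo]
  rfl

lemma tcoeff_algebraMap (i : σ → Fin q) (r : R) :
    tcoeff i (algebraMap R (Trunc σ q R) r) =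
      open scoped Classical in if ∀ a, (i a : ℕ) = 0 then r else 0 := by
  classical
  change MvPowerSeries.coeff (expo i) (MvPowerSeries.C r) = _
  rw [MvPowerSeries.coeff_C]
  refine if_congr ?_ rfl rfl
  simp [Finsupp.ext_iff]

lemma tcoeff_algebraMap_mul (i : σ → Fin q) (r : R) (x : Trunc σ q R) :
    tcoeff i (algebraMap R (Trunc σ q R) r * x) = r * tcoeff i x := by
  obtain ⟨f, rfl⟩ := Ideal.Quotient.mk_surjective x
  exact MvPowerSeries.coeff_C_mul _ _ _

lemma tcoeff_smul (i : σ → Fin q) (r : R) (x : Trunc σ q R) :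
    tcoeff i (r • x) = r * tcoeff i x := by
  obtain ⟨f, rfl⟩ := Ideal.Quotient.mk_surjective x
  exact MvPowerSeries.coeff_smul f (expo i) r

lemma algebraMap_trunc_injective (hq : 0 < q) :
    Function.Injective (algebraMap R (Trunc σ q R)) := fun x y h => by
  have := congrArg (tcoeff fun _ => ⟨0, hq⟩) h
  simpa [tcoeff_algebraMap] using this

/-- Functoriality of the truncated polynomial ring in the coefficients. -/
def truncMap {S : Type*} [CommRing S] (φ : R →+* S) : Trunc σ q R →+* Trunc σ q S :=
  Ideal.quotientMap _ (MvPowerSeries.map φ) fun f hf n hn => by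
    rw [MvPowerSeries.coeff_map, hf n hn, map_zero]

@[simp] lemma tcoeff_truncMap {S : Type*} [CommRing S] (φ : R →+* S) (i : σ → Fin q)
    (x : Trunc σ q R) : tcoeff i (truncMap φ x) = φ (tcoeff i x) := by
  obtain ⟨f, rfl⟩ := Ideal.Quotient.mk_surjective x
  exact MvPowerSeries.coeff_map _ _ _

@[simp] lemma truncMap_algebraMap {S : Type*} [CommRing S] (φ : R →+* S) (r : R) :
    truncMap φ (algebraMap R (Trunc σ q R) r) = algebraMap S (Trunc σ q S) (φ r) := by
  refine Trunc.ext fun i => ?_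
  rw [tcoeff_truncMap, tcoeff_algebraMap, tcoeff_algebraMap]
  split_ifs <;> simp

/-- The coordinate `X_a` in the truncated polynomial ring. -/
def tX (a : σ) : Trunc σ q R := Ideal.Quotient.mk _ (MvPowerSeries.X a)

omit [Fintype σ] in
lemma monomial_mem_truncIdeal {n : σ →₀ ℕ} {a : σ} (ha : q ≤ n a) (r : R) :
    MvPowerSeries.monomial n r ∈ truncIdeal σ q R := fun n' hn' => by
  classical
  rw [MvPowerSeries.coeff_monomial, if_neg]
  rintro rfl
  exact absurd (hn' a) (not_lt.2 ha)

lemma eq_sum_monomial [DecidableEq σ] (x : Trunc σ q R) :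
    x = ∑ i : σ → Fin q,
      Ideal.Quotient.mk (truncIdeal σ q R) (MvPowerSeries.monomial (expo i) (tcoeff i x)) := by
  classical
  refine Trunc.ext fun j => ?_
  rw [map_sum]
  simp only [tcoeff_mk, MvPowerSeries.coeff_monomial]
  rw [Finset.sum_eq_single j]
  · simp
  · intro b _ hb
    rw [if_neg fun h => hb (expo_injective h).symm]
  · simp

end Trunc

section TruncCharP

variable {σ : Type*} [Fintype σ] {p m : ℕ} [Fact p.Prime] {R : Type*} [CommRing R] [CharP R p]

/-- In characteristic `p`, the `p^m`-th powers in `R[X]/(X^(p^m))` are constants. -/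
lemma trunc_pow (x : Trunc σ (p ^ m) R) :
    x ^ p ^ m = algebraMap R _ (tcoeff (fun _ => 0) x ^ p ^ m) := by
  classical
  have : CharP (Trunc σ (p ^ m) R) p :=
    charP_of_injective_ringHom (algebraMap_trunc_injective (NeZero.pos _)) p
  conv_lhs => rw [eq_sum_monomial x]
  rw [sum_pow_char_pow, Finset.sum_eq_single fun _ => 0]
  · rw [map_pow]
    congr 1
    have : expo (fun _ : σ => (0 : Fin (p ^ m))) = 0 := by ext; simp
    rw [this]
    rfl
  · intro i _ hi
    obtain ⟨a, ha⟩ : ∃ a, i a ≠ 0 := by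
      by_contra! h
      exact hi (funext h)
    rw [← map_pow, MvPowerSeries.monomial_pow, Ideal.Quotient.eq_zero_iff_mem]
    refine monomial_mem_truncIdeal (a := a) ?_ _
    have : 1 ≤ (i a : ℕ) := Nat.one_le_iff_ne_zero.2 fun h => ha (Fin.ext h)
    simpa using Nat.le_mul_of_pos_right (p ^ m) this
  · simp

end TruncCharP

/-! ### The structure constants of a truncated formal group law -/

section Rename

variable {σ τ ρ : Type*} {R : Type*} [CommRing R]

/-- Coefficients of the product of a power series in the variables `f` with a monomial in the disjoint
set of variables `c`. -/
lemma coeff_rename_mul_monomial (f : σ ↪ τ) (c : ρ ↪ τ) (hfc : ∀ a b, f a ≠ c b)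
    (F : MvPowerSeries σ R) (n : σ →₀ ℕ) (n' d : ρ →₀ ℕ) [DecidableEq (ρ →₀ ℕ)] :
    MvPowerSeries.coeff (Finsupp.embDomain f n + Finsupp.embDomain c n')
      (MvPowerSeries.rename f F * MvPowerSeries.monomial (Finsupp.embDomain c d) 1) =
      if d = n' then MvPowerSeries.coeff n F else 0 := by
  classical
  have hf : ∀ (x : σ →₀ ℕ) b, Finsupp.embDomain f x (c b) = 0 := fun x b =>
    Finsupp.embDomain_of_notMem_range _ _ _ fun ⟨a, ha⟩ => hfc a b ha
  rw [MvPowerSeries.coeff_mul_monomial, mul_one]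
  split_ifs with h h' h'
  · rw [h', add_tsub_cancel_right, MvPowerSeries.coeff_embDomain_rename]
  · obtain ⟨b, hb⟩ : ∃ b, d b ≠ n' b := by
      by_contra! h2
      exact h' (Finsupp.ext h2)
    have hle := h (c b)
    rw [Finsupp.add_apply, hf, zero_add, Finsupp.embDomain_apply_self,
      Finsupp.embDomain_apply_self] at hle
    refine MvPowerSeries.coeff_rename_eq_zero _ _ ?_
    rintro ⟨x, hx⟩
    have := DFunLike.congr_fun hx (c b)
    rw [← Finsupp.embDomain_eq_mapDomain, hf, Finsupp.tsub_apply, Finsupp.add_apply, hf, zero_add,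
      Finsupp.embDomain_apply_self, Finsupp.embDomain_apply_self] at this
    omega
  · exact absurd (by rw [h']; exact le_add_self) h
  · rfl

lemma embDomain_add_apply_left (f : σ ↪ τ) (c : ρ ↪ τ) (hfc : ∀ a b, f a ≠ c b)
    (n : σ →₀ ℕ) (n' : ρ →₀ ℕ) (a : σ) :
    (Finsupp.embDomain f n + Finsupp.embDomain c n') (f a) = n a := by
  rw [Finsupp.add_apply, Finsupp.embDomain_apply_self,
    Finsupp.embDomain_of_notMem_range _ _ _ fun ⟨b, hb⟩ => hfc a b hb.symm, add_zero]

lemma embDomain_add_apply_right (f : σ ↪ τ) (c : ρ ↪ τ) (hfc : ∀ a b, f a ≠ c b)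
    (n : σ →₀ ℕ) (n' : ρ →₀ ℕ) (b : ρ) :
    (Finsupp.embDomain f n + Finsupp.embDomain c n') (c b) = n' b := by
  rw [Finsupp.add_apply, Finsupp.embDomain_apply_self,
    Finsupp.embDomain_of_notMem_range _ _ _ fun ⟨a, ha⟩ => hfc a b ha, zero_add]

lemma prod_X_pow_eq_monomial [Fintype ρ] (c : ρ ↪ τ) (d : ρ →₀ ℕ) :
    ∏ a, (MvPowerSeries.X (c a) : MvPowerSeries τ R) ^ d a =
      MvPowerSeries.monomial (Finsupp.embDomain c d) 1 := by
  rw [MvPowerSeries.monomial_one_eq, Finsupp.embDomain_eq_mapDomain,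
    Finsupp.prod_mapDomain_index_inj c.injective, Finsupp.prod_fintype _ _ (by simp)]

end Rename

namespace FormalGroupLaw

variable {e : ℕ} {k : Type*} [CommRing k] (W : FormalGroupLaw e k)

lemma hasSubst_right : MvPowerSeries.HasSubst
    (Sum.elim MvPowerSeries.X 0 : Fin e ⊕ Fin e → MvPowerSeries (Fin e) k) :=
  MvPowerSeries.hasSubst_of_constantCoeff_zero (by rintro (a | a) <;> simp)

lemma hasSubst_left : MvPowerSeries.HasSubst
    (Sum.elim 0 MvPowerSeries.X : Fin e ⊕ Fin e → MvPowerSeries (Fin e) k) :=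
  MvPowerSeries.hasSubst_of_constantCoeff_zero (by rintro (a | a) <;> simp)

/-- An exponent of the variables `(X, Y)`, given by its two halves. -/
def pairExpo (i j : Fin e → ℕ) : Fin e ⊕ Fin e →₀ ℕ :=
  Finsupp.equivFunOnFinite.symm (Sum.elim i j)

lemma exists_pairExpo (d : Fin e ⊕ Fin e →₀ ℕ) :
    ∃ i j : Fin e →₀ ℕ, d = pairExpo i j :=
  ⟨d.comapDomain Sum.inl Sum.inl_injective.injOn, d.comapDomain Sum.inr Sum.inr_injective.injOn, by
    ext (a | a) <;> rfl⟩

lemma prod_pairExpo {M : Type*} [CommMonoid M] (i j : Fin e → ℕ) (F : Fin e ⊕ Fin e → M) :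
    (pairExpo i j).prod (fun s n => F s ^ n) =
      (∏ a, F (Sum.inl a) ^ i a) * ∏ a, F (Sum.inr a) ^ j a := by
  rw [Finsupp.prod_fintype _ _ (by simp), Fintype.prod_sum_type]
  rfl

lemma pairExpo_injective {i j i' j' : Fin e → ℕ} (h : pairExpo i j = pairExpo i' j') :
    i = i' ∧ j = j' :=
  ⟨funext fun a => DFunLike.congr_fun h (Sum.inl a), funext fun a => DFunLike.congr_fun h (Sum.inr a)⟩

lemma prod_zero_pow {M : Type*} [CommMonoidWithZero M] (d : Fin e →₀ ℕ) (hd : d ≠ 0) :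
    ∏ a, (0 : M) ^ d a = 0 := by
  obtain ⟨a, ha⟩ : ∃ a, d a ≠ 0 := by
    by_contra! h
    exact hd (Finsupp.ext h)
  exact Finset.prod_eq_zero (Finset.mem_univ a) (zero_pow ha)

/-- The coefficients of `f(X, 0)`. -/
lemma coeff_subst_right (f : MvPowerSeries (Fin e ⊕ Fin e) k) (n : Fin e →₀ ℕ) :
    MvPowerSeries.coeff n (MvPowerSeries.subst
      (Sum.elim MvPowerSeries.X 0 : Fin e ⊕ Fin e → MvPowerSeries (Fin e) k) f) =
    MvPowerSeries.coeff (pairExpo n 0) f := by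
  classical
  rw [MvPowerSeries.coeff_subst hasSubst_right, finsum_eq_single _ (pairExpo n 0)]
  · rw [prod_pairExpo]
    have := prod_X_pow_eq_monomial (R := k) (Function.Embedding.refl (Fin e)) n
    simp only [Function.Embedding.refl_apply, Finsupp.embDomain_refl] at this
    simp [this]
  · intro d hd
    obtain ⟨i, j, rfl⟩ := exists_pairExpo d
    rw [prod_pairExpo]
    by_cases hj : j = 0
    · subst hj
      have := prod_X_pow_eq_monomial (R := k) (Function.Embedding.refl (Fin e)) i
      simp only [Function.Embedding.refl_apply, Finsupp.embDomain_refl] at this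
      simp only [Sum.elim_inl, this]
      simp only [Sum.elim_inr, Finsupp.coe_zero, Pi.zero_apply, pow_zero, Finset.prod_const_one,
        mul_one, MvPowerSeries.coeff_monomial]
      rw [if_neg, smul_zero]
      rintro rfl
      exact hd rfl
    · simp [prod_zero_pow j hj]

/-- The coefficients of `f(0, Y)`. -/
lemma coeff_subst_left (f : MvPowerSeries (Fin e ⊕ Fin e) k) (n : Fin e →₀ ℕ) :
    MvPowerSeries.coeff n (MvPowerSeries.subst
      (Sum.elim 0 MvPowerSeries.X : Fin e ⊕ Fin e → MvPowerSeries (Fin e) k) f) =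
    MvPowerSeries.coeff (pairExpo 0 n) f := by
  classical
  rw [MvPowerSeries.coeff_subst hasSubst_left, finsum_eq_single _ (pairExpo 0 n)]
  · rw [prod_pairExpo]
    have := prod_X_pow_eq_monomial (R := k) (Function.Embedding.refl (Fin e)) n
    simp only [Function.Embedding.refl_apply, Finsupp.embDomain_refl] at this
    simp [this]
  · intro d hd
    obtain ⟨i, j, rfl⟩ := exists_pairExpo d
    rw [prod_pairExpo]
    by_cases hi : i = 0
    · subst hi
      have := prod_X_pow_eq_monomial (R := k) (Function.Embedding.refl (Fin e)) j
      simp only [Function.Embedding.refl_apply, Finsupp.embDomain_refl] at this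
      simp only [Sum.elim_inr, this]
      simp only [Sum.elim_inl, Finsupp.coe_zero, Pi.zero_apply, pow_zero, Finset.prod_const_one,
        one_mul, MvPowerSeries.coeff_monomial]
      rw [if_neg, smul_zero]
      rintro rfl
      exact hd rfl
    · simp [prod_zero_pow i hi]

lemma constantCoeff_toSeries (a : Fin e) : MvPowerSeries.constantCoeff (W.toSeries a) = 0 := by
  have h := coeff_subst_right (W.toSeries a) 0
  rw [W.right_id] at h
  rw [MvPowerSeries.coeff_zero_X] at h
  rw [← MvPowerSeries.coeff_zero_eq_constantCoeff_apply, h]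
  have h0 : pairExpo (⇑(0 : Fin e →₀ ℕ)) 0 = 0 := by
    refine Finsupp.ext ?_
    rintro (a | a) <;> rfl
  rw [h0]

/-- The monomial `W^l = ∏ W_a^{l_a}` in the components of the formal group law. -/
def powers (l : Fin e → ℕ) : MvPowerSeries (Fin e ⊕ Fin e) k := ∏ a, W.toSeries a ^ l a

variable {p m : ℕ}

lemma structConst_eq (i j l : Idx e p m) : W.structConst p m i j l =
    MvPowerSeries.coeff (pairExpo (fun a => i a) fun a => j a) (W.powers fun a => l a) := rfl

lemma expo_sumElim (i j : Idx e p m) :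
    expo (Sum.elim i j) = pairExpo (fun a => (i a : ℕ)) fun a => (j a : ℕ) := by
  ext (a | a) <;> rfl

lemma coeff_zero_left_powers (j l : Fin e →₀ ℕ) [DecidableEq (Fin e →₀ ℕ)] :
    MvPowerSeries.coeff (pairExpo 0 j) (W.powers l) = if j = l then 1 else 0 := by
  have := prod_X_pow_eq_monomial (R := k) (Function.Embedding.refl (Fin e)) l
  simp only [Function.Embedding.refl_apply, Finsupp.embDomain_refl, id] at this
  rw [← coeff_subst_left, powers, ← MvPowerSeries.coe_substAlgHom hasSubst_left, map_prod]
  simp only [map_pow]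
  simp only [MvPowerSeries.coe_substAlgHom hasSubst_left, W.left_id, this,
    MvPowerSeries.coeff_monomial]
  congr

lemma coeff_zero_right_powers (i l : Fin e →₀ ℕ) [DecidableEq (Fin e →₀ ℕ)] :
    MvPowerSeries.coeff (pairExpo i 0) (W.powers l) = if i = l then 1 else 0 := by
  have := prod_X_pow_eq_monomial (R := k) (Function.Embedding.refl (Fin e)) l
  simp only [Function.Embedding.refl_apply, Finsupp.embDomain_refl, id] at this
  rw [← coeff_subst_right, powers, ← MvPowerSeries.coe_substAlgHom hasSubst_right, map_prod]
  simp only [map_pow]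
  simp only [MvPowerSeries.coe_substAlgHom hasSubst_right, W.right_id, this,
    MvPowerSeries.coeff_monomial]
  congr

variable [NeZero p]

/-- The left counit law of `W[m]`: it says that `W(0, Y) = Y`. -/
lemma structConst_zero_left (j l : Idx e p m) :
    W.structConst p m 0 j l = if j = l then 1 else 0 := by
  classical
  have := W.coeff_zero_left_powers (expo j) (expo l)
  rw [if_congr expo_injective.eq_iff rfl rfl] at this
  rw [← this]
  rfl

/-- The right counit law of `W[m]`: it says that `W(X, 0) = X`. -/
lemma structConst_zero_right (i l : Idx e p m) :
    W.structConst p m i 0 l = if i = l then 1 else 0 := by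
  classical
  have := W.coeff_zero_right_powers (expo i) (expo l)
  rw [if_congr expo_injective.eq_iff rfl rfl] at this
  rw [← this]
  rfl

end FormalGroupLaw

namespace FormalGroupLaw

variable {e : ℕ} {k : Type*} [CommRing k] (W : FormalGroupLaw e k) {p m : ℕ}

lemma powers_add (l l' : Fin e → ℕ) : W.powers (l + l') = W.powers l * W.powers l' := by
  simp only [powers, Pi.add_apply, pow_add, Finset.prod_mul_distrib]

section

variable [Fact p.Prime] [CharP k p]

/-- In characteristic `p`, the `p^m`-th powers of `W_a` have no coefficients with exponents below
`p^m`. -/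
lemma coeff_powers_eq_zero (i j : Idx e p m) {l : Fin e → ℕ} {a : Fin e} (ha : p ^ m ≤ l a) :
    MvPowerSeries.coeff (pairExpo (fun a => (i a : ℕ)) fun a => (j a : ℕ)) (W.powers l) = 0 := by
  rw [← expo_sumElim, ← tcoeff_mk]
  refine Eq.trans ?_ (map_zero (tcoeff (Sum.elim i j)))
  congr 1
  rw [powers, map_prod]
  refine Finset.prod_eq_zero (Finset.mem_univ a) ?_
  rw [map_pow, ← Nat.sub_add_cancel ha, pow_add, trunc_pow, tcoeff_mk]
  have : expo (fun _ : Fin e ⊕ Fin e => (0 : Fin (p ^ m))) = 0 := by ext; simp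
  rw [this, MvPowerSeries.coeff_zero_eq_constantCoeff_apply, constantCoeff_toSeries,
    zero_pow (NeZero.ne _), map_zero, mul_zero]

/-- The comultiplication of `W[m]` is multiplicative: `W^l * W^l' = W^(l + l')`, which vanishes modulo
the `p^m`-th powers of the variables as soon as one exponent reaches `p^m`. -/
lemma sum_structConst_mul (i j l l' : Idx e p m) :
    ∑ x ∈ splits i, ∑ y ∈ splits j, W.structConst p m x.1 y.1 l * W.structConst p m x.2 y.2 l' =
      if h : ∀ a, (l a : ℕ) + l' a < p ^ m then W.structConst p m i j fun a => ⟨l a + l' a, h a⟩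
      else 0 := by
  classical
  have key : MvPowerSeries.coeff (pairExpo (fun a => (i a : ℕ)) fun a => (j a : ℕ))
      (W.powers ((fun a => (l a : ℕ)) + fun a => (l' a : ℕ))) =
      ∑ x ∈ splits i, ∑ y ∈ splits j,
        W.structConst p m x.1 y.1 l * W.structConst p m x.2 y.2 l' := by
    rw [powers_add, ← expo_sumElim, MvPowerSeries.coeff_mul, sum_antidiagonal_expo,
      ← Finset.sum_product']
    refine Finset.sum_nbij'
      (fun z => ((fun a => z.1 (Sum.inl a), fun a => z.2 (Sum.inl a)),
        (fun a => z.1 (Sum.inr a), fun a => z.2 (Sum.inr a))))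
      (fun z => (Sum.elim z.1.1 z.2.1, Sum.elim z.1.2 z.2.2)) ?_ ?_ ?_ ?_ ?_
    · intro z hz
      simp only [Finset.mem_filter, Finset.mem_univ, true_and, Finset.mem_product] at hz ⊢
      exact ⟨fun a => hz (Sum.inl a), fun a => hz (Sum.inr a)⟩
    · intro z hz
      simp only [Finset.mem_filter, Finset.mem_univ, true_and, Finset.mem_product] at hz ⊢
      rintro (a | a)
      · exact hz.1 a
      · exact hz.2 a
    · rintro ⟨z, z'⟩ _
      refine Prod.ext ?_ ?_ <;> · ext (a | a) <;> rfl
    · rintro ⟨⟨_, _⟩, _, _⟩ _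
      rfl
    · rintro ⟨z, z'⟩ _
      rw [structConst_eq, structConst_eq, ← expo_sumElim, ← expo_sumElim]
      congr 3 <;> ext (a | a) <;> rfl
  rw [← key]
  split_ifs with h
  · rfl
  · push Not at h
    obtain ⟨a, ha⟩ := h
    exact W.coeff_powers_eq_zero i j (a := a) ha

/-- The variables `(X, Y)` among `(X, Y, Z)`. -/
def emb₁₂ (e : ℕ) : Fin e ⊕ Fin e ↪ Fin e ⊕ (Fin e ⊕ Fin e) :=
  ⟨Sum.elim Sum.inl fun b => Sum.inr (Sum.inl b), by rintro (a | a) (b | b) h <;> simp_all⟩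

/-- The variables `(Y, Z)` among `(X, Y, Z)`. -/
def emb₂₃ (e : ℕ) : Fin e ⊕ Fin e ↪ Fin e ⊕ (Fin e ⊕ Fin e) :=
  ⟨Sum.elim (fun b => Sum.inr (Sum.inl b)) fun b => Sum.inr (Sum.inr b), by
    rintro (a | a) (b | b) h <;> simp_all⟩

/-- The variables `X` among `(X, Y, Z)`. -/
def emb₁ (e : ℕ) : Fin e ↪ Fin e ⊕ (Fin e ⊕ Fin e) := ⟨Sum.inl, Sum.inl_injective⟩

/-- The variables `Z` among `(X, Y, Z)`. -/
def emb₃ (e : ℕ) : Fin e ↪ Fin e ⊕ (Fin e ⊕ Fin e) :=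
  ⟨fun a => Sum.inr (Sum.inr a), fun a b h => by simpa using h⟩

lemma emb₁₂_ne_emb₃ (a : Fin e ⊕ Fin e) (b : Fin e) : emb₁₂ e a ≠ emb₃ e b := by
  rcases a with a | a
  · exact Sum.inl_ne_inr
  · exact fun h => Sum.inl_ne_inr (Sum.inr_injective h)

lemma emb₂₃_ne_emb₁ (a : Fin e ⊕ Fin e) (b : Fin e) : emb₂₃ e a ≠ emb₁ e b := by
  rcases a with a | a <;> exact Sum.inr_ne_inl

/-- Associativity of the formal group law, for the monomials `W^l`. -/
lemma assoc_powers (l : Fin e → ℕ) :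
    MvPowerSeries.subst (Sum.elim (fun a => MvPowerSeries.rename (emb₁₂ e) (W.toSeries a))
        fun a => MvPowerSeries.X (emb₃ e a)) (W.powers l) =
    MvPowerSeries.subst (Sum.elim (fun a => MvPowerSeries.X (emb₁ e a))
        fun a => MvPowerSeries.rename (emb₂₃ e) (W.toSeries a)) (W.powers l) := by
  have h₁ : MvPowerSeries.HasSubst (Sum.elim
      (fun a => MvPowerSeries.rename (emb₁₂ e) (W.toSeries a))
      fun a => (MvPowerSeries.X (emb₃ e a) : MvPowerSeries _ k)) :=
    MvPowerSeries.hasSubst_of_constantCoeff_zero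
      (by rintro (a | a) <;> simp [W.constantCoeff_toSeries])
  have h₂ : MvPowerSeries.HasSubst (Sum.elim
      (fun a => (MvPowerSeries.X (emb₁ e a) : MvPowerSeries _ k))
      fun a => MvPowerSeries.rename (emb₂₃ e) (W.toSeries a)) :=
    MvPowerSeries.hasSubst_of_constantCoeff_zero
      (by rintro (a | a) <;> simp [W.constantCoeff_toSeries])
  rw [powers, ← MvPowerSeries.coe_substAlgHom h₁, ← MvPowerSeries.coe_substAlgHom h₂, map_prod,
    map_prod]
  simp only [map_pow]
  simp only [MvPowerSeries.coe_substAlgHom h₁, MvPowerSeries.coe_substAlgHom h₂]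
  refine Finset.prod_congr rfl fun a _ => congrArg (· ^ l a) ?_
  have := W.assoc a
  simp only [MvPowerSeries.rename_eq_subst]
  have h₃ : (MvPowerSeries.X ∘ (emb₁₂ e) : _ → MvPowerSeries (Fin e ⊕ (Fin e ⊕ Fin e)) k) =
      Sum.elim (fun b => MvPowerSeries.X (Sum.inl b))
        (fun b => MvPowerSeries.X (Sum.inr (Sum.inl b))) := by
    ext1 (a | a) <;> rfl
  have h₄ : (MvPowerSeries.X ∘ (emb₂₃ e) : _ → MvPowerSeries (Fin e ⊕ (Fin e ⊕ Fin e)) k) =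
      Sum.elim (fun b => MvPowerSeries.X (Sum.inr (Sum.inl b)))
        (fun b => MvPowerSeries.X (Sum.inr (Sum.inr b))) := by
    ext1 (a | a) <;> rfl
  rw [h₃, h₄]
  exact this

/-- The coefficient of `X^i Y^j Z^j'` in `W(W(X, Y), Z)^l'`. -/
lemma sum_structConst_left (i j j' l' : Idx e p m) :
    MvPowerSeries.coeff (Finsupp.embDomain (emb₁₂ e) (expo (Sum.elim i j)) +
        Finsupp.embDomain (emb₃ e) (expo j'))
      (MvPowerSeries.subst (Sum.elim (fun a => MvPowerSeries.rename (emb₁₂ e) (W.toSeries a))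
        fun a => MvPowerSeries.X (emb₃ e a)) (W.powers fun a => l' a)) =
    ∑ l, W.structConst p m l j' l' * W.structConst p m i j l := by
  classical
  have h₁ : MvPowerSeries.HasSubst (Sum.elim
      (fun a => MvPowerSeries.rename (emb₁₂ e) (W.toSeries a))
      fun a => (MvPowerSeries.X (emb₃ e a) : MvPowerSeries _ k)) :=
    MvPowerSeries.hasSubst_of_constantCoeff_zero
      (by rintro (a | a) <;> simp [W.constantCoeff_toSeries])
  have hterm : ∀ d d' : Fin e →₀ ℕ, MvPowerSeries.coeff
      (Finsupp.embDomain (emb₁₂ e) (expo (Sum.elim i j)) + Finsupp.embDomain (emb₃ e) (expo j'))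
      ((pairExpo d d').prod fun s n => (Sum.elim
        (fun a => MvPowerSeries.rename (emb₁₂ e) (W.toSeries a))
        (fun a => (MvPowerSeries.X (emb₃ e a) : MvPowerSeries _ k)) s) ^ n) =
      if d' = expo j' then MvPowerSeries.coeff (expo (Sum.elim i j)) (W.powers d) else 0 := by
    intro d d'
    rw [prod_pairExpo]
    simp only [Sum.elim_inl, Sum.elim_inr, prod_X_pow_eq_monomial, ← map_pow, ← map_prod]
    exact coeff_rename_mul_monomial _ _ emb₁₂_ne_emb₃ _ _ _ _
  rw [MvPowerSeries.coeff_subst h₁, finsum_eq_sum_of_support_subset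
    (s := Finset.univ.map ⟨fun l : Idx e p m => pairExpo (expo l) (expo j'), fun l l' h =>
      expo_injective (DFunLike.coe_injective (pairExpo_injective h).1)⟩), Finset.sum_map]
  · refine Finset.sum_congr rfl fun l _ => ?_
    change _ • MvPowerSeries.coeff _ ((pairExpo (expo l) (expo j')).prod _) = _
    rw [hterm, if_pos rfl, smul_eq_mul, structConst_eq, structConst_eq, expo_sumElim]
    rfl
  · intro d hd
    obtain ⟨d, d', rfl⟩ := exists_pairExpo d
    rw [Function.mem_support, hterm] at hd
    rw [Finset.coe_map]
    split_ifs at hd with h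
    · subst h
      obtain ⟨l, rfl⟩ : ∃ l : Idx e p m, expo l = d := by
        refine exists_expo fun a => ?_
        by_contra! ha
        rw [expo_sumElim, W.coeff_powers_eq_zero i j ha, smul_zero] at hd
        exact hd rfl
      exact ⟨l, by simp, rfl⟩
    · simp at hd

/-- The coefficient of `X^i Y^j Z^j'` in `W(X, W(Y, Z))^l'`. -/
lemma sum_structConst_right (i j j' l' : Idx e p m) :
    MvPowerSeries.coeff (Finsupp.embDomain (emb₂₃ e) (expo (Sum.elim j j')) +
        Finsupp.embDomain (emb₁ e) (expo i))
      (MvPowerSeries.subst (Sum.elim (fun a => MvPowerSeries.X (emb₁ e a))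
        fun a => MvPowerSeries.rename (emb₂₃ e) (W.toSeries a)) (W.powers fun a => l' a)) =
    ∑ l, W.structConst p m i l l' * W.structConst p m j j' l := by
  classical
  have h₁ : MvPowerSeries.HasSubst (Sum.elim
      (fun a => (MvPowerSeries.X (emb₁ e a) : MvPowerSeries _ k))
      fun a => MvPowerSeries.rename (emb₂₃ e) (W.toSeries a)) :=
    MvPowerSeries.hasSubst_of_constantCoeff_zero
      (by rintro (a | a) <;> simp [W.constantCoeff_toSeries])
  have hterm : ∀ d d' : Fin e →₀ ℕ, MvPowerSeries.coeff
      (Finsupp.embDomain (emb₂₃ e) (expo (Sum.elim j j')) + Finsupp.embDomain (emb₁ e) (expo i))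
      ((pairExpo d d').prod fun s n => (Sum.elim
        (fun a => (MvPowerSeries.X (emb₁ e a) : MvPowerSeries _ k))
        (fun a => MvPowerSeries.rename (emb₂₃ e) (W.toSeries a)) s) ^ n) =
      if d = expo i then MvPowerSeries.coeff (expo (Sum.elim j j')) (W.powers d') else 0 := by
    intro d d'
    rw [prod_pairExpo, mul_comm]
    simp only [Sum.elim_inl, Sum.elim_inr, prod_X_pow_eq_monomial, ← map_pow, ← map_prod]
    exact coeff_rename_mul_monomial _ _ emb₂₃_ne_emb₁ _ _ _ _
  rw [MvPowerSeries.coeff_subst h₁, finsum_eq_sum_of_support_subset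
    (s := Finset.univ.map ⟨fun l : Idx e p m => pairExpo (expo i) (expo l), fun l l' h =>
      expo_injective (DFunLike.coe_injective (pairExpo_injective h).2)⟩), Finset.sum_map]
  · refine Finset.sum_congr rfl fun l _ => ?_
    change _ • MvPowerSeries.coeff _ ((pairExpo (expo i) (expo l)).prod _) = _
    rw [hterm, if_pos rfl, smul_eq_mul, structConst_eq, structConst_eq, expo_sumElim]
    rfl
  · intro d hd
    obtain ⟨d, d', rfl⟩ := exists_pairExpo d
    rw [Function.mem_support, hterm] at hd
    rw [Finset.coe_map]
    split_ifs at hd with h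
    · subst h
      obtain ⟨l, rfl⟩ : ∃ l : Idx e p m, expo l = d' := by
        refine exists_expo fun a => ?_
        by_contra! ha
        rw [expo_sumElim, W.coeff_powers_eq_zero j j' ha, smul_zero] at hd
        exact hd rfl
      exact ⟨l, by simp, rfl⟩
    · simp at hd

/-- Coassociativity of `W[m]` in terms of the structure constants. -/
lemma structConst_coassoc (i j j' l' : Idx e p m) :
    ∑ l, W.structConst p m l j' l' * W.structConst p m i j l =
      ∑ l, W.structConst p m i l l' * W.structConst p m j j' l := by
  rw [← sum_structConst_left, ← sum_structConst_right, assoc_powers]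
  congr 2
  refine Finsupp.ext ?_
  have h₁ := embDomain_add_apply_left _ _ (emb₁₂_ne_emb₃ (e := e)) (expo (Sum.elim i j)) (expo j')
  have h₂ := embDomain_add_apply_right _ _ (emb₁₂_ne_emb₃ (e := e)) (expo (Sum.elim i j)) (expo j')
  have h₃ := embDomain_add_apply_left _ _ (emb₂₃_ne_emb₁ (e := e)) (expo (Sum.elim j j')) (expo i)
  have h₄ := embDomain_add_apply_right _ _ (emb₂₃_ne_emb₁ (e := e)) (expo (Sum.elim j j')) (expo i)
  rintro (a | a | a)
  · exact (h₁ (Sum.inl a)).trans (h₄ a).symm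
  · exact (h₁ (Sum.inr a)).trans (h₃ (Sum.inl a)).symm
  · exact (h₂ a).trans (h₃ (Sum.inr a)).symm

end

end FormalGroupLaw

/-! ### Actions of a truncated formal group law on commutative rings -/

section GAct

variable {e : ℕ} {k : Type*} [CommRing k] (W : FormalGroupLaw e k) (p m : ℕ) [Fact p.Prime]

/-- A `W[m]`-iterative truncated Hasse-Schmidt derivation `D` over `k` on the ring `R`, whose
`k`-algebra structure is given by `ι`; equivalently, an action of `W[m]` on `Spec R` over `k`. -/
structure GAct {R : Type*} [CommRing R] (ι : k →+* R) (D : Idx e p m → R → R) : Prop where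
  zero : ∀ x, D 0 x = x
  add : ∀ i x y, D i (x + y) = D i x + D i y
  smul : ∀ i c x, D i (ι c * x) = ι c * D i x
  mul : ∀ i x y, D i (x * y) = ∑ jl ∈ splits i, D jl.1 x * D jl.2 y
  iter : ∀ i j x, D j (D i x) = ∑ l, ι (W.structConst p m i j l) * D l x

variable {W p m} {R : Type*} [CommRing R] {ι : k →+* R} {D : Idx e p m → R → R}

section Aug

variable {σ : Type*} [Fintype σ]

/-- The augmentation of the truncated polynomial ring: the constant coefficient. -/
def taug : Trunc σ (p ^ m) R →+* R :=
  Ideal.Quotient.lift _ MvPowerSeries.constantCoeff fun _ hf => by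
    rw [← MvPowerSeries.coeff_zero_eq_constantCoeff_apply]
    exact hf 0 fun _ => NeZero.pos _

lemma tcoeff_zero (x : Trunc σ (p ^ m) R) : tcoeff 0 x = taug x := by
  obtain ⟨f, rfl⟩ := Ideal.Quotient.mk_surjective x
  have : expo (0 : σ → Fin (p ^ m)) = 0 := by ext; simp
  rw [tcoeff_mk, this]
  rfl

lemma taug_truncMap {S : Type*} [CommRing S] (φ : R →+* S) (x : Trunc σ (p ^ m) R) :
    taug (truncMap φ x) = φ (taug x) := by
  rw [← tcoeff_zero, tcoeff_truncMap, tcoeff_zero]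

lemma tcoeff_algebraMap' (i : σ → Fin (p ^ m)) (r : R) [Decidable (i = 0)] :
    tcoeff i (algebraMap R (Trunc σ (p ^ m) R) r) = if i = 0 then r else 0 := by
  rw [tcoeff_algebraMap]
  refine if_congr ?_ rfl rfl
  exact ⟨fun h => funext fun a => Fin.ext (h a), fun h a => by rw [h]; rfl⟩

lemma trunc_pow' [CharP R p] (x : Trunc σ (p ^ m) R) :
    x ^ p ^ m = algebraMap R _ (taug x ^ p ^ m) := by
  rw [trunc_pow, ← tcoeff_zero]
  rfl

/-- An element of the truncated polynomial ring with invertible constant coefficient is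
invertible. -/
lemma isUnit_trunc [CharP R p] {x : Trunc σ (p ^ m) R} (hx : IsUnit (taug x)) : IsUnit x := by
  rw [← isUnit_pow_iff (NeZero.ne (p ^ m)), trunc_pow']
  exact (hx.pow _).map _

end Aug

/-- The coaction `x ↦ ∑ D_i(x) v^i` as a ring homomorphism. -/
def GAct.hom [CharP R p] (h : GAct W p m ι D) : R →+* Trunc (Fin e) (p ^ m) R :=
  have hmul : ∀ x y : R, (ofCoeffs fun i => D i (x * y) : Trunc (Fin e) (p ^ m) R) =
      ofCoeffs (fun i => D i x) * ofCoeffs fun i => D i y := fun x y =>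
    Trunc.ext fun i => by simp [tcoeff_mul, h.mul]
  { toFun := fun x => ofCoeffs fun i => D i x
    map_one' := by
      -- the image of `1` is an idempotent with constant coefficient `1`, hence a unit
      have h1 := hmul 1 1
      rw [mul_one] at h1
      have hu : IsUnit (ofCoeffs fun i => D i 1 : Trunc (Fin e) (p ^ m) R) := isUnit_trunc <| by
        rw [← tcoeff_zero, tcoeff_ofCoeffs, h.zero]
        exact isUnit_one
      exact (hu.mul_eq_left.1 h1.symm)
    map_mul' := hmul
    map_zero' := Trunc.ext fun i => by
      rw [tcoeff_ofCoeffs, map_zero]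
      simpa using h.add i 0 0
    map_add' := fun x y => Trunc.ext fun i => by simp [h.add] }

@[simp] lemma GAct.tcoeff_hom [CharP R p] (h : GAct W p m ι D) (i : Idx e p m) (x : R) :
    tcoeff i (h.hom x) = D i x :=
  tcoeff_ofCoeffs (fun i => D i x) i

lemma GAct.taug_hom [CharP R p] (h : GAct W p m ι D) (x : R) : taug (h.hom x) = x := by
  rw [← tcoeff_zero, h.tcoeff_hom, h.zero]

lemma GAct.hom_algebraMap [CharP R p] (h : GAct W p m ι D) (c : k) :
    h.hom (ι c) = algebraMap R _ (ι c) := Trunc.ext fun i => by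
  have h1 : D i (ι c) = ι c * D i 1 := by rw [← h.smul, mul_one]
  have h2 := h.tcoeff_hom i 1
  rw [map_one, ← map_one (algebraMap R _), tcoeff_algebraMap'] at h2
  rw [h.tcoeff_hom, tcoeff_algebraMap', h1, ← h2]
  split_ifs <;> simp

/-- The condition that a ring homomorphism `ρ : R → R[v]/(v^(p^m))` is a coaction up to
coassociativity: it is compatible with the augmentation and `k`-linear. -/
structure IsPreCoaction (ι : k →+* R) (ρ : R →+* Trunc (Fin e) (p ^ m) R) : Prop where
  aug : ∀ x, taug (ρ x) = x
  const : ∀ c, ρ (ι c) = algebraMap R _ (ι c)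

lemma structConst_zero [CharP k p] (i j : Idx e p m) :
    W.structConst p m i j 0 = if i = 0 ∧ j = 0 then 1 else 0 := by
  classical
  rw [FormalGroupLaw.structConst_eq]
  have : (W.powers fun a => ((0 : Idx e p m) a : ℕ)) = 1 := by simp [FormalGroupLaw.powers]
  rw [this, MvPowerSeries.coeff_one]
  refine if_congr ?_ rfl rfl
  constructor
  · intro h
    have h' := fun s => DFunLike.congr_fun h s
    exact ⟨funext fun a => Fin.ext (h' (Sum.inl a)), funext fun a => Fin.ext (h' (Sum.inr a))⟩
  · rintro ⟨rfl, rfl⟩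
    refine Finsupp.ext ?_
    rintro (a | a) <;> rfl

variable {ρ : R →+* Trunc (Fin e) (p ^ m) R}

/-- Elements on which the coaction is trivial satisfy the iterativity identities. -/
lemma iter_of_const [CharP k p] (W : FormalGroupLaw e k) (ι : k →+* R) {x : R}
    (hx : ρ x = algebraMap R _ x) (i j : Idx e p m) :
    tcoeff j (ρ (tcoeff i (ρ x))) =
      ∑ l, ι (W.structConst p m i j l) * tcoeff l (ρ x) := by
  rw [hx, Finset.sum_eq_single 0]
  · rw [structConst_zero, tcoeff_algebraMap', tcoeff_algebraMap', if_pos rfl]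
    by_cases hi : i = 0
    · rw [if_pos hi, hx, tcoeff_algebraMap']
      by_cases hj : j = 0 <;> simp [hi, hj]
    · simp [hi]
  · intro l _ hl
    rw [tcoeff_algebraMap', if_neg hl, mul_zero]
  · simp

lemma sum_comm_four {α β γ δ M : Type*} [AddCommMonoid M] (s : Finset α) (t : Finset β)
    (u : Finset γ) (v : Finset δ) (f : α → β → γ → δ → M) :
    ∑ a ∈ s, ∑ b ∈ t, ∑ c ∈ u, ∑ d ∈ v, f a b c d =
      ∑ c ∈ u, ∑ d ∈ v, ∑ a ∈ s, ∑ b ∈ t, f a b c d := by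
  rw [← Finset.sum_product' s t, ← Finset.sum_product' u v]
  simp only [← Finset.sum_product' u v, ← Finset.sum_product' s t]
  exact Finset.sum_comm

variable (W) in
/-- The subring of the elements satisfying the iterativity identities. -/
def iterSubring [CharP k p] (_hρ : IsPreCoaction ι ρ) : Subring R where
  carrier := {x | ∀ i j, tcoeff j (ρ (tcoeff i (ρ x))) =
    ∑ l, ι (W.structConst p m i j l) * tcoeff l (ρ x)}
  zero_mem' := iter_of_const W ι (by simp)
  one_mem' := iter_of_const W ι (by simp)
  add_mem' := fun {x y} hx hy i j => by
    simp only [map_add, hx i j, hy i j, mul_add, Finset.sum_add_distrib]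
  neg_mem' := fun {x} hx i j => by
    simp only [map_neg, hx i j, mul_neg, Finset.sum_neg_distrib]
  mul_mem' := fun {x y} hx hy i j => by
    calc tcoeff j (ρ (tcoeff i (ρ (x * y))))
        = ∑ s ∈ splits i, ∑ t ∈ splits j,
          (∑ l, ι (W.structConst p m s.1 t.1 l) * tcoeff l (ρ x)) *
            ∑ l, ι (W.structConst p m s.2 t.2 l) * tcoeff l (ρ y) := by
          rw [map_mul, tcoeff_mul, map_sum, map_sum]
          refine Finset.sum_congr rfl fun s _ => ?_
          rw [map_mul, tcoeff_mul]
          refine Finset.sum_congr rfl fun t _ => ?_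
          rw [hx, hy]
      _ = ∑ l, ∑ l', (∑ s ∈ splits i, ∑ t ∈ splits j,
            ι (W.structConst p m s.1 t.1 l * W.structConst p m s.2 t.2 l')) *
              (tcoeff l (ρ x) * tcoeff l' (ρ y)) := by
          simp_rw [Finset.sum_mul_sum]
          rw [sum_comm_four]
          simp only [Finset.sum_mul]
          refine Finset.sum_congr rfl fun l _ => Finset.sum_congr rfl fun l' _ =>
            Finset.sum_congr rfl fun s _ => Finset.sum_congr rfl fun t _ => ?_
          rw [map_mul]
          ring
      _ = ∑ l : Idx e p m × Idx e p m, ∑ n : Idx e p m,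
            if ∀ a, (l.1 a : ℕ) + (l.2 a : ℕ) = (n a : ℕ) then
              ι (W.structConst p m i j n) * (tcoeff l.1 (ρ x) * tcoeff l.2 (ρ y)) else 0 := by
          rw [← Finset.sum_product']
          refine Finset.sum_congr rfl fun l _ => ?_
          simp only [← map_sum]
          rw [W.sum_structConst_mul]
          split_ifs with h
          · rw [Finset.sum_eq_single fun a => ⟨l.1 a + l.2 a, h a⟩]
            · simp
            · intro n _ hn
              rw [if_neg]
              exact fun h' => hn (funext fun a => Fin.ext (h' a).symm)
            · simp
          · rw [map_zero, zero_mul, Finset.sum_eq_zero]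
            intro n _
            rw [if_neg]
            exact fun h' => h fun a => by rw [h' a]; exact (n a).2
      _ = ∑ l, ι (W.structConst p m i j l) * tcoeff l (ρ (x * y)) := by
          rw [Finset.sum_comm]
          refine Finset.sum_congr rfl fun n _ => ?_
          rw [map_mul, tcoeff_mul, Finset.mul_sum, ← Finset.sum_filter]
          congr!

/-- Inverses of elements satisfying the iterativity identities satisfy them: `y = x⁻¹` is
`x^(p^m - 1) * y^(p^m)`, and the coaction is trivial on `p^m`-th powers. -/
lemma mem_iterSubring_of_mul_eq_one [CharP k p] [CharP R p] (hρ : IsPreCoaction ι ρ) {x y : R}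
    (hx : x ∈ iterSubring W hρ) (hxy : x * y = 1) : y ∈ iterSubring W hρ := by
  have hy : y ^ p ^ m ∈ iterSubring W hρ := iter_of_const W ι (by
    rw [map_pow, trunc_pow', hρ.aug])
  have : y = x ^ (p ^ m - 1) * y ^ p ^ m := by
    conv_rhs => rw [← Nat.sub_add_cancel (NeZero.one_le (n := p ^ m)), Nat.add_sub_cancel, pow_succ,
      ← mul_assoc, ← mul_pow, hxy, one_pow, one_mul]
  rw [this]
  exact mul_mem (pow_mem hx _) hy

lemma GAct.ofHom [CharP k p] (hρ : IsPreCoaction ι ρ) (htop : iterSubring W hρ = ⊤) :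
    GAct W p m ι fun i x => tcoeff i (ρ x) where
  zero x := by rw [tcoeff_zero, hρ.aug]
  add i x y := by simp
  smul i c x := by rw [map_mul, hρ.const, tcoeff_algebraMap_mul]
  mul i x y := by rw [map_mul, tcoeff_mul]
  iter i j x := (htop ▸ Subring.mem_top x : x ∈ iterSubring W hρ) i j

/-- If a ring homomorphism `f` intertwines coactions, its image satisfies the iterativity
identities. -/
lemma GAct.map_mem_iterSubring [CharP k p] {A : Type*} [CommRing A] [CharP A p] {ιA : k →+* A}
    {DA : Idx e p m → A → A} (h : GAct W p m ιA DA) (hρ : IsPreCoaction ι ρ) {f : A →+* R}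
    (hι : ∀ c, f (ιA c) = ι c) (hf : ∀ a, ρ (f a) = truncMap f (h.hom a)) (a : A) :
    f a ∈ iterSubring W hρ := fun i j => by
  simp only [hf, tcoeff_truncMap, h.tcoeff_hom]
  rw [h.iter, map_sum]
  simp only [map_mul, hι]

/-- The action of `W[m]` extends to localizations. -/
lemma GAct.exists_localization [CharP k p] {A : Type*} [CommRing A] [CharP A p] {ιA : k →+* A}
    {DA : Idx e p m → A → A} (h : GAct W p m ιA DA) (M : Submonoid A) (S : Type*) [CommRing S]
    [CharP S p] [Algebra A S] [IsLocalization M S] :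
    ∃ D : Idx e p m → S → S, GAct W p m ((algebraMap A S).comp ιA) D ∧
      ∀ i a, D i (algebraMap A S a) = algebraMap A S (DA i a) := by
  have hu : ∀ y : M, IsUnit (((truncMap (algebraMap A S)).comp h.hom) y) := fun y =>
    isUnit_trunc <| by
      rw [RingHom.comp_apply, taug_truncMap, h.taug_hom]
      exact IsLocalization.map_units S y
  set ρ : S →+* Trunc (Fin e) (p ^ m) S := IsLocalization.lift hu with hρdef
  have hρa : ∀ a, ρ (algebraMap A S a) = truncMap (algebraMap A S) (h.hom a) := fun a =>
    IsLocalization.lift_eq hu a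
  have hρ : IsPreCoaction ((algebraMap A S).comp ιA) ρ := by
    refine ⟨fun x => ?_, fun c => ?_⟩
    · have : taug.comp ρ = RingHom.id S := IsLocalization.ringHom_ext M <| RingHom.ext fun a => by
        simp only [RingHom.comp_apply, hρa, taug_truncMap, h.taug_hom, RingHom.id_apply]
      exact RingHom.congr_fun this x
    · rw [RingHom.comp_apply, hρa, h.hom_algebraMap, truncMap_algebraMap]
  have hmem : ∀ a, algebraMap A S a ∈ iterSubring W hρ :=
    h.map_mem_iterSubring hρ (fun _ => rfl) hρa
  refine ⟨_, GAct.ofHom hρ (eq_top_iff.2 fun x _ => ?_), fun i a => ?_⟩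
  · obtain ⟨a, s, rfl⟩ := IsLocalization.exists_mk'_eq M x
    have h1 : IsLocalization.mk' S a s = algebraMap A S a * IsLocalization.mk' S 1 s := by
      rw [← IsLocalization.mk'_eq_mul_mk'_one]
    rw [h1]
    refine mul_mem (hmem a) (mem_iterSubring_of_mul_eq_one hρ (hmem s) ?_)
    rw [← IsLocalization.mk'_eq_mul_mk'_one, IsLocalization.mk'_self]
  · rw [hρa, tcoeff_truncMap, h.tcoeff_hom]

open TensorProduct in
/-- Two actions of `W[m]` over a base on which the coactions agree induce an action on the tensor
product. -/
lemma GAct.exists_tensor [CharP k p] {F R₁ R₂ : Type*} [CommRing F] [CommRing R₁] [CommRing R₂]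
    [Algebra F R₁] [Algebra F R₂] [CharP R₁ p] [CharP R₂ p] {ι₁ : k →+* R₁} {ι₂ : k →+* R₂}
    {D₁ : Idx e p m → R₁ → R₁} {D₂ : Idx e p m → R₂ → R₂}
    (h₁ : GAct W p m ι₁ D₁) (h₂ : GAct W p m ι₂ D₂)
    (hι : ∀ c, (ι₁ c) ⊗ₜ[F] (1 : R₂) = (1 : R₁) ⊗ₜ[F] (ι₂ c))
    (hF : ∀ (f : F) i, D₁ i (algebraMap F R₁ f) ⊗ₜ[F] (1 : R₂) =
      (1 : R₁) ⊗ₜ[F] D₂ i (algebraMap F R₂ f)) :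
    ∃ D : Idx e p m → R₁ ⊗[F] R₂ → R₁ ⊗[F] R₂,
      GAct W p m (Algebra.TensorProduct.includeLeftRingHom.comp ι₁) D ∧
      (∀ i a, D i (a ⊗ₜ 1) = D₁ i a ⊗ₜ 1) ∧ ∀ i b, D i (1 ⊗ₜ b) = 1 ⊗ₜ D₂ i b := by
  set inl : R₁ →+* R₁ ⊗[F] R₂ := Algebra.TensorProduct.includeLeftRingHom
  set inr : R₂ →+* R₁ ⊗[F] R₂ := (Algebra.TensorProduct.includeRight : R₂ →ₐ[F] _).toRingHom
  have hinl : ∀ a, inl a = a ⊗ₜ 1 := fun _ => rfl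
  have hinr : ∀ b, inr b = 1 ⊗ₜ b := fun _ => rfl
  set g₁ := (truncMap inl).comp h₁.hom
  set g₂ := (truncMap inr).comp h₂.hom
  have hg : ∀ f : F, g₁ (algebraMap F R₁ f) = g₂ (algebraMap F R₂ f) := fun f =>
    Trunc.ext fun i => by
      simp only [g₁, g₂, RingHom.comp_apply, tcoeff_truncMap, GAct.tcoeff_hom]
      exact hF f i
  let ψ : R₁ ⊗[F] R₂ →+ Trunc (Fin e) (p ^ m) (R₁ ⊗[F] R₂) :=
    TensorProduct.liftAddHom
      ((AddMonoidHom.mul.comp g₁.toAddMonoidHom).compr₂ (AddMonoidHom.id _) |>.flip.comp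
        g₂.toAddMonoidHom).flip fun r a b => by
          change g₁ (r • a) * g₂ b = g₁ a * g₂ (r • b)
          rw [Algebra.smul_def, Algebra.smul_def, map_mul, map_mul, hg]
          ring
  have hψ : ∀ a b, ψ (a ⊗ₜ b) = g₁ a * g₂ b := fun a b => rfl
  let ρ : R₁ ⊗[F] R₂ →+* Trunc (Fin e) (p ^ m) (R₁ ⊗[F] R₂) :=
    { ψ with
      map_one' := by
        change ψ (1 ⊗ₜ 1) = 1
        rw [hψ, map_one, map_one, one_mul]
      map_mul' := fun x y => by
        change ψ (x * y) = ψ x * ψ y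
        induction x using TensorProduct.induction_on with
        | zero => simp
        | add x x' hx hx' => rw [add_mul, map_add, map_add, add_mul, hx, hx']
        | tmul a b =>
          induction y using TensorProduct.induction_on with
          | zero => simp
          | add y y' hy hy' => rw [mul_add, map_add, map_add, mul_add, hy, hy']
          | tmul a' b' =>
            rw [Algebra.TensorProduct.tmul_mul_tmul, hψ, hψ, hψ, map_mul, map_mul]
            ring }
  have hρ₁ : ∀ a, ρ (inl a) = truncMap inl (h₁.hom a) := fun a =>
    (hψ a 1).trans (by rw [map_one, mul_one]; rfl)
  have hρ₂ : ∀ b, ρ (inr b) = truncMap inr (h₂.hom b) := fun b =>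
    (hψ 1 b).trans (by rw [map_one, one_mul]; rfl)
  have htmul : ∀ a b, a ⊗ₜ[F] b = inl a * inr b := fun a b => by
    rw [hinl, hinr, Algebra.TensorProduct.tmul_mul_tmul, one_mul, mul_one]
  have hρ : IsPreCoaction (inl.comp ι₁) ρ := by
    refine ⟨fun x => ?_, fun c => ?_⟩
    · induction x using TensorProduct.induction_on with
      | zero => simp
      | add x y hx hy => rw [map_add, map_add, hx, hy]
      | tmul a b =>
        rw [htmul, map_mul, map_mul, hρ₁, hρ₂, taug_truncMap, taug_truncMap, h₁.taug_hom,
          h₂.taug_hom]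
    · rw [RingHom.comp_apply, hρ₁, h₁.hom_algebraMap, truncMap_algebraMap]
  refine ⟨_, GAct.ofHom hρ (eq_top_iff.2 fun x _ => ?_), fun i a => ?_, fun i b => ?_⟩
  · induction x using TensorProduct.induction_on with
    | zero => exact zero_mem _
    | add x y hx hy => exact add_mem (hx trivial) (hy trivial)
    | tmul a b =>
      rw [htmul]
      exact mul_mem (h₁.map_mem_iterSubring hρ (fun _ => rfl) hρ₁ a)
        (h₂.map_mem_iterSubring hρ (fun c => (hι c).symm) hρ₂ b)
  · rw [← hinl, hρ₁, tcoeff_truncMap, h₁.tcoeff_hom]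
    rfl
  · rw [← hinr, hρ₂, tcoeff_truncMap, h₂.tcoeff_hom]
    rfl

/-- The polynomial ring in the variables `y_{b,i}`, `b ∈ β`, `i ∈ [p^m]^e`, is the ring freely
generated over `R` by elements `y_{b,0}` with `D_i(y_{b,0}) = y_{b,i}`. -/
lemma GAct.exists_mvPolynomial [CharP k p] [CharP R p] (h : GAct W p m ι D) (β : Type*) :
    ∃ D' : Idx e p m → MvPolynomial (β × Idx e p m) R → MvPolynomial (β × Idx e p m) R,
      GAct W p m (MvPolynomial.C.comp ι) D' ∧
      (∀ i a, D' i (MvPolynomial.C a) = MvPolynomial.C (D i a)) ∧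
      ∀ i b, D' i (MvPolynomial.X (b, 0)) = MvPolynomial.X (b, i) := by
  set P := MvPolynomial (β × Idx e p m) R
  let Y : β × Idx e p m → Trunc (Fin e) (p ^ m) P := fun y =>
    ofCoeffs fun j => ∑ l, MvPolynomial.C (ι (W.structConst p m y.2 j l)) * MvPolynomial.X (y.1, l)
  let ρ : P →+* Trunc (Fin e) (p ^ m) P :=
    MvPolynomial.eval₂Hom ((truncMap MvPolynomial.C).comp h.hom) Y
  have hρC : ∀ a, ρ (MvPolynomial.C a) = truncMap MvPolynomial.C (h.hom a) := fun a =>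
    MvPolynomial.eval₂Hom_C _ _ _
  have hρX : ∀ y, ρ (MvPolynomial.X y) = Y y := fun y => MvPolynomial.eval₂Hom_X' _ _ _
  have hρ : IsPreCoaction (MvPolynomial.C.comp ι) ρ := by
    refine ⟨fun x => ?_, fun c => ?_⟩
    · have : taug.comp ρ = RingHom.id P := by
        refine MvPolynomial.ringHom_ext (fun a => ?_) fun y => ?_
        · simp only [RingHom.comp_apply, hρC, taug_truncMap, h.taug_hom]
          rfl
        · rw [RingHom.comp_apply, hρX, ← tcoeff_zero, tcoeff_ofCoeffs]
          simp only [W.structConst_zero_right]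
          simp
          rfl
      exact RingHom.congr_fun this x
    · rw [RingHom.comp_apply, hρC, h.hom_algebraMap, truncMap_algebraMap]
  refine ⟨_, GAct.ofHom hρ (eq_top_iff.2 fun x _ => ?_), fun i a => ?_, fun i b => ?_⟩
  · induction x using MvPolynomial.induction_on with
    | C a => exact h.map_mem_iterSubring hρ (fun _ => rfl) hρC a
    | add x y hx hy => exact add_mem (hx trivial) (hy trivial)
    | mul_X x y hx =>
      refine mul_mem (hx trivial) fun i j => ?_
      have hcomp : ∀ i j, tcoeff j (ρ (MvPolynomial.X (y.1, i))) =
          ∑ l, MvPolynomial.C (ι (W.structConst p m i j l)) * MvPolynomial.X (y.1, l) := by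
        intro i j
        rw [hρX, tcoeff_ofCoeffs]
      rw [show y = (y.1, y.2) from rfl, hcomp, map_sum, map_sum]
      simp only [hcomp]
      have hcoef : ∀ l, tcoeff j (ρ (MvPolynomial.C (ι (W.structConst p m y.2 i l)) *
          MvPolynomial.X (y.1, l))) = ∑ l', MvPolynomial.C (ι (W.structConst p m y.2 i l *
            W.structConst p m l j l')) * MvPolynomial.X (y.1, l') := by
        intro l
        have := hρ.const (W.structConst p m y.2 i l)
        rw [RingHom.comp_apply] at this
        rw [map_mul, this, tcoeff_algebraMap_mul, hcomp, Finset.mul_sum]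
        simp only [map_mul, mul_assoc]
      simp only [hcoef, Finset.mul_sum, RingHom.comp_apply]
      rw [Finset.sum_comm]
      conv_rhs => rw [Finset.sum_comm]
      refine Finset.sum_congr rfl fun l' _ => ?_
      simp only [← mul_assoc, ← map_mul, ← Finset.sum_mul, ← map_sum]
      congr 3
      simpa only [mul_comm] using W.structConst_coassoc y.2 i j l'
  · rw [hρC, tcoeff_truncMap, h.tcoeff_hom]
  · rw [hρX, tcoeff_ofCoeffs]
    simp [W.structConst_zero_left]

end GAct

/-! ### Constants -/

section Constants

variable {e : ℕ} {k : Type*} [CommRing k] {W : FormalGroupLaw e k} {p m : ℕ} [Fact p.Prime]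
  {K : Type*} [Field K] [CharP K p] {ι : k →+* K} {D : Idx e p m → K → K}

/-- The field of constants: the elements on which the coaction is trivial. -/
def GAct.constants (h : GAct W p m ι D) : Subfield K where
  __ := RingHom.eqLocus h.hom (algebraMap K _)
  inv_mem' x hx := by
    by_cases h0 : x = 0
    · simp [h0]
    change h.hom x = algebraMap K _ x at hx
    change h.hom x⁻¹ = algebraMap K _ x⁻¹
    calc h.hom x⁻¹ = h.hom x⁻¹ * algebraMap K _ (x * x⁻¹) := by
          rw [mul_inv_cancel₀ h0, map_one, mul_one]
      _ = h.hom (x⁻¹ * x) * algebraMap K _ x⁻¹ := by rw [map_mul, map_mul, ← hx]; ring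
      _ = _ := by rw [inv_mul_cancel₀ h0, map_one, one_mul]

lemma GAct.mem_constants_iff (h : GAct W p m ι D) {x : K} :
    x ∈ h.constants ↔ h.hom x = algebraMap K _ x := Iff.rfl

lemma GAct.mem_constants (h : GAct W p m ι D) {x : K} :
    x ∈ h.constants ↔ ∀ i, i ≠ 0 → D i x = 0 := by
  rw [h.mem_constants_iff]
  constructor
  · intro hx i hi
    rw [← h.tcoeff_hom, hx, tcoeff_algebraMap', if_neg hi]
  · intro hx
    refine Trunc.ext fun i => ?_
    rw [h.tcoeff_hom, tcoeff_algebraMap']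
    split_ifs with hi
    · rw [hi, h.zero]
    · exact hx i hi

lemma GAct.const_mul (h : GAct W p m ι D) {c : K} (hc : c ∈ h.constants) (i : Idx e p m) (x : K) :
    D i (c * x) = c * D i x := by
  rw [← h.tcoeff_hom, ← h.tcoeff_hom i x, map_mul, h.mem_constants_iff.1 hc, tcoeff_algebraMap_mul]

lemma GAct.pow_mem_constants (h : GAct W p m ι D) (x : K) : x ^ p ^ m ∈ h.constants := by
  rw [h.mem_constants_iff, map_pow, trunc_pow', h.taug_hom]

lemma GAct.algebraMap_mem_constants (h : GAct W p m ι D) (c : k) : ι c ∈ h.constants :=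
  h.hom_algebraMap c

lemma splits_eq_zero_left {i : Idx e p m} {s : Idx e p m × Idx e p m} (hs : s ∈ splits i)
    (h0 : s.1 = 0) : s.2 = i := funext fun a => Fin.ext <| by
  have := mem_splits.1 hs a
  rw [h0] at this
  simpa using this

lemma splits_eq_left {i : Idx e p m} {s : Idx e p m × Idx e p m} (hs : s ∈ splits i)
    (h0 : s.1 = i) : s.2 = 0 := funext fun a => Fin.ext <| by
  have := mem_splits.1 hs a
  rw [h0] at this
  simpa using this

omit [Fact p.Prime] in
lemma splits_le {i : Idx e p m} {s : Idx e p m × Idx e p m} (hs : s ∈ splits i) : s.1 ≤ i :=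
  fun a => Fin.le_def.2 <| by
    have := mem_splits.1 hs a
    omega

/-- If the square matrix `(D_j(z_i))` is invertible, then every element of `K` is a linear
combination of the `z_i` with constant coefficients: the coefficients that solve the linear system
`D_j(y) = ∑ f_i D_j(z_i)` are constants. -/
lemma GAct.exists_constants_coeff (h : GAct W p m ι D) (z : Idx e p m → K)
    (hinj : ∀ f : Idx e p m → K, (∀ j, ∑ i, f i * D j (z i) = 0) → f = 0)
    (y : K) (f : Idx e p m → K) (hf : ∀ j, ∑ i, f i * D j (z i) = D j y) (i : Idx e p m) :
    f i ∈ h.constants := by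
  rw [h.mem_constants]
  intro l
  revert i
  induction l using WellFoundedLT.induction with
  | ind l ih =>
    intro i hl
    have hD : ∀ l (s : Finset (Idx e p m)) (g : Idx e p m → K), D l (∑ i ∈ s, g i) = ∑ i ∈ s, D l (g i) := by
      intro l s g
      simp only [← h.tcoeff_hom, map_sum]
    suffices (fun i => D l (f i)) = 0 from congrFun this i
    refine hinj _ fun j => ?_
    have h1 : D l (D j y) = ∑ i, f i * D l (D j (z i)) := by
      rw [h.iter]
      simp only [h.iter, ← hf, Finset.mul_sum]
      rw [Finset.sum_comm]
      refine Finset.sum_congr rfl fun i _ => Finset.sum_congr rfl fun n _ => by ring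
    rw [← hf, hD] at h1
    have h2 : ∀ i, D l (f i * D j (z i)) = f i * D l (D j (z i)) + D l (f i) * D j (z i) := by
      intro i
      have hmem1 : ((0 : Idx e p m), l) ∈ splits l := by simp
      have hmem2 : (l, (0 : Idx e p m)) ∈ splits l := by simp
      rw [h.mul, ← Finset.add_sum_erase _ _ hmem1, ← Finset.add_sum_erase _ _ (a := (l, 0)),
        Finset.sum_eq_zero]
      · simp only [h.zero, add_zero]
      · intro s hs
        rw [Finset.mem_erase, Finset.mem_erase] at hs
        have h0 : s.1 ≠ 0 := fun h0 => hs.2.1 (Prod.ext h0 (splits_eq_zero_left hs.2.2 h0))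
        have h1 : s.1 ≠ l := fun h1 => hs.1 (Prod.ext h1 (splits_eq_left hs.2.2 h1))
        rw [ih s.1 (lt_of_le_of_ne (splits_le hs.2.2) h1) i h0, zero_mul]
      · rw [Finset.mem_erase]
        exact ⟨fun h0 => hl (congrArg Prod.fst h0), hmem2⟩
    simp only [h2, Finset.sum_add_distrib] at h1
    simpa using h1

end Constants

/-! ### Bases over the constants -/

section Jacobian

variable {e : ℕ} {p m : ℕ} {R : Type*} [CommRing R]

/-- The total degree of a multi-index. -/
def deg (i : Idx e p m) : ℕ := ∑ a, (i a : ℕ)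

/-- Vanishing of the coefficients of degree less than `n`. -/
def OrdGE (n : ℕ) (t : Trunc (Fin e) (p ^ m) R) : Prop := ∀ i : Idx e p m, deg i < n → tcoeff i t = 0

lemma OrdGE.mul {n n' : ℕ} {s t : Trunc (Fin e) (p ^ m) R} (hs : OrdGE n s) (ht : OrdGE n' t) :
    OrdGE (n + n') (s * t) := fun i hi => by
  rw [tcoeff_mul]
  refine Finset.sum_eq_zero fun x hx => ?_
  have hx' := mem_splits.1 hx
  have : deg x.1 + deg x.2 = deg i := by
    rw [deg, deg, deg, ← Finset.sum_add_distrib]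
    exact Finset.sum_congr rfl fun a _ => hx' a
  by_cases h : deg x.1 < n
  · rw [hs _ h, zero_mul]
  · rw [ht x.2 (by omega), mul_zero]

lemma OrdGE.mono {n n' : ℕ} (h : n ≤ n') {t : Trunc (Fin e) (p ^ m) R} (ht : OrdGE n' t) :
    OrdGE n t := fun i hi => ht i (hi.trans_le h)

lemma OrdGE.add {n : ℕ} {s t : Trunc (Fin e) (p ^ m) R} (hs : OrdGE n s) (ht : OrdGE n t) :
    OrdGE n (s + t) := fun i hi => by rw [map_add, hs i hi, ht i hi, add_zero]

/-- `s` and `t` have the same homogeneous part of degree `n` and no parts of lower degree. -/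
def SameInitial (n : ℕ) (s t : Trunc (Fin e) (p ^ m) R) : Prop := OrdGE (n + 1) (s - t) ∧ OrdGE n t

lemma SameInitial.mul {n n' : ℕ} {s t s' t' : Trunc (Fin e) (p ^ m) R} (h : SameInitial n s t)
    (h' : SameInitial n' s' t') : SameInitial (n + n') (s * s') (t * t') := by
  refine ⟨?_, h.2.mul h'.2⟩
  have hs' : OrdGE n' s' := by
    have := (h'.1.mono (Nat.le_succ n')).add h'.2
    rwa [sub_add_cancel] at this
  have h1 := (h.1.mul hs').add ((h.2.mul h'.1).mono (by omega : n + 1 + n' ≤ _))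
  have h2 : s * s' - t * t' = (s - t) * s' + t * (s' - t') := by ring
  rw [h2]
  exact h1.mono (by omega)

lemma SameInitial.one : SameInitial 0 (1 : Trunc (Fin e) (p ^ m) R) 1 :=
  ⟨fun i _ => by rw [sub_self, map_zero], fun i hi => absurd hi (by omega)⟩

lemma SameInitial.pow {n : ℕ} {s t : Trunc (Fin e) (p ^ m) R} (h : SameInitial n s t) (r : ℕ) :
    SameInitial (r * n) (s ^ r) (t ^ r) := by
  induction r with
  | zero => simpa using SameInitial.one
  | succ r ih =>
    rw [pow_succ, pow_succ, Nat.succ_mul]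
    exact ih.mul h

lemma SameInitial.prod {α : Type*} (S : Finset α) (n : α → ℕ)
    (s t : α → Trunc (Fin e) (p ^ m) R) (h : ∀ a ∈ S, SameInitial (n a) (s a) (t a)) :
    SameInitial (∑ a ∈ S, n a) (∏ a ∈ S, s a) (∏ a ∈ S, t a) := by
  classical
  induction S using Finset.induction_on with
  | empty => simpa using SameInitial.one
  | insert a S ha ih =>
    rw [Finset.sum_insert ha, Finset.prod_insert ha, Finset.prod_insert ha]
    exact (h a (Finset.mem_insert_self a S)).mul
      (ih fun b hb => h b (Finset.mem_insert_of_mem hb))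

lemma tcoeff_prod_tX (i j : Idx e p m) :
    tcoeff j (∏ a, (tX a : Trunc (Fin e) (p ^ m) R) ^ (i a : ℕ)) = if j = i then 1 else 0 := by
  classical
  have h1 := prod_X_pow_eq_monomial (R := R) (Function.Embedding.refl (Fin e)) (expo i)
  simp only [Function.Embedding.refl_apply, Finsupp.embDomain_refl, id, expo_apply] at h1
  have : (∏ a, (tX a : Trunc (Fin e) (p ^ m) R) ^ (i a : ℕ)) =
      Ideal.Quotient.mk _ (MvPowerSeries.monomial (expo i) 1) := by
    rw [← h1, map_prod]
    rfl
  rw [this, tcoeff_mk, MvPowerSeries.coeff_monomial]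
  exact if_congr expo_injective.eq_iff rfl rfl

variable [Fact p.Prime]

lemma unitIdx_val (hm : 0 < m) (a b : Fin e) :
    ((unitIdx a : Idx e p m) b : ℕ) = if b = a then 1 else 0 := by
  have h1 : 1 < p ^ m := Nat.one_lt_pow hm.ne' (Nat.Prime.one_lt Fact.out)
  rw [unitIdx, Pi.single_apply]
  split_ifs
  · rw [Fin.val_one', Nat.mod_eq_of_lt h1]
  · rfl

lemma unitIdx_ne_zero (hm : 0 < m) (a : Fin e) : (unitIdx a : Idx e p m) ≠ 0 := fun h => by
  have := unitIdx_val (p := p) hm a a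
  rw [h] at this
  simp at this

lemma eq_zero_of_deg_eq_zero {i : Idx e p m} (hi : deg i = 0) : i = 0 := by
  rw [deg, Finset.sum_eq_zero_iff] at hi
  exact funext fun a => Fin.ext (hi a (Finset.mem_univ a))

lemma exists_unitIdx (hm : 0 < m) {i : Idx e p m} (hi : deg i = 1) : ∃ a, i = unitIdx a := by
  obtain ⟨a, -, ha⟩ : ∃ a ∈ Finset.univ, (i a : ℕ) ≠ 0 := by
    by_contra! h
    rw [deg, Finset.sum_eq_zero h] at hi
    exact absurd hi (by norm_num)
  rw [deg, ← Finset.add_sum_erase _ _ (Finset.mem_univ a)] at hi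
  have h0 : ∑ b ∈ Finset.univ.erase a, (i b : ℕ) = 0 := by omega
  refine ⟨a, funext fun b => Fin.ext ?_⟩
  rw [unitIdx_val hm]
  split_ifs with hb
  · subst hb; omega
  · exact Finset.sum_eq_zero_iff.1 h0 b (Finset.mem_erase.2 ⟨hb, Finset.mem_univ b⟩)

lemma tcoeff_tX (hm : 0 < m) (a : Fin e) (j : Idx e p m) :
    tcoeff j (tX a : Trunc (Fin e) (p ^ m) R) = if j = unitIdx a then 1 else 0 := by
  rw [← tcoeff_prod_tX]
  congr 1
  rw [Finset.prod_eq_single a]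
  · rw [unitIdx_val hm, if_pos rfl, pow_one]
  · intro b _ hb
    rw [unitIdx_val hm, if_neg hb, pow_zero]
  · simp

/-- Elements `u_a` with the same linear parts as the coordinates generate the truncated polynomial
ring. -/
lemma mem_of_linear_part (A : Subalgebra R (Trunc (Fin e) (p ^ m) R)) (hm : 0 < m)
    (u : Fin e → Trunc (Fin e) (p ^ m) R) (huA : ∀ a, u a ∈ A)
    (h0 : ∀ a, tcoeff 0 (u a) = 0)
    (h1 : ∀ a c, tcoeff (unitIdx c) (u a) = if c = a then 1 else 0)
    (t : Trunc (Fin e) (p ^ m) R) : t ∈ A := by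
  have hinj : Function.Injective (unitIdx : Fin e → Idx e p m) := fun a b hab => by
    have := congrArg (fun i : Idx e p m => (i b : ℕ)) hab
    simp only [unitIdx_val hm, if_true] at this
    by_contra hne
    rw [if_neg (Ne.symm hne)] at this
    exact absurd this (by norm_num)
  have hu : ∀ a, SameInitial 1 (u a) (tX a) := by
    intro a
    constructor
    · intro i hi
      rw [map_sub, tcoeff_tX hm]
      rcases Nat.lt_succ_iff_lt_or_eq.1 hi with hi | hi
      · obtain rfl : i = 0 := eq_zero_of_deg_eq_zero (by omega)
        rw [h0, if_neg (unitIdx_ne_zero hm a).symm, sub_zero]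
      · obtain ⟨c, rfl⟩ := exists_unitIdx hm hi
        rw [h1, if_congr hinj.eq_iff rfl rfl, sub_self]
    · intro i hi
      obtain rfl : i = 0 := eq_zero_of_deg_eq_zero (by omega)
      rw [tcoeff_tX hm, if_neg (unitIdx_ne_zero hm a).symm]
  have hmon : ∀ i : Idx e p m, SameInitial (deg i) (∏ a, u a ^ (i a : ℕ))
      (∏ a, tX a ^ (i a : ℕ)) := by
    intro i
    have := SameInitial.prod Finset.univ _ _ _ fun a _ => (hu a).pow (i a : ℕ)
    simpa [deg] using this
  -- successive approximation: degrees above `e * p ^ m` do not occur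
  have key : ∀ r n, n + r = e * p ^ m + 1 → ∀ t, OrdGE n t → t ∈ A := by
    intro r
    induction r with
    | zero =>
      intro n hn t ht
      have : t = 0 := Trunc.ext fun i => by
        rw [map_zero]
        refine ht i ?_
        have : deg i ≤ ∑ _a : Fin e, p ^ m := Finset.sum_le_sum fun a _ => (i a).2.le
        rw [Finset.sum_const, Finset.card_univ, Fintype.card_fin, smul_eq_mul] at this
        omega
      rw [this]
      exact zero_mem A
    | succ r ih =>
      intro n hn t ht
      set s := ∑ i : Idx e p m with deg i = n, algebraMap R _ (tcoeff i t) * ∏ a, u a ^ (i a : ℕ)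
        with hs
      have hsA : s ∈ A := sum_mem fun i _ => mul_mem (A.algebraMap_mem _)
        (prod_mem fun a _ => pow_mem (huA a) _)
      have hts : OrdGE (n + 1) (t - s) := by
        intro j hj
        have hcoef : ∀ i : Idx e p m, deg i = n →
            tcoeff j (∏ a, u a ^ (i a : ℕ)) = if j = i then 1 else 0 := by
          intro i hi
          rw [← tcoeff_prod_tX, ← sub_eq_zero, ← map_sub]
          exact (hmon i).1 j (by omega)
        rw [map_sub, hs, map_sum, Finset.sum_congr rfl fun i hi => by
          rw [tcoeff_algebraMap_mul, hcoef i (Finset.mem_filter.1 hi).2] ]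
        simp only [mul_ite, mul_one, mul_zero, Finset.sum_ite_eq, Finset.mem_filter,
          Finset.mem_univ, true_and]
        split_ifs with hjn
        · exact sub_self _
        · rw [ht j (by omega), sub_zero]
      have := ih (n + 1) (by omega) _ hts
      rw [← sub_add_cancel t s]
      exact add_mem this hsA
  exact key _ 0 (zero_add _) t fun i hi => absurd hi (by omega)

end Jacobian

section Basis

variable {e : ℕ} {k : Type*} [CommRing k] {W : FormalGroupLaw e k} {p m : ℕ} [Fact p.Prime]
  {K : Type*} [Field K] [CharP K p] {ι : k →+* K} {D : Idx e p m → K → K}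

/-- The monomial `x^i`. -/
def mon {K : Type*} [CommMonoid K] {q : ℕ} (x : Fin e → K) (i : Fin e → Fin q) : K :=
  ∏ a, x a ^ (i a : ℕ)

/-- The family `x` has an invertible Jacobian matrix `(D_{(0,…,1,…,0)}(x_b))`, with inverse `Q`. -/
def JacInv (D : Idx e p m → K → K) (x : Fin e → K) (Q : Fin e → Fin e → K) : Prop :=
  ∀ c a, ∑ b, Q c b * D (unitIdx a) (x b) = if a = c then 1 else 0

variable {x : Fin e → K} {Q : Fin e → Fin e → K}

/-- The images of the monomials `x^i` under the coaction span the truncated polynomial ring. -/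
lemma GAct.exists_coeff_of_jacInv (h : GAct W p m ι D) (hm : 0 < m) (hx : JacInv D x Q)
    (t : Idx e p m → K) : ∃ f : Idx e p m → K, ∀ j, ∑ i, f i * D j (mon x i) = t j := by
  set S : Submodule K (Trunc (Fin e) (p ^ m) K) :=
    Submodule.span K (Set.range fun i : Idx e p m => h.hom (mon x i))
  have hpow : ∀ n : Fin e → ℕ, h.hom (∏ a, x a ^ n a) ∈ S := by
    intro n
    have h1 : ∏ a, x a ^ n a = (∏ a, x a ^ (n a / p ^ m)) ^ p ^ m *
        mon x fun a => (⟨n a % p ^ m, Nat.mod_lt _ (NeZero.pos _)⟩ : Fin (p ^ m)) := by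
      rw [mon, ← Finset.prod_pow, ← Finset.prod_mul_distrib]
      refine Finset.prod_congr rfl fun a _ => ?_
      rw [← pow_mul, ← pow_add, mul_comm, Nat.div_add_mod]
    rw [h1, map_mul, h.mem_constants_iff.1 (h.pow_mem_constants _), ← Algebra.smul_def]
    exact S.smul_mem _ (Submodule.subset_span ⟨_, rfl⟩)
  have hmul : S * S ≤ S := by
    rw [Submodule.span_mul_span, Submodule.span_le]
    rintro _ ⟨_, ⟨i, rfl⟩, _, ⟨j, rfl⟩, rfl⟩
    simp only [mon, SetLike.mem_coe]
    rw [← map_mul, ← Finset.prod_mul_distrib]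
    simp only [← pow_add]
    exact hpow _
  let A : Subalgebra K (Trunc (Fin e) (p ^ m) K) := S.toSubalgebra
    (by have := hpow 0; simpa using this) fun a b ha hb => hmul (Submodule.mul_mem_mul ha hb)
  have hA : ∀ b, h.hom (x b) ∈ A := fun b => by
    have := hpow (Pi.single b 1)
    rw [Finset.prod_eq_single b (by intro c _ hc; simp [hc]) (by simp), Pi.single_eq_same,
      pow_one] at this
    exact this
  -- the inverse Jacobian normalises the linear parts of the images of the `x_b`
  let u : Fin e → Trunc (Fin e) (p ^ m) K := fun a =>
    ∑ b, algebraMap K _ (Q a b) * (h.hom (x b) - algebraMap K _ (x b))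
  have huA : ∀ a, u a ∈ A := fun a => sum_mem fun b _ =>
    mul_mem (A.algebraMap_mem _) (sub_mem (hA b) (A.algebraMap_mem _))
  have htop := mem_of_linear_part A hm u huA
    (fun a => by simp [u, tcoeff_algebraMap_mul, tcoeff_algebraMap', h.zero])
    (fun a c => by
      simp [u, tcoeff_algebraMap_mul, tcoeff_algebraMap', unitIdx_ne_zero hm, hx a c])
    (ofCoeffs t)
  obtain ⟨f, hf⟩ := (Submodule.mem_span_range_iff_exists_fun K).1 htop
  refine ⟨f, fun j => ?_⟩
  have := congrArg (tcoeff j) hf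
  rw [tcoeff_ofCoeffs, map_sum] at this
  simpa [tcoeff_smul] using this

/-- The square matrix `(D_j(x^i))` is invertible, since its rows span. -/
lemma GAct.eq_zero_of_jacInv (h : GAct W p m ι D) (hm : 0 < m) (hx : JacInv D x Q)
    (f : Idx e p m → K) (hf : ∀ j, ∑ i, f i * D j (mon x i) = 0) : f = 0 := by
  let T : (Idx e p m → K) →ₗ[K] (Idx e p m → K) :=
    { toFun := fun f j => ∑ i, f i * D j (mon x i)
      map_add' := fun f g => by ext; simp [add_mul, Finset.sum_add_distrib]
      map_smul' := fun c f => by ext; simp [mul_assoc, Finset.mul_sum] }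
  have hsurj : Function.Surjective T := fun t => by
    obtain ⟨f, hf⟩ := h.exists_coeff_of_jacInv hm hx t
    exact ⟨f, funext hf⟩
  have hinj := LinearMap.injective_iff_surjective.2 hsurj
  exact hinj (by rw [map_zero]; exact funext hf)

/-- If `x` has an invertible Jacobian matrix, the monomials `x^i`, `i ∈ [p^m]^e`, are a basis of `K`
over its field of constants. -/
lemma GAct.exists_basis (h : GAct W p m ι D) (hm : 0 < m) (hx : JacInv D x Q) :
    ∃ b : Module.Basis (Idx e p m) h.constants K, ∀ i, b i = mon x i := by
  have hli : LinearIndependent h.constants (mon x : Idx e p m → K) := by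
    rw [Fintype.linearIndependent_iff]
    intro g hg i
    have := h.eq_zero_of_jacInv hm hx (fun i => (g i : K)) fun j => by
      have h1 := congrArg (fun y => tcoeff j (h.hom y)) hg
      simp only [map_sum, map_zero, Subfield.smul_def, smul_eq_mul, h.tcoeff_hom,
        h.const_mul (g _).2] at h1
      exact h1
    exact Subtype.ext (congrFun this i)
  refine ⟨Module.Basis.mk hli fun y _ => ?_, fun i => Module.Basis.mk_apply _ _ _⟩
  obtain ⟨f, hf⟩ := h.exists_coeff_of_jacInv hm hx fun j => D j y
  have hc := h.exists_constants_coeff (mon x) (h.eq_zero_of_jacInv hm hx) y f hf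
  have h0 := hf 0
  simp only [h.zero] at h0
  rw [Submodule.mem_span_range_iff_exists_fun]
  exact ⟨fun i => ⟨f i, hc i⟩, h0⟩

end Basis

/-! ### Enlarging the field of constants -/

section ConstantExtension

open TensorProduct Polynomial

/-- If an algebraic element `θ` has the same degree over `E` as over a larger field `M`, then a
family of elements of `M` that is linearly independent over `E` remains so over `E(θ)`. -/
lemma eq_zero_of_natDegree_minpoly_le {E Ω : Type*} [Field E] [Field Ω] [Algebra E Ω]
    (M : IntermediateField E Ω) {β : Type*} [Fintype β] (X : β → M)
    (hX : LinearIndependent E X) {θ : Ω} (hθ : IsIntegral E θ)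
    (hdeg : (minpoly E θ).natDegree ≤ (minpoly M θ).natDegree) (f : β → Ω)
    (hf : ∀ i, f i ∈ IntermediateField.adjoin E {θ}) (h0 : ∑ i, f i * X i = 0) : f = 0 := by
  have hspan : ∀ y ∈ IntermediateField.adjoin E {θ}, ∃ c : Fin (minpoly E θ).natDegree → E,
      y = ∑ j, algebraMap E Ω (c j) * θ ^ (j : ℕ) := by
    intro y hy
    let B := IntermediateField.adjoin.powerBasis hθ
    have hdim : B.dim = (minpoly E θ).natDegree := IntermediateField.adjoin.powerBasis_dim hθ
    refine ⟨fun j => B.basis.repr ⟨y, hy⟩ (finCongr hdim.symm j), ?_⟩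
    have h1 := congrArg (algebraMap (IntermediateField.adjoin E {θ}) Ω) (B.basis.sum_repr ⟨y, hy⟩)
    rw [map_sum] at h1
    change _ = y at h1
    refine h1.symm.trans ?_
    refine (Fintype.sum_equiv (finCongr hdim.symm) _ _ fun j => ?_).symm
    rw [Algebra.smul_def, map_mul, B.coe_basis, map_pow, ← IsScalarTower.algebraMap_apply]
    rfl
  choose c hc using fun i => hspan (f i) (hf i)
  have hli : LinearIndependent M fun j : Fin (minpoly E θ).natDegree => θ ^ (j : ℕ) :=
    (linearIndependent_pow (K := M) θ).comp (Fin.castLE hdeg) (Fin.castLE_injective hdeg)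
  rw [Fintype.linearIndependent_iff] at hli hX
  have h1 : ∀ j, ∑ i, c i j • X i = 0 := by
    refine hli (fun j => ∑ i, c i j • X i) ?_
    rw [← h0]
    simp only [hc, Finset.sum_mul, Finset.sum_smul]
    rw [Finset.sum_comm]
    refine Finset.sum_congr rfl fun i _ => Finset.sum_congr rfl fun j _ => ?_
    rw [Algebra.smul_def, Algebra.smul_def, map_mul]
    change algebraMap E Ω (c i j) * X i * _ = _
    ring
  funext i
  rw [hc]
  refine Finset.sum_eq_zero fun j _ => ?_
  rw [hX _ (h1 j) i, map_zero, zero_mul]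

/-- The degree of a `p`-th root does not drop over a field that does not contain it. -/
lemma natDegree_minpoly_le_of_pow_eq {E Ω : Type*} [Field E] [Field Ω] [Algebra E Ω] (p : ℕ)
    [Fact p.Prime] [CharP Ω p] (M : IntermediateField E Ω) {θ : Ω} {a : E}
    (hθ : θ ^ p = algebraMap E Ω a) (hθM : θ ∉ M) :
    (minpoly E θ).natDegree ≤ (minpoly M θ).natDegree := by
  have hp0 := (Nat.Prime.ne_zero (Fact.out : p.Prime))
  have hirr : Irreducible ((Polynomial.X : M[X]) ^ p - Polynomial.C (algebraMap E M a)) := by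
    refine X_pow_sub_C_irreducible_of_prime Fact.out fun y hy => hθM ?_
    have h1 : ((y : Ω)) ^ p = θ ^ p := by
      rw [hθ]
      exact congrArg (algebraMap M Ω) hy
    have := frobenius_inj Ω p h1
    rw [← this]
    exact y.2
  have h0 : aeval θ ((Polynomial.X : M[X]) ^ p - Polynomial.C (algebraMap E M a)) = 0 := by
    rw [map_sub, map_pow, aeval_X, aeval_C, hθ, ← IsScalarTower.algebraMap_apply, sub_self]
  rw [← minpoly.eq_of_irreducible_of_monic hirr h0 (monic_X_pow_sub_C _ hp0),
    natDegree_X_pow_sub_C]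
  have h1 : aeval θ ((Polynomial.X : E[X]) ^ p - Polynomial.C a) = 0 := by
    rw [map_sub, map_pow, aeval_X, aeval_C, hθ, sub_self]
  exact (natDegree_le_natDegree (minpoly.min E θ (monic_X_pow_sub_C a hp0) h1)).trans
    natDegree_X_pow_sub_C.le

lemma IsSepClosed.of_ringEquiv {F F' : Type*} [Field F] [Field F'] (e : F ≃+* F')
    [IsSepClosed F] : IsSepClosed F' := by
  refine IsSepClosed.of_exists_root _ fun f _ hirr hsep => ?_
  obtain ⟨x, hx⟩ := IsSepClosed.exists_root (f.map e.symm.toRingHom)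
    (by rw [degree_map]; exact hirr.degree_pos.ne') hsep.map
  refine ⟨e x, ?_⟩
  have : f = (f.map e.symm.toRingHom).map e.toRingHom := by
    rw [Polynomial.map_map]
    simp
  rw [this, eval_map, show e x = e.toRingHom x from rfl, eval₂_hom, hx, map_zero]

/-- Let `K/C` be finite and purely inseparable of exponent at most `m`. An algebraic extension `E` of
`C` that is maximal with the property that `E ⊗ K` is a field makes `E ⊗ K` separably closed, with
`E` contained in its `p`-th powers. -/
theorem exists_maximal_constant_extension {C K : Type u} [Field C] [Field K] [Algebra C K] (p m : ℕ)
    [Fact p.Prime] [CharP K p] {β : Type*} [Fintype β] (b : Module.Basis β C K)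
    (hpow : ∀ y : K, y ^ p ^ m ∈ (algebraMap C K).range) :
    ∃ (E : Type u) (_ : Field E) (_ : Algebra C E) (hF : IsField (E ⊗[C] K)),
      (letI := hF.toField; IsSepClosed (E ⊗[C] K)) ∧
      ∀ a : E, ∃ z : E ⊗[C] K, z ^ p = a ⊗ₜ 1 := by
  classical
  let Ω := AlgebraicClosure K
  have hΩ : CharP Ω p := charP_of_injective_algebraMap (algebraMap K Ω).injective p
  let bΩ : β → Ω := fun i => algebraMap K Ω (b i)
  -- linear independence of the basis over an intermediate field
  let P : IntermediateField C Ω → Prop := fun E =>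
    ∀ f : β → Ω, (∀ i, f i ∈ E) → ∑ i, f i * bΩ i = 0 → f = 0
  have hbot : P ⊥ := by
    intro f hf h0
    choose c hc using fun i => IntermediateField.mem_bot.1 (hf i)
    have h1 : ∑ i, c i • b i = 0 := by
      apply (algebraMap K Ω).injective
      rw [map_zero, ← h0, map_sum]
      refine Finset.sum_congr rfl fun i _ => ?_
      rw [Algebra.smul_def, map_mul, ← IsScalarTower.algebraMap_apply, hc]
    funext i
    rw [← hc, Fintype.linearIndependent_iff.1 b.linearIndependent c h1 i, map_zero]
    rfl
  obtain ⟨E, -, hE, hmax⟩ := zorn_le_nonempty₀ {E | P E} (fun c hcP hc y hy => by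
    have : Nonempty c := ⟨⟨y, hy⟩⟩
    refine ⟨⨆ E : c, (E : IntermediateField C Ω), fun f hf h0 => ?_,
      fun z hz => le_iSup (fun E : c => (E : IntermediateField C Ω)) ⟨z, hz⟩⟩
    have hdir : Directed (· ≤ ·) fun E : c => (E : IntermediateField C Ω) := hc.directed
    have hf' : ∀ i, ∃ E : c, f i ∈ (E : IntermediateField C Ω) := fun i => by
      have := hf i
      rw [← SetLike.mem_coe, IntermediateField.coe_iSup_of_directed hdir] at this
      simpa using this
    choose g hg using hf'
    obtain ⟨E, hE⟩ := hdir.finset_le (Finset.univ.image g)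
    exact hcP E.2 f (fun i => hE (g i) (Finset.mem_image_of_mem _ (Finset.mem_univ i)) (hg i)) h0)
    ⊥ hbot
  change P E at hE
  have hEp : CharP E p := (algebraMap E Ω).charP (algebraMap E Ω).injective p
  let φ : E ⊗[C] K →ₐ[E] Ω := Algebra.TensorProduct.lift (Algebra.ofId E Ω)
    (IsScalarTower.toAlgHom C K Ω) fun _ _ => mul_comm _ _
  have hφ : ∀ a y, φ (a ⊗ₜ y) = a * algebraMap K Ω y := fun a y => by
    simp [φ]
    rfl
  let B := Algebra.TensorProduct.basis E b
  have hφB : ∀ c : β → E, φ (∑ i, c i • B i) = ∑ i, (c i : Ω) * bΩ i := fun c => by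
    rw [map_sum]
    refine Finset.sum_congr rfl fun i _ => ?_
    rw [map_smul, Algebra.TensorProduct.basis_apply, hφ, Algebra.smul_def]
    simp [bΩ]
  have hinj : Function.Injective φ := by
    rw [injective_iff_map_eq_zero]
    intro z hz
    rw [← B.sum_repr z, hφB] at hz
    have := hE (fun i => B.repr z i) (fun i => (B.repr z i).2) hz
    rw [← B.sum_repr z]
    refine Finset.sum_eq_zero fun i _ => ?_
    rw [show B.repr z i = 0 from Subtype.ext (congrFun this i), zero_smul]
  have hdom : IsDomain (E ⊗[C] K) := hinj.isDomain φ.toRingHom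
  have hfin : Module.Finite E (E ⊗[C] K) := Module.Finite.of_basis B
  have hF : IsField (E ⊗[C] K) := isField_of_isIntegral_of_isField' (R := E) (S := E ⊗[C] K) (Field.toIsField E)
  let _ : Field (E ⊗[C] K) := hF.toField
  let M : IntermediateField E Ω := φ.fieldRange
  have hXM : ∀ i, bΩ i ∈ M := fun i => ⟨1 ⊗ₜ b i, by
    change φ _ = _
    rw [hφ]
    simp [bΩ]⟩
  let XM : β → M := fun i => ⟨bΩ i, hXM i⟩
  have hli : LinearIndependent E XM := by
    rw [Fintype.linearIndependent_iff]
    intro g hg i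
    have h1 := congrArg (algebraMap M Ω) hg
    rw [map_sum, map_zero] at h1
    have := hE (fun i => g i) (fun i => (g i).2) (by
      rw [← h1]
      refine Finset.sum_congr rfl fun i _ => ?_
      rw [Algebra.smul_def, map_mul]
      rfl)
    exact Subtype.ext (congrFun this i)
  -- maximality: adjoining an element whose degree does not drop over `M` is impossible
  have hmem : ∀ θ : Ω, (minpoly E θ).natDegree ≤ (minpoly M θ).natDegree → θ ∈ E := by
    intro θ hθ
    have hint : IsIntegral E θ := by
      have : Algebra.IsAlgebraic C K := by
        have : Module.Finite C K := Module.Finite.of_basis b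
        infer_instance
      have : Algebra.IsAlgebraic C Ω := Algebra.IsAlgebraic.trans C K Ω
      exact ((Algebra.IsAlgebraic.isAlgebraic (R := C) θ).isIntegral).tower_top
    have hP : P ((IntermediateField.adjoin E {θ}).restrictScalars C) := fun f hf h0 =>
      eq_zero_of_natDegree_minpoly_le M XM hli hint hθ f hf h0
    refine hmax hP (fun x hx => ?_) (IntermediateField.mem_adjoin_simple_self E θ)
    exact (IntermediateField.adjoin E {θ}).algebraMap_mem ⟨x, hx⟩
  have hMpow : ∀ y : M, ∃ a : E, algebraMap E M a = y ^ p ^ m := by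
    rintro ⟨_, z, rfl⟩
    rw [← B.sum_repr z]
    choose d hd using fun i => hpow (b i)
    refine ⟨∑ i, B.repr z i ^ p ^ m * algebraMap C E (d i), Subtype.ext ?_⟩
    change (algebraMap E Ω) _ = (φ _) ^ p ^ m
    rw [hφB, sum_pow_char_pow, map_sum]
    refine Finset.sum_congr rfl fun i _ => ?_
    rw [map_mul, mul_pow, map_pow, ← map_pow (algebraMap K Ω), ← hd,
      ← IsScalarTower.algebraMap_apply, ← IsScalarTower.algebraMap_apply]
    rfl
  have hMins : IsPurelyInseparable E M := by
    rw [isPurelyInseparable_iff_pow_mem E p]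
    exact fun y => ⟨m, hMpow y⟩
  have hsepE : ∀ θ : Ω, IsSeparable E θ → θ ∈ E := fun θ hθ => hmem θ (by
    rw [← minpoly.map_eq_of_isSeparable_of_isPurelyInseparable M θ hθ, natDegree_map])
  refine ⟨E, inferInstance, inferInstance, hF, ?_, fun a => ?_⟩
  · have hsepM : ∀ θ : Ω, IsSeparable M θ → θ ∈ M := by
      intro θ hθ
      have hfr : θ ^ p ^ m ∈ E := by
        refine hsepE _ ?_
        choose g hg using hMpow
        have hginj := (algebraMap E M).injective
        let ψ : M →+* E :=
          { toFun := g
            map_one' := hginj (by rw [hg, map_one, one_pow])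
            map_mul' := fun x y => hginj (by rw [hg, map_mul, hg, hg, mul_pow])
            map_zero' := hginj (by rw [hg, map_zero, zero_pow (NeZero.ne _)])
            map_add' := fun x y => hginj (by rw [hg, map_add, hg, hg, add_pow_char_pow]) }
        have hψ : ∀ x, algebraMap E Ω (ψ x) = algebraMap M Ω x ^ p ^ m := fun x => by
          have := congrArg (algebraMap M Ω) (hg x)
          rw [map_pow] at this
          exact this
        have hs : ((minpoly M θ).map ψ).Separable :=
          Polynomial.Separable.map (f := ψ) hθ
        refine hs.of_dvd (minpoly.dvd E _ ?_)
        have h2 : (algebraMap E Ω).comp ψ = (iterateFrobenius Ω p m).comp (algebraMap M Ω) :=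
          RingHom.ext fun x => by
            rw [RingHom.comp_apply, hψ, RingHom.comp_apply, iterateFrobenius_def]
        rw [aeval_def, eval₂_map, h2, ← iterateFrobenius_def, ← hom_eval₂, ← aeval_def,
          minpoly.aeval, map_zero]
      have h3 : θ ∈ separableClosure M Ω ⊓ perfectClosure M Ω := by
        refine ⟨hθ, (mem_perfectClosure_iff_pow_mem p).2 ⟨m, ?_⟩⟩
        exact ⟨algebraMap E M ⟨_, hfr⟩, rfl⟩
      rw [separableClosure_inf_perfectClosure, IntermediateField.mem_bot] at h3
      obtain ⟨y, hy⟩ := h3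
      rw [← hy]
      exact y.2
    have hMs : IsSepClosed M := by
      refine IsSepClosed.of_exists_root _ fun f hmonic hirr hsep => ?_
      obtain ⟨θ, hθ⟩ := IsAlgClosed.exists_aeval_eq_zero Ω f hirr.degree_pos.ne'
      have : IsSeparable M θ := hsep.of_dvd (minpoly.dvd M θ hθ)
      refine ⟨⟨θ, hsepM θ this⟩, (algebraMap M Ω).injective ?_⟩
      rw [map_zero, ← hθ, aeval_def, ← eval₂_at_apply]
      rfl
    have he : Function.Bijective φ.rangeRestrict :=
      ⟨fun x y hxy => hinj (congrArg Subtype.val hxy), φ.rangeRestrict_surjective⟩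
    let e₀ : (E ⊗[C] K) ≃+* M := RingEquiv.ofBijective φ.rangeRestrict.toRingHom he
    exact IsSepClosed.of_ringEquiv e₀.symm
  · obtain ⟨θ, hθ⟩ := IsAlgClosed.exists_pow_nat_eq (a : Ω) (Nat.Prime.pos (Fact.out : p.Prime))
    have hθM : θ ∈ M := by
      by_contra hθM
      exact hθM (M.algebraMap_mem ⟨θ, hmem θ (natDegree_minpoly_le_of_pow_eq p M hθ hθM)⟩)
    obtain ⟨z, hz⟩ : ∃ z, φ z = θ := hθM
    refine ⟨z, hinj ?_⟩
    rw [map_pow, hz, hθ, hφ, map_one, mul_one]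

end ConstantExtension

/-! ### Embedding into separably closed strict fields -/

section EulerOperators

variable {e p : ℕ}

lemma derivation_sum_apply {R β : Type*} [CommRing R] (s : Finset β) (f : β → Derivation ℤ R R)
    (y : R) : (∑ a ∈ s, f a) y = ∑ a ∈ s, f a y :=
  map_sum (⟨⟨fun d => d y, rfl⟩, fun _ _ => rfl⟩ : Derivation ℤ R R →+ R) f s

/-- The monomial `x^j` is an eigenvector of `x_b ∂_b` with eigenvalue `j_b`. -/
lemma deriv_mon {K : Type*} [Field K] (δ : Fin e → Derivation ℤ K K) (x : Fin e → K)
    (hx : ∀ b c, δ b (x c) = if b = c then 1 else 0) {q : ℕ} (j : Fin e → Fin q) (b : Fin e) :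
    x b * δ b (mon x j) = ((j b : ℕ) : K) * mon x j := by
  have hgen : ∀ (s : Finset (Fin e)), x b * δ b (∏ a ∈ s, x a ^ (j a : ℕ)) =
      if b ∈ s then ((j b : ℕ) : K) * ∏ a ∈ s, x a ^ (j a : ℕ) else 0 := by
    classical
    intro s
    induction s using Finset.induction_on with
    | empty => simp
    | insert a s ha ih =>
      rw [Finset.prod_insert ha, Derivation.leibniz, smul_eq_mul, smul_eq_mul, mul_add,
        mul_left_comm, ih, Derivation.leibniz_pow, hx]
      by_cases hba : b = a
      · subst hba
        rw [if_neg ha, if_pos (Finset.mem_insert_self _ _), if_pos rfl]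
        rcases Nat.eq_zero_or_pos (j b : ℕ) with h0 | h0
        · simp [h0]
        · conv_rhs => rw [← Nat.sub_add_cancel h0, pow_succ]
          rw [Nat.sub_add_cancel h0]
          simp
          ring
      · rw [if_neg hba]
        simp only [Finset.mem_insert, hba, false_or, smul_zero, mul_zero, add_zero]
        split_ifs
        · ring
        · simp
  rw [mon, hgen, if_pos (Finset.mem_univ b)]

/-- If derivations `∂_b` kill the coefficients and satisfy `∂_b x_c = δ_{b,c}`, then the monomials
`x^j` with exponents below `p` are linearly independent over these coefficients: they are joint
eigenvectors of the operators `x_b ∂_b` with distinct eigenvalues. -/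
lemma eq_zero_of_sum_mul_mon {K : Type*} [Field K] [CharP K p] (δ : Fin e → Derivation ℤ K K)
    (x : Fin e → K) (hx : ∀ b c, δ b (x c) = if b = c then 1 else 0)
    (s : Finset (Fin e → Fin p)) (f : (Fin e → Fin p) → K) (hf : ∀ j b, δ b (f j) = 0)
    (h0 : ∑ j ∈ s, f j * mon x j = 0) : ∀ j ∈ s, f j = 0 := by
  classical
  have hx0 : ∀ b, x b ≠ 0 := fun b hb => by
    have := hx b b
    rw [hb, map_zero, if_pos rfl] at this
    exact zero_ne_one this
  have hmon : ∀ j : Fin e → Fin p, mon x j ≠ 0 := fun j =>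
    Finset.prod_ne_zero_iff.2 fun a _ => pow_ne_zero _ (hx0 a)
  induction s using Finset.induction_on generalizing f with
  | empty => simp
  | insert j₀ s hj₀ ih =>
    have hs : ∀ j ∈ s, f j = 0 := by
      intro j hj
      obtain ⟨b, hb⟩ : ∃ b, j b ≠ j₀ b := by
        by_contra! h
        exact hj₀ (funext h ▸ hj)
      have h1 : ∑ i ∈ s, ((((i b : ℕ) : K) - ((j₀ b : ℕ) : K)) * f i) * mon x i = 0 := by
        have h2 : x b * δ b (∑ i ∈ insert j₀ s, f i * mon x i) = 0 := by rw [h0]; simp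
        have h3 : ∀ i, x b * δ b (f i * mon x i) = ((i b : ℕ) : K) * (f i * mon x i) := by
          intro i
          rw [Derivation.leibniz, hf, smul_zero, add_zero, smul_eq_mul, mul_left_comm,
            deriv_mon δ x hx]
          ring
        rw [map_sum, Finset.mul_sum, Finset.sum_congr rfl fun i _ => h3 i] at h2
        have h4 : ∑ i ∈ insert j₀ s, ((((i b : ℕ) : K) - ((j₀ b : ℕ) : K)) * f i) * mon x i = 0 := by
          have h5 := congrArg (((j₀ b : ℕ) : K) * ·) h0
          simp only [mul_zero, Finset.mul_sum] at h5
          refine Eq.trans ?_ ((congrArg₂ (· - ·) h2 h5).trans (sub_zero 0))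
          rw [← Finset.sum_sub_distrib]
          exact Finset.sum_congr rfl fun i _ => by ring
        rw [Finset.sum_insert hj₀, sub_self, zero_mul, zero_mul, zero_add] at h4
        exact h4
      have h5 := ih (fun i => (((i b : ℕ) : K) - ((j₀ b : ℕ) : K)) * f i) (fun i c => by
        rw [Derivation.leibniz, hf, map_sub, Derivation.map_natCast, Derivation.map_natCast]
        simp) h1 j hj
      refine (mul_eq_zero.1 h5).resolve_left fun h6 => hb (Fin.ext ?_)
      rw [sub_eq_zero, CharP.natCast_eq_natCast K p] at h6
      exact Nat.ModEq.eq_of_lt_of_lt h6 (j b).2 (j₀ b).2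
    intro j hj
    rcases Finset.mem_insert.1 hj with rfl | hj
    · rw [Finset.sum_insert hj₀, Finset.sum_eq_zero (fun i hi => by rw [hs i hi, zero_mul]),
        add_zero] at h0
      exact (mul_eq_zero.1 h0).resolve_right (hmon j)
    · exact hs j hj

end EulerOperators

section Derivations

variable {e : ℕ} {k : Type*} [CommRing k] {W : FormalGroupLaw e k} {p m : ℕ} [Fact p.Prime]

/-- For a unit multi-index, the Hasse-Schmidt map is a derivation. -/
lemma GAct.mul_unitIdx {R : Type*} [CommRing R] {ι : k →+* R} {D : Idx e p m → R → R}
    (h : GAct W p m ι D) (hm : 0 < m) (a : Fin e) (x y : R) :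
    D (unitIdx a) (x * y) = D (unitIdx a) x * y + x * D (unitIdx a) y := by
  classical
  have hne : (unitIdx a : Idx e p m) ≠ 0 := unitIdx_ne_zero hm a
  have : (splits (unitIdx a : Idx e p m)) = {(unitIdx a, 0), (0, unitIdx a)} := by
    ext s
    rw [mem_splits, Finset.mem_insert, Finset.mem_singleton]
    constructor
    · intro hs
      have h0 : ∀ b, b ≠ a → (s.1 b : ℕ) = 0 ∧ (s.2 b : ℕ) = 0 := fun b hb => by
        have := hs b
        rw [unitIdx_val hm, if_neg hb] at this
        omega
      have h1 := hs a
      rw [unitIdx_val hm, if_pos rfl] at h1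
      have key : ∀ t : Idx e p m, (∀ b, b ≠ a → (t b : ℕ) = 0) →
          ((t a : ℕ) = 1 → t = unitIdx a) ∧ ((t a : ℕ) = 0 → t = 0) := fun t ht =>
        ⟨fun h => funext fun b => Fin.ext (by
          rw [unitIdx_val hm]
          split_ifs with hb
          · rw [hb, h]
          · exact ht b hb),
        fun h => funext fun b => Fin.ext (by
          by_cases hb : b = a
          · rw [hb, h]; rfl
          · exact ht b hb)⟩
      have k1 := key s.1 fun b hb => (h0 b hb).1
      have k2 := key s.2 fun b hb => (h0 b hb).2
      rcases Nat.eq_zero_or_pos (s.1 a : ℕ) with h2 | h2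
      · exact Or.inr (Prod.ext (k1.2 h2) (k2.1 (by omega)))
      · exact Or.inl (Prod.ext (k1.1 (by omega)) (k2.2 (by omega)))
    · rintro (rfl | rfl) b <;> simp
  rw [h.mul, this, Finset.sum_pair (by simp [hne]), h.zero, h.zero]

lemma GAct.map_zero' {R : Type*} [CommRing R] {ι : k →+* R} {D : Idx e p m → R → R}
    (h : GAct W p m ι D) (i : Idx e p m) : D i 0 = 0 := by
  simpa using h.add i 0 0

/-- The derivation given by a unit multi-index. -/
def GAct.deriv {R : Type*} [CommRing R] {ι : k →+* R} {D : Idx e p m → R → R}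
    (h : GAct W p m ι D) (hm : 0 < m) (a : Fin e) : Derivation ℤ R R :=
  Derivation.mk' (AddMonoidHom.toIntLinearMap ⟨⟨D (unitIdx a), h.map_zero' _⟩, h.add _⟩)
    fun x y => by
      change D (unitIdx a) (x * y) = x * D (unitIdx a) y + y * D (unitIdx a) x
      rw [h.mul_unitIdx hm]
      ring

@[simp] lemma GAct.deriv_apply {R : Type*} [CommRing R] {ι : k →+* R} {D : Idx e p m → R → R}
    (h : GAct W p m ι D) (hm : 0 < m) (a : Fin e) (x : R) : h.deriv hm a x = D (unitIdx a) x := rfl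

end Derivations

section Strict

variable {e : ℕ} {k : Type*} [CommRing k] {W : FormalGroupLaw e k} {p m : ℕ} [Fact p.Prime]

/-- Strictness: the common constants of the derivations given by the unit multi-indices are `p`-th
powers. -/
def Strict {K : Type*} [Field K] (D : Idx e p m → K → K) : Prop :=
  ∀ x, (∀ a, D (unitIdx a) x = 0) → ∃ y, y ^ p = x

/-- There are `n` elements that form a basis over the subfield of `p`-th powers. -/
def HasPowerBasis (K : Type*) [Field K] (p n : ℕ) : Prop :=
  ∃ b : Fin n → K, (∀ c : Fin n → K, ∑ i, c i ^ p * b i = 0 → ∀ i, c i = 0) ∧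
    ∀ y, ∃ c : Fin n → K, ∑ i, c i ^ p * b i = y

/-- A solution of the linear equations `∑_b Q_{c,b} D_a(x_b) = δ_{a,c}` yields derivations `∂_b`
dual to `x`. -/
lemma GAct.exists_dual_derivations {K : Type*} [Field K] {ι : k →+* K} {D : Idx e p m → K → K}
    (h : GAct W p m ι D) (hm : 0 < m) {x : Fin e → K} {Q : Fin e → Fin e → K}
    (hQ : JacInv D x Q) : ∃ δ : Fin e → Derivation ℤ K K,
      (∀ b c, δ b (x c) = if b = c then 1 else 0) ∧
      ∀ y, (∀ a, D (unitIdx a) y = 0) → ∀ b, δ b y = 0 := by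
  classical
  have hmat : Matrix.of Q * Matrix.of (fun b a => D (unitIdx a) (x b)) = 1 := by
    ext c a
    rw [Matrix.mul_apply, Matrix.one_apply]
    exact (hQ c a).trans (if_congr eq_comm rfl rfl)
  have hmat' := mul_eq_one_comm.1 hmat
  refine ⟨fun b => ∑ a, Q a b • h.deriv hm a, fun b c => ?_, fun y hy b => ?_⟩
  · have := congrFun (congrFun hmat' c) b
    rw [Matrix.mul_apply, Matrix.one_apply] at this
    rw [derivation_sum_apply]
    simp only [Derivation.smul_apply, h.deriv_apply, smul_eq_mul]
    rw [← if_congr (eq_comm (a := c)) rfl rfl, ← this]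
    exact Finset.sum_congr rfl fun a _ => mul_comm _ _
  · rw [derivation_sum_apply]
    refine Finset.sum_eq_zero fun a _ => ?_
    rw [Derivation.smul_apply, h.deriv_apply, hy, smul_zero]

lemma GAct.unitIdx_pow {R : Type*} [CommRing R] [CharP R p] {ι : k →+* R} {D : Idx e p m → R → R}
    (h : GAct W p m ι D) (hm : 0 < m) (a : Fin e) (y : R) : D (unitIdx a) (y ^ p) = 0 := by
  rw [← h.deriv_apply hm, Derivation.leibniz_pow]
  simp

/-- A `W[m]`-field with a nondegenerate system `x` of coordinates that is spanned by the monomials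
in `x` over its `p`-th powers is strict of imperfection degree `e`. -/
lemma GAct.strict_and_hasPowerBasis {K : Type*} [Field K] [CharP K p] {ι : k →+* K}
    {D : Idx e p m → K → K} (h : GAct W p m ι D) (hm : 0 < m) {x : Fin e → K}
    {Q : Fin e → Fin e → K} (hQ : JacInv D x Q)
    (hspan : ∀ y, ∃ c : (Fin e → Fin p) → K, ∑ j, c j ^ p * mon x j = y) :
    Strict D ∧ HasPowerBasis K p (p ^ e) := by
  obtain ⟨δ, hδ, hδ0⟩ := h.exists_dual_derivations hm hQ
  have hpow : ∀ y b, δ b (y ^ p) = 0 := fun y => hδ0 _ fun a => h.unitIdx_pow hm a y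
  constructor
  · intro y hy
    obtain ⟨c, hc⟩ := hspan y
    have : ∑ j, (c j ^ p - if j = 0 then y else 0) * mon x j = 0 := by
      simp only [sub_mul, Finset.sum_sub_distrib, hc]
      simp [mon]
    have h0 := eq_zero_of_sum_mul_mon (p := p) δ x hδ Finset.univ _ (fun j b => by
      rw [map_sub, hpow]
      split_ifs
      · rw [hδ0 y hy, sub_zero]
      · rw [map_zero, sub_zero]) this 0 (Finset.mem_univ 0)
    exact ⟨c 0, by simpa [sub_eq_zero] using h0⟩
  · let ε : (Fin e → Fin p) ≃ Fin (p ^ e) := Fintype.equivFinOfCardEq (by simp)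
    refine ⟨fun i => mon x (ε.symm i), fun c hc i => ?_, fun y => ?_⟩
    · rw [← Equiv.sum_comp ε] at hc
      simp only [Equiv.symm_apply_apply] at hc
      have := eq_zero_of_sum_mul_mon (p := p) δ x hδ Finset.univ (fun j => c (ε j) ^ p)
        (fun j b => hpow _ b) hc (ε.symm i) (Finset.mem_univ _)
      simpa using eq_zero_of_pow_eq_zero this
    · obtain ⟨c, hc⟩ := hspan y
      refine ⟨fun i => c (ε.symm i), ?_⟩
      rw [← hc, ← Equiv.sum_comp ε]
      simp

end Strict

section Generic

variable {e : ℕ} {k : Type*} [CommRing k] {W : FormalGroupLaw e k} {p m : ℕ} [Fact p.Prime]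
  [CharP k p]

/-- The trivial action. -/
lemma GAct.trivial {R : Type*} [CommRing R] (W : FormalGroupLaw e k) (ι : k →+* R) :
    GAct W p m ι fun i x => if i = 0 then x else 0 := by
  classical
  have hρ : IsPreCoaction (p := p) (m := m) (e := e) ι (algebraMap R (Trunc (Fin e) (p ^ m) R)) :=
    ⟨fun x => by rw [← tcoeff_zero, tcoeff_algebraMap', if_pos rfl], fun c => rfl⟩
  have := GAct.ofHom (W := W) hρ (eq_top_iff.2 fun x _ => iter_of_const W ι rfl)
  simp only [tcoeff_algebraMap'] at this
  convert this

/-- Every `W[m]`-field embeds into one with a nondegenerate system of coordinates. -/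
lemma GAct.exists_jacInv {K : Type u} [Field K] [CharP K p] {ι : k →+* K} {D : Idx e p m → K → K}
    (h : GAct W p m ι D) (hm : 0 < m) :
    ∃ (K' : Type u) (_ : Field K') (_ : CharP K' p) (j : K →+* K') (D' : Idx e p m → K' → K')
      (x : Fin e → K') (Q : Fin e → Fin e → K'), GAct W p m (j.comp ι) D' ∧
      (∀ i a, D' i (j a) = j (D i a)) ∧ JacInv D' x Q := by
  classical
  obtain ⟨D₁, h₁, hC, hX⟩ := h.exists_mvPolynomial (Fin e)
  let P := MvPolynomial (Fin e × Idx e p m) K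
  have : CharP (FractionRing P) p :=
    charP_of_injective_algebraMap (IsFractionRing.injective P (FractionRing P)) p
  obtain ⟨D', h', hD'⟩ := h₁.exists_localization (nonZeroDivisors P) (FractionRing P)
  -- the Jacobian matrix consists of distinct variables
  let u : Fin e × Fin e → Fin e × Idx e p m := fun s => (s.1, unitIdx s.2)
  have hu : Function.Injective u := fun s t hst => by
    refine Prod.ext (Prod.ext_iff.1 hst).1 ?_
    by_contra hne
    have := unitIdx_val (p := p) hm s.2 t.2
    rw [show (unitIdx s.2 : Idx e p m) = unitIdx t.2 from (Prod.ext_iff.1 hst).2,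
      unitIdx_val hm, if_pos rfl, if_neg (Ne.symm hne)] at this
    exact one_ne_zero this
  let φ : MvPolynomial (Fin e × Fin e) K →+* FractionRing P :=
    (algebraMap P (FractionRing P)).comp (MvPolynomial.rename u).toRingHom
  have hφ : Function.Injective φ :=
    (IsFractionRing.injective P (FractionRing P)).comp (MvPolynomial.rename_injective u hu)
  let J : Matrix (Fin e) (Fin e) (FractionRing P) := φ.mapMatrix (Matrix.mvPolynomialX _ _ K)
  have hJ : J.det ≠ 0 := by
    rw [← RingHom.map_det]
    exact (map_ne_zero_iff φ hφ).2 (Matrix.det_mvPolynomialX_ne_zero _ _)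
  refine ⟨FractionRing P, inferInstance, inferInstance, (algebraMap P _).comp MvPolynomial.C, D',
    fun b => algebraMap P _ (MvPolynomial.X (b, 0)),
    fun c b => (J⁻¹ : Matrix (Fin e) (Fin e) (FractionRing P)) c b, h', fun i a => ?_, fun c a => ?_⟩
  · rw [RingHom.comp_apply, hD', hC]
    rfl
  · have h1 := Matrix.nonsing_inv_mul J (isUnit_iff_ne_zero.2 hJ)
    have h2 := congrFun (congrFun h1 c) a
    rw [Matrix.mul_apply, Matrix.one_apply] at h2
    rw [if_congr (eq_comm (a := a)) rfl rfl, ← h2]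
    refine Finset.sum_congr rfl fun b _ => ?_
    rw [hD', hX]
    refine congrArg (J⁻¹ c b * ·) ?_
    change _ = algebraMap P (FractionRing P) (MvPolynomial.rename u (Matrix.mvPolynomialX _ _ K b a))
    rw [Matrix.mvPolynomialX_apply, MvPolynomial.rename_X]

open TensorProduct in
/-- Every `W[m]`-field embeds into a strict separably closed one of imperfection degree `e`. -/
theorem GAct.exists_sepClosed {K : Type u} [Field K] [CharP K p] {ι : k →+* K}
    {D : Idx e p m → K → K} (h : GAct W p m ι D) (hm : 0 < m) :
    ∃ (K' : Type u) (_ : Field K') (_ : CharP K' p) (j : K →+* K') (D' : Idx e p m → K' → K'),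
      GAct W p m (j.comp ι) D' ∧ (∀ i a, D' i (j a) = j (D i a)) ∧ Strict D' ∧ IsSepClosed K' ∧
      HasPowerBasis K' p (p ^ e) := by
  classical
  -- enlarge the field of constants of a field `K₁` with coordinates `x`: the new field is `E ⊗ K₁`
  -- with the trivial action on `E`
  obtain ⟨K₁, _, _, j₁, D₁, x, Q, h₁, hD₁, hQ⟩ := h.exists_jacInv hm
  obtain ⟨b, hb⟩ := h₁.exists_basis hm hQ
  obtain ⟨E, _, _, hF, hsep, hroot⟩ := exists_maximal_constant_extension p m b
    fun y => ⟨⟨_, h₁.pow_mem_constants y⟩, rfl⟩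
  have : CharP h₁.constants p :=
    (algebraMap h₁.constants K₁).charP (algebraMap h₁.constants K₁).injective p
  have : CharP E p := charP_of_injective_algebraMap (algebraMap h₁.constants E).injective p
  let ιC : k →+* h₁.constants := (j₁.comp ι).codRestrict h₁.constants h₁.algebraMap_mem_constants
  have htriv := GAct.trivial (p := p) (m := m) W ((algebraMap h₁.constants E).comp ιC)
  have hone : ∀ c : h₁.constants, (algebraMap h₁.constants E c) ⊗ₜ[h₁.constants] (1 : K₁) =
      1 ⊗ₜ (c : K₁) := fun c => by
    rw [Algebra.algebraMap_eq_smul_one, TensorProduct.smul_tmul, Subfield.smul_def, smul_eq_mul,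
      mul_one]
  obtain ⟨D', h', hDl, hDr⟩ := htriv.exists_tensor h₁ (fun c => hone (ιC c)) fun f i => by
    by_cases hi : i = 0
    · rw [if_pos hi, hone, hi]
      congr 1
      exact (h₁.zero _).symm
    · rw [if_neg hi, TensorProduct.zero_tmul]
      rw [show algebraMap h₁.constants K₁ f = f from rfl, (h₁.mem_constants.1 f.2) i hi,
        TensorProduct.tmul_zero]
  let inr : K₁ →+* E ⊗[h₁.constants] K₁ :=
    (Algebra.TensorProduct.includeRight : K₁ →ₐ[h₁.constants] E ⊗[h₁.constants] K₁).toRingHom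
  have hinr : ∀ y, inr y = 1 ⊗ₜ y := fun _ => rfl
  have hι : Algebra.TensorProduct.includeLeftRingHom.comp
      ((algebraMap h₁.constants E).comp ιC) = (inr.comp j₁).comp ι :=
    RingHom.ext fun c => hone (ιC c)
  rw [hι] at h'
  let _ : Field (E ⊗[h₁.constants] K₁) := hF.toField
  have : CharP (E ⊗[h₁.constants] K₁) p := charP_of_injective_ringHom inr.injective p
  have hJ : JacInv D' (fun b => inr (x b)) fun c b => inr (Q c b) := fun c a => by
    rw [← map_one inr, ← map_zero inr, ← apply_ite inr, ← hQ c a, map_sum]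
    refine Finset.sum_congr rfl fun b _ => ?_
    rw [map_mul]
    congr 1
    exact hDr _ _
  have hspan : ∀ y : E ⊗[h₁.constants] K₁, ∃ c : (Fin e → Fin p) → E ⊗[h₁.constants] K₁,
      ∑ j, c j ^ p * mon (fun b => inr (x b)) j = y := by
    intro y
    have hadd : ∀ (s : Finset (Idx e p m)) (g : Idx e p m → E ⊗[h₁.constants] K₁),
        (∀ i, ∃ c : (Fin e → Fin p) → E ⊗[h₁.constants] K₁,
          ∑ j, c j ^ p * mon (fun b => inr (x b)) j = g i) →
        ∃ c : (Fin e → Fin p) → E ⊗[h₁.constants] K₁,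
          ∑ j, c j ^ p * mon (fun b => inr (x b)) j = ∑ i ∈ s, g i := by
      intro s g hg
      choose c hc using hg
      refine ⟨fun j => ∑ i ∈ s, c i j, ?_⟩
      simp only [sum_pow_char, Finset.sum_mul]
      rw [Finset.sum_comm]
      exact Finset.sum_congr rfl fun i _ => hc i
    rw [← (Algebra.TensorProduct.basis E b).sum_repr y]
    refine hadd _ _ fun i => ?_
    obtain ⟨z, hz⟩ := hroot ((Algebra.TensorProduct.basis E b).repr y i)
    have hp := NeZero.pos p
    let r : Fin e → Fin p := fun a => ⟨i a % p, Nat.mod_lt _ hp⟩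
    refine ⟨Pi.single r (z * ∏ a, inr (x a) ^ (i a / p : ℕ)), ?_⟩
    rw [Finset.sum_eq_single r (fun j _ hj => by
      rw [Pi.single_eq_of_ne hj, zero_pow hp.ne', zero_mul]) (by simp), Pi.single_eq_same,
      mul_pow, hz, mul_assoc, mon, ← Finset.prod_pow, ← Finset.prod_mul_distrib,
      Algebra.TensorProduct.basis_apply, hb, TensorProduct.smul_tmul', smul_eq_mul, mul_one]
    have : ∏ a, (inr (x a) ^ (i a / p : ℕ)) ^ p * inr (x a) ^ (r a : ℕ) = inr (mon x i) := by
      rw [mon, map_prod]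
      refine Finset.prod_congr rfl fun a _ => ?_
      rw [← pow_mul, ← pow_add, mul_comm, Nat.div_add_mod, map_pow]
    rw [this, hinr]
    exact (Algebra.TensorProduct.tmul_mul_tmul _ _ _ _).trans (by rw [mul_one, one_mul])
  obtain ⟨hs, hpb⟩ := h'.strict_and_hasPowerBasis hm hJ hspan
  refine ⟨E ⊗[h₁.constants] K₁, inferInstance, inferInstance, inr.comp j₁, D', h', fun i a => ?_,
    hs, hsep, hpb⟩
  rw [RingHom.comp_apply, RingHom.comp_apply, ← hD₁]
  exact hDr _ _

end Generic

/-! ### Separability and amalgamation -/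

section Separability

variable {e : ℕ} {k : Type*} [CommRing k] {W : FormalGroupLaw e k} {p m : ℕ} [Fact p.Prime]

/-- An extension of a strict `W[m]`-field is separable, in MacLane's form: `p`-th powers of linearly
independent elements are linearly independent. Differentiating a relation between the `p`-th powers
shortens it, unless its coefficients are constants, hence `p`-th powers. -/
theorem GAct.eq_zero_of_sum_mul_pow {F K : Type*} [Field F] [Field K] [CharP F p] [CharP K p]
    [Algebra F K] {ιF : k →+* F} {DF : Idx e p m → F → F} {ι : k →+* K} {D : Idx e p m → K → K}
    (hF : GAct W p m ιF DF) (hstr : Strict DF) (h : GAct W p m ι D) (hm : 0 < m)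
    (hD : ∀ i x, D i (algebraMap F K x) = algebraMap F K (DF i x)) {β : Type*} (v : β → K)
    (s : Finset β) (hv : ∀ g : β → F, ∑ i ∈ s, g i • v i = 0 → ∀ i ∈ s, g i = 0) (f : β → F)
    (h0 : ∑ i ∈ s, f i • v i ^ p = 0) : ∀ i ∈ s, f i = 0 := by
  classical
  induction s using Finset.induction_on generalizing f with
  | empty => simp
  | insert i₀ s hi₀ ih =>
    have hv' : ∀ g : β → F, ∑ i ∈ s, g i • v i = 0 → ∀ i ∈ s, g i = 0 := by
      intro g hg i hi
      have := hv (fun i => if i ∈ s then g i else 0) (by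
        rw [Finset.sum_insert hi₀, if_neg hi₀, zero_smul, zero_add, ← hg]
        exact Finset.sum_congr rfl fun i hi => by rw [if_pos hi]) i (Finset.mem_insert_of_mem hi)
      rwa [if_pos hi] at this
    have h00 : f i₀ = 0 := by
      by_contra hne
      -- normalise the relation
      let g : β → F := fun i => (f i₀)⁻¹ * f i
      have hg0 : g i₀ = 1 := inv_mul_cancel₀ hne
      have hg : ∑ i ∈ insert i₀ s, g i • v i ^ p = 0 := by
        simp only [g, mul_smul, ← Finset.smul_sum, h0, smul_zero]
      have hder : ∀ a, ∀ i ∈ s, DF (unitIdx a) (g i) = 0 := fun a => by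
        refine ih hv' (fun i => DF (unitIdx a) (g i)) ?_
        have h1 := congrArg (h.deriv hm a) hg
        have h2 : ∀ i, h.deriv hm a (g i • v i ^ p) = DF (unitIdx a) (g i) • v i ^ p := by
          intro i
          rw [Algebra.smul_def, Algebra.smul_def, Derivation.leibniz, h.deriv_apply, h.deriv_apply,
            h.unitIdx_pow hm, hD, smul_zero, zero_add, smul_eq_mul, mul_comm]
        rw [map_sum, map_zero, Finset.sum_congr rfl fun i _ => h2 i, Finset.sum_insert hi₀, hg0,
          ← one_pow p, hF.unitIdx_pow hm, zero_smul, zero_add] at h1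
        exact h1
      have hroot : ∀ i ∈ insert i₀ s, ∃ c, c ^ p = g i := by
        intro i hi
        rcases Finset.mem_insert.1 hi with rfl | hi
        · exact ⟨1, by rw [hg0, one_pow]⟩
        · exact hstr _ fun a => hder a i hi
      choose! c hc using hroot
      have h3 : ∑ i ∈ insert i₀ s, c i • v i = 0 := by
        refine eq_zero_of_pow_eq_zero (n := p) ?_
        rw [sum_pow_char, ← hg]
        exact Finset.sum_congr rfl fun i hi => by rw [smul_pow, hc i hi]
      have h4 := hv c h3 i₀ (Finset.mem_insert_self _ _)
      have h5 := hc i₀ (Finset.mem_insert_self _ _)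
      rw [h4, hg0, zero_pow (NeZero.ne p)] at h5
      exact zero_ne_one h5
    rw [Finset.sum_insert hi₀, h00, zero_smul, zero_add] at h0
    intro i hi
    rcases Finset.mem_insert.1 hi with rfl | hi
    · exact h00
    · exact ih hv' f h0 i hi

end Separability

section Amalgamation

open TensorProduct

variable {e : ℕ} {k : Type*} [CommRing k] {W : FormalGroupLaw e k} {p m : ℕ} [Fact p.Prime]

/-- MacLane's criterion holds for extensions of strict `W[m]`-fields. -/
lemma GAct.linearIndependent_pow {F K : Type*} [Field F] [Field K] [CharP F p] [CharP K p]
    [Algebra F K] {ιF : k →+* F} {DF : Idx e p m → F → F} {ι : k →+* K} {D : Idx e p m → K → K}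
    (hF : GAct W p m ιF DF) (hstr : Strict DF) (h : GAct W p m ι D) (hm : 0 < m)
    (hD : ∀ i x, D i (algebraMap F K x) = algebraMap F K (DF i x)) {β : Type*} {v : β → K}
    (hv : LinearIndependent F v) : LinearIndependent F fun i => v i ^ p := by
  rw [linearIndependent_iff'] at hv ⊢
  exact fun s g hg => hF.eq_zero_of_sum_mul_pow hstr h hm hD v s (hv s) g hg

/-- Tensor products over a strict `W[m]`-field are reduced. -/
lemma GAct.isReduced_tensor {F K₁ K₂ : Type*} [Field F] [Field K₁] [Field K₂] [CharP F p]
    [CharP K₁ p] [CharP K₂ p] [Algebra F K₁] [Algebra F K₂] {ιF : k →+* F} {DF : Idx e p m → F → F}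
    {ι : k →+* K₂} {D : Idx e p m → K₂ → K₂}
    (hF : GAct W p m ιF DF) (hstr : Strict DF) (h : GAct W p m ι D) (hm : 0 < m)
    (hD : ∀ i x, D i (algebraMap F K₂ x) = algebraMap F K₂ (DF i x)) :
    IsReduced (K₁ ⊗[F] K₂) := by
  have hinl : Function.Injective (algebraMap K₁ (K₁ ⊗[F] K₂)) := (algebraMap K₁ _).injective
  have : CharP (K₁ ⊗[F] K₂) p := charP_of_injective_algebraMap hinl p
  rw [isReduced_iff_pow_one_lt p (Nat.Prime.one_lt Fact.out)]
  intro z hz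
  let b := Module.Basis.ofVectorSpace F K₂
  let B := Algebra.TensorProduct.basis K₁ b
  have hli := Module.Flat.linearIndependent_one_tmul (S := K₁)
    (hF.linearIndependent_pow hstr h hm hD b.linearIndependent)
  have hsum : z = ∑ i ∈ (B.repr z).support, B.repr z i • B i := (B.linearCombination_repr z).symm
  rw [hsum, sum_pow_char] at hz
  rw [linearIndependent_iff'] at hli
  have h0 := hli (B.repr z).support (fun i => B.repr z i ^ p) (by
    rw [← hz]
    refine Finset.sum_congr rfl fun i _ => ?_
    rw [smul_pow, Algebra.TensorProduct.basis_apply, Algebra.TensorProduct.tmul_pow, one_pow])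
  rw [hsum]
  exact Finset.sum_eq_zero fun i hi => by rw [eq_zero_of_pow_eq_zero (h0 i hi), zero_smul]

variable [CharP k p]

/-- Amalgamation over a strict `W[m]`-field. -/
theorem GAct.exists_amalgam {F K₁ K₂ : Type u} [Field F] [Field K₁] [Field K₂] [CharP F p]
    [CharP K₁ p] [CharP K₂ p] {ιF : k →+* F} {DF : Idx e p m → F → F} (hF : GAct W p m ιF DF)
    (hstr : Strict DF) (hm : 0 < m) {j₁ : F →+* K₁} {j₂ : F →+* K₂}
    {D₁ : Idx e p m → K₁ → K₁} {D₂ : Idx e p m → K₂ → K₂}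
    (h₁ : GAct W p m (j₁.comp ιF) D₁) (h₂ : GAct W p m (j₂.comp ιF) D₂)
    (hD₁ : ∀ i x, D₁ i (j₁ x) = j₁ (DF i x)) (hD₂ : ∀ i x, D₂ i (j₂ x) = j₂ (DF i x)) :
    ∃ (L : Type u) (_ : Field L) (_ : CharP L p) (f₁ : K₁ →+* L) (f₂ : K₂ →+* L)
      (D : Idx e p m → L → L), GAct W p m (f₁.comp (j₁.comp ιF)) D ∧ f₁.comp j₁ = f₂.comp j₂ ∧
      (∀ i x, D i (f₁ x) = f₁ (D₁ i x)) ∧ ∀ i x, D i (f₂ x) = f₂ (D₂ i x) := by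
  let _ : Algebra F K₁ := j₁.toAlgebra
  let _ : Algebra F K₂ := j₂.toAlgebra
  have hone : ∀ x : F, j₁ x ⊗ₜ[F] (1 : K₂) = 1 ⊗ₜ j₂ x := fun x =>
    (Algebra.TensorProduct.tmul_one_eq_one_tmul x)
  obtain ⟨D, h, hDl, hDr⟩ := h₁.exists_tensor (F := F) h₂ (fun c => hone (ιF c)) fun x i => by
    rw [show algebraMap F K₁ x = j₁ x from rfl, show algebraMap F K₂ x = j₂ x from rfl, hD₁, hD₂,
      hone]
  have hred : IsReduced (K₁ ⊗[F] K₂) := hF.isReduced_tensor hstr h₂ hm hD₂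
  have : CharP (K₁ ⊗[F] K₂) p :=
    charP_of_injective_algebraMap (algebraMap K₁ (K₁ ⊗[F] K₂)).injective p
  -- the localization of the reduced ring `K₁ ⊗ K₂` at a minimal prime is a field
  obtain ⟨r, hr⟩ := Ideal.exists_maximal (K₁ ⊗[F] K₂)
  have := hr.isPrime
  obtain ⟨q, hq, -⟩ := Ideal.exists_minimalPrimes_le (bot_le : ⊥ ≤ r)
  have := hq.1.1
  have : Ring.KrullDimLE 0 (Localization.AtPrime q) := .of_isLocalization _ hq _
  let _ : Field (Localization.AtPrime q) := Ring.KrullDimLE.isField_of_isReduced.toField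
  let f₁ : K₁ →+* Localization.AtPrime q :=
    (algebraMap (K₁ ⊗[F] K₂) _).comp Algebra.TensorProduct.includeLeftRingHom
  let f₂ : K₂ →+* Localization.AtPrime q := (algebraMap (K₁ ⊗[F] K₂) _).comp
    (Algebra.TensorProduct.includeRight : K₂ →ₐ[F] K₁ ⊗[F] K₂).toRingHom
  have : CharP (Localization.AtPrime q) p := charP_of_injective_ringHom f₁.injective p
  obtain ⟨D', h', hD'⟩ := h.exists_localization q.primeCompl (Localization.AtPrime q)
  refine ⟨Localization.AtPrime q, inferInstance, inferInstance, f₁, f₂, D', h', ?_, ?_, ?_⟩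
  · exact RingHom.ext fun x => congrArg (algebraMap (K₁ ⊗[F] K₂) _) (hone x)
  · intro i x
    exact (hD' i _).trans (congrArg _ (hDl i x))
  · intro i x
    exact (hD' i _).trans (congrArg _ (hDr i x))

/-- Amalgamation over a common subring whose constants are `p`-th powers. -/
theorem GAct.exists_amalgam_of_ring {A K₁ K₂ : Type u} [CommRing A] [Field K₁] [Field K₂]
    [CharP A p] [CharP K₁ p] [CharP K₂ p] {ιA : k →+* A} {DA : Idx e p m → A → A}
    (hA : GAct W p m ιA DA) (hm : 0 < m)
    (hstr : ∀ x : A, (∀ a, DA (unitIdx a) x = 0) → ∃ y, y ^ p = x)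
    {j₁ : A →+* K₁} {j₂ : A →+* K₂} (hj₁ : Function.Injective j₁) (hj₂ : Function.Injective j₂)
    {D₁ : Idx e p m → K₁ → K₁} {D₂ : Idx e p m → K₂ → K₂}
    (h₁ : GAct W p m (j₁.comp ιA) D₁) (h₂ : GAct W p m (j₂.comp ιA) D₂)
    (hD₁ : ∀ i x, D₁ i (j₁ x) = j₁ (DA i x)) (hD₂ : ∀ i x, D₂ i (j₂ x) = j₂ (DA i x)) :
    ∃ (L : Type u) (_ : Field L) (_ : CharP L p) (f₁ : K₁ →+* L) (f₂ : K₂ →+* L)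
      (D : Idx e p m → L → L), GAct W p m (f₁.comp (j₁.comp ιA)) D ∧ f₁.comp j₁ = f₂.comp j₂ ∧
      (∀ i x, D i (f₁ x) = f₁ (D₁ i x)) ∧ ∀ i x, D i (f₂ x) = f₂ (D₂ i x) := by
  have : IsDomain A := hj₁.isDomain j₁
  let F := FractionRing A
  have : CharP F p := charP_of_injective_algebraMap (IsFractionRing.injective A F) p
  obtain ⟨DF, hF, hDF⟩ := hA.exists_localization (nonZeroDivisors A) F
  have hlift : ∀ {K : Type u} [Field K] [CharP K p] {j : A →+* K} (hj : Function.Injective j)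
      {D : Idx e p m → K → K} (h : GAct W p m (j.comp ιA) D)
      (hD : ∀ i x, D i (j x) = j (DA i x)),
      ∀ i x, D i (IsFractionRing.lift hj x) = (IsFractionRing.lift hj : F →+* K) (DF i x) := by
    intro K _ _ j hj D h hD
    have : h.hom.comp (IsFractionRing.lift hj : F →+* K) =
        (truncMap (IsFractionRing.lift hj : F →+* K)).comp hF.hom := by
      refine IsLocalization.ringHom_ext (nonZeroDivisors A) (RingHom.ext fun x => Trunc.ext fun i => ?_)
      simp only [RingHom.comp_apply, h.tcoeff_hom, tcoeff_truncMap, hF.tcoeff_hom, hDF,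
        IsFractionRing.lift_algebraMap, hD]
    intro i x
    rw [← h.tcoeff_hom, ← hF.tcoeff_hom, ← tcoeff_truncMap]
    exact congrArg _ (RingHom.congr_fun this x)
  have hcomp : ∀ {K : Type u} [Field K] {j : A →+* K} (hj : Function.Injective j),
      (IsFractionRing.lift hj : F →+* K).comp ((algebraMap A F).comp ιA) = j.comp ιA := fun hj =>
    RingHom.ext fun c => IsFractionRing.lift_algebraMap hj (ιA c)
  have hstrF : Strict DF := by
    intro x hx
    obtain ⟨a, s, hs, rfl⟩ := IsFractionRing.div_surjective (A := A) x
    have hs0 : algebraMap A F s ≠ 0 := IsFractionRing.to_map_ne_zero_of_mem_nonZeroDivisors hs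
    have hp1 : p = p - 1 + 1 := (Nat.sub_add_cancel (Nat.Prime.one_lt Fact.out).le).symm
    -- multiply by a `p`-th power to clear the denominator
    have h1 : algebraMap A F (a * s ^ (p - 1)) =
        algebraMap A F a / algebraMap A F s * algebraMap A F s ^ p := by
      conv_rhs => rw [hp1, pow_succ', ← mul_assoc, div_mul_cancel₀ _ hs0]
      rw [map_mul, map_pow]
    obtain ⟨y, hy⟩ := hstr (a * s ^ (p - 1)) fun b => by
      apply IsFractionRing.injective A F
      rw [← hDF, h1, hF.mul_unitIdx hm, hx, hF.unitIdx_pow hm]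
      simp
    refine ⟨algebraMap A F y / algebraMap A F s, ?_⟩
    rw [div_pow, ← map_pow, hy, h1, mul_div_assoc, div_self (pow_ne_zero _ hs0), mul_one]
  obtain ⟨L, _, _, f₁, f₂, D, h, hf, h1, h2⟩ := hF.exists_amalgam hstrF hm
    (j₁ := IsFractionRing.lift hj₁) (j₂ := IsFractionRing.lift hj₂) (D₁ := D₁) (D₂ := D₂)
    (by rw [hcomp]; exact h₁) (by rw [hcomp]; exact h₂) (hlift hj₁ h₁ hD₁) (hlift hj₂ h₂ hD₂)
  rw [hcomp] at h
  refine ⟨L, _, inferInstance, f₁, f₂, D, h, RingHom.ext fun x => ?_, h1, h2⟩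
  have := RingHom.congr_fun hf (algebraMap A F x)
  simpa only [RingHom.comp_apply, IsFractionRing.lift_algebraMap] using this

end Amalgamation

section Generation

variable {e : ℕ} {k : Type*} [CommRing k] {W : FormalGroupLaw e k} {p m : ℕ} [Fact p.Prime]

/-- A basis over the `p`-th powers remains independent over the `p`-th powers of a separable
extension. -/
lemma independent_of_separable {K : Type*} {N : Type v} [Field K] [Field N] [CharP N p] [Algebra K N] {n : ℕ}
    {b : Fin n → K} (hb : ∀ c : Fin n → K, ∑ i, c i ^ p * b i = 0 → ∀ i, c i = 0)
    (hsep : ∀ {β : Type v} {v : β → N}, LinearIndependent K v → LinearIndependent K fun i => v i ^ p)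
    (c : Fin n → N) (hc : ∑ i, c i ^ p * algebraMap K N (b i) = 0) : ∀ i, c i = 0 := by
  classical
  let B := Module.Basis.ofVectorSpace K N
  have hli := hsep B.linearIndependent
  let s : Finset _ := Finset.univ.biUnion fun i => (B.repr (c i)).support
  have hsum : ∀ i, c i = ∑ l ∈ s, B.repr (c i) l • B l := fun i => by
    conv_lhs => rw [← B.linearCombination_repr (c i)]
    exact Finsupp.sum_of_support_subset _
      (Finset.subset_biUnion_of_mem (fun i => (B.repr (c i)).support) (Finset.mem_univ i)) _
      (by simp)
  have h1 : ∑ l ∈ s, (∑ i, B.repr (c i) l ^ p * b i) • B l ^ p = 0 := by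
    rw [← hc]
    simp only [Finset.sum_smul]
    rw [Finset.sum_comm]
    refine Finset.sum_congr rfl fun i _ => ?_
    conv_rhs => rw [hsum i, sum_pow_char, Finset.sum_mul]
    refine Finset.sum_congr rfl fun l _ => ?_
    rw [smul_pow, Algebra.smul_def, Algebra.smul_def, map_mul]
    ring
  have h2 := linearIndependent_iff'.1 hli s _ h1
  intro i
  rw [hsum i]
  exact Finset.sum_eq_zero fun l hl => by rw [hb _ (h2 l hl) i, zero_smul]

/-- Elements independent over the `p`-th powers, as many as the imperfection degree allows, span. -/
lemma HasPowerBasis.span_of_independent {N : Type*} [Field N] [CharP N p] {n : ℕ}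
    (hN : HasPowerBasis N p n) {b : Fin n → N}
    (hb : ∀ c : Fin n → N, ∑ i, c i ^ p * b i = 0 → ∀ i, c i = 0) (y : N) :
    ∃ c : Fin n → N, ∑ i, c i ^ p * b i = y := by
  classical
  obtain ⟨a, -, ha⟩ := hN
  let S : Subfield N := (frobenius N p).fieldRange
  have hroot : ∀ g : S, ∃ c : N, c ^ p = g := fun g => g.2
  choose r hr using hroot
  have hsp : Submodule.span S (Set.range a) = ⊤ := by
    rw [eq_top_iff]
    rintro y -
    obtain ⟨c, rfl⟩ := ha y
    refine Submodule.sum_mem _ fun i _ => ?_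
    exact Submodule.smul_mem _ (⟨c i ^ p, ⟨c i, rfl⟩⟩ : S) (Submodule.subset_span ⟨i, rfl⟩)
  have hli : LinearIndependent S b := by
    rw [Fintype.linearIndependent_iff]
    intro g hg i
    have := hb (fun i => r (g i)) (by
      rw [← hg]
      exact Finset.sum_congr rfl fun i _ => by rw [hr]; rfl) i
    refine Subtype.ext ?_
    rw [← hr, this, zero_pow (NeZero.ne p)]
    rfl
  have hfin : Module.Finite S N := ⟨⟨Finset.univ.image a, by simpa using hsp⟩⟩
  have hle : Module.finrank S N ≤ n := by
    have := finrank_range_le_card (R := S) a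
    rw [Set.finrank, hsp, finrank_top, Fintype.card_fin] at this
    exact this
  have hcard : Fintype.card (Fin n) = Module.finrank S N :=
    le_antisymm hli.fintype_card_le_finrank (by rwa [Fintype.card_fin])
  have htop := hli.span_eq_top_of_card_eq_finrank' hcard
  have hy : y ∈ Submodule.span S (Set.range b) := htop ▸ Submodule.mem_top
  obtain ⟨g, hg⟩ := (Submodule.mem_span_range_iff_exists_fun S).1 hy
  refine ⟨fun i => r (g i), ?_⟩
  rw [← hg]
  exact Finset.sum_congr rfl fun i _ => by rw [hr]; rfl

/-- If a basis of `K` over its `p`-th powers spans `N` over its `p`-th powers, then the only subring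
of `N` containing `K` and all `p^m`-th powers is `N`. -/
lemma subring_eq_top_of_span {K N : Type*} [Field K] [Field N] [CharP N p] (j : K →+* N) {n : ℕ}
    {b : Fin n → K} (hspan : ∀ y, ∃ c : Fin n → N, ∑ i, c i ^ p * j (b i) = y) (r : ℕ)
    (S : Subring N) (hj : ∀ x, j x ∈ S) (hpow : ∀ y, y ^ p ^ r ∈ S) : S = ⊤ := by
  induction r generalizing S with
  | zero => exact eq_top_iff.2 fun y _ => by simpa using hpow y
  | succ r ih =>
    -- the elements whose `p`-th powers lie in `S` form a subring with the same properties
    have h1 : S.comap (frobenius N p) = ⊤ := ih _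
      (fun x => by
        rw [Subring.mem_comap, frobenius_def, ← map_pow]
        exact hj _)
      (fun y => by
        rw [Subring.mem_comap, frobenius_def, ← pow_mul, ← pow_succ]
        exact hpow y)
    refine eq_top_iff.2 fun y _ => ?_
    obtain ⟨c, rfl⟩ := hspan y
    refine sum_mem fun i _ => mul_mem ?_ (hj _)
    have : c i ∈ S.comap (frobenius N p) := h1 ▸ Subring.mem_top _
    exact this

/-- Let `j : K → N` be an embedding of strict `W[m]`-fields of the same finite imperfection degree.
A field embedding of `N` into a `W[m]`-field that is compatible with the action on `K` is compatible
with the action on `N`, because `N` is generated by `K` and the constants `y^(p^m)`. -/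
theorem GAct.map_comm_of_comp {K N N' : Type*} [Field K] [Field N] [Field N'] [CharP K p]
    [CharP N p] [CharP N' p] {ι : k →+* K} {j : K →+* N} {f : N →+* N'} {ι' : k →+* N'}
    {D : Idx e p m → K → K} {DN : Idx e p m → N → N} {D' : Idx e p m → N' → N'}
    (h : GAct W p m ι D) (hN : GAct W p m (j.comp ι) DN) (h' : GAct W p m ι' D') (hm : 0 < m)
    (hj : ∀ i x, DN i (j x) = j (D i x)) (hf : ∀ i x, D' i (f (j x)) = f (j (D i x)))
    (hstr : Strict D) {n : ℕ} (hK : HasPowerBasis K p n) (hNb : HasPowerBasis N p n) (i : Idx e p m)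
    (y : N) : D' i (f y) = f (DN i y) := by
  obtain ⟨b, hb, -⟩ := hK
  let _ : Algebra K N := j.toAlgebra
  have hind := independent_of_separable hb fun hv => h.linearIndependent_pow hstr hN hm hj hv
  have hspan := hNb.span_of_independent hind
  have htop := subring_eq_top_of_span j hspan m
    (RingHom.eqLocus (h'.hom.comp f) ((truncMap f).comp hN.hom))
    (fun x => Trunc.ext fun i => by
      simp only [RingHom.comp_apply, h'.tcoeff_hom, tcoeff_truncMap, hN.tcoeff_hom, hf, hj])
    (fun y => by
      change h'.hom (f (y ^ p ^ m)) = truncMap f (hN.hom (y ^ p ^ m))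
      rw [map_pow f, map_pow h'.hom, trunc_pow', h'.taug_hom, map_pow hN.hom, trunc_pow', hN.taug_hom,
        truncMap_algebraMap, map_pow f])
  have : y ∈ RingHom.eqLocus (h'.hom.comp f) ((truncMap f).comp hN.hom) := htop ▸ Subring.mem_top y
  have := congrArg (tcoeff i) this
  simpa only [RingHom.comp_apply, h'.tcoeff_hom, tcoeff_truncMap, hN.tcoeff_hom] using this

end Generation

section Points

open Polynomial in
/-- The polynomials with nonzero derivative need not be separable, but they have a separable
irreducible factor. -/
lemma IsSepClosed.exists_root_of_derivative_ne_zero {K : Type*} [Field K] [IsSepClosed K] (f : K[X])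
    (hf : derivative f ≠ 0) : ∃ x, f.eval x = 0 := by
  -- a polynomial without roots has only inseparable irreducible factors, so its derivative vanishes
  suffices h : (∀ x, f.eval x ≠ 0) → derivative f = 0 by
    by_contra! hroot
    exact hf (h hroot)
  clear hf
  induction f using UniqueFactorizationMonoid.induction_on_prime with
  | h₁ => simp
  | h₂ x hx =>
    obtain ⟨c, -, rfl⟩ := isUnit_iff.1 hx
    simp
  | h₃ a q ha hq ih =>
    intro hroot
    have h1 : derivative a = 0 := ih fun x hx => hroot x (by rw [eval_mul, hx, mul_zero])
    have h2 : derivative q = 0 := by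
      by_contra h
      obtain ⟨x, hx⟩ := IsSepClosed.exists_root q hq.irreducible.degree_pos.ne'
        ((separable_iff_derivative_ne_zero hq.irreducible).2 h)
      exact hroot x (by rw [eval_mul, hx, zero_mul])
    rw [derivative_mul, h1, h2, zero_mul, mul_zero, add_zero]

open Polynomial in
lemma IsSepClosed.of_exists_root_of_derivative_ne_zero {K : Type*} [Field K]
    (h : ∀ f : K[X], derivative f ≠ 0 → ∃ x, f.eval x = 0) : IsSepClosed K :=
  IsSepClosed.of_exists_root _ fun f _ hirr hsep =>
    h f ((separable_iff_derivative_ne_zero hirr).1 hsep)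

open Polynomial in
/-- Ultrapowers of separably closed fields are separably closed. -/
instance isSepClosed_germ {I K : Type*} (U : Ultrafilter I) [Field K] [IsSepClosed K] :
    IsSepClosed (Filter.Germ (U : Filter I) K) := by
  refine IsSepClosed.of_exists_root_of_derivative_ne_zero fun f hf => ?_
  have hrep : ∀ n, ∃ c : I → K, (c : Filter.Germ (U : Filter I) K) = f.coeff n := fun n =>
    Quotient.exists_rep _
  choose c hc using hrep
  let g : I → K[X] := fun P => ∑ n ∈ Finset.range (f.natDegree + 1), monomial n (c n P)
  have hcoeff : ∀ P n, (g P).coeff n = if n ∈ Finset.range (f.natDegree + 1) then c n P else 0 := by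
    intro P n
    simp only [g, finsetSum_coeff, coeff_monomial, Finset.sum_ite_eq']
  have hg : ∀ᶠ P in (U : Filter I), derivative (g P) ≠ 0 := by
    refine Ultrafilter.eventually_not.2 fun hcon => hf (Polynomial.ext fun n => ?_)
    rw [coeff_derivative, coeff_zero, ← hc]
    by_cases hn : n + 1 ∈ Finset.range (f.natDegree + 1)
    · have h1 : (fun P => c (n + 1) P * ((n : K) + 1)) =ᶠ[(U : Filter I)] fun _ => 0 :=
        hcon.mono fun P hP => by
          have := congrArg (fun q : K[X] => q.coeff n) hP
          simpa only [coeff_derivative, hcoeff, if_pos hn, coeff_zero] using this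
      exact Filter.Germ.coe_eq.2 h1
    · rw [hc, coeff_eq_zero_of_natDegree_lt (by simpa using hn), zero_mul]
  have hroot : ∀ᶠ P in (U : Filter I), ∃ x, (g P).eval x = 0 :=
    hg.mono fun P hP => IsSepClosed.exists_root_of_derivative_ne_zero _ hP
  obtain ⟨r, hr⟩ := hroot.choice
  refine ⟨(r : Filter.Germ (U : Filter I) K), ?_⟩
  rw [eval_eq_sum_range]
  have h1 : ∑ i ∈ Finset.range (f.natDegree + 1), f.coeff i * (r : Filter.Germ (U : Filter I) K) ^ i =
      Filter.Germ.coeRingHom (U : Filter I) (∑ i ∈ Finset.range (f.natDegree + 1), c i * r ^ i) := by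
    rw [map_sum]
    refine Finset.sum_congr rfl fun i _ => ?_
    rw [map_mul, map_pow, ← hc]
    rfl
  rw [h1]
  refine Filter.Germ.coe_eq.2 (hr.mono fun P hP => ?_)
  rw [← hP]
  simp [g, eval_finsetSum, Finset.sum_apply]

/-- Let `N / K` satisfy MacLane's condition, with `K` separably closed and infinite. For every finite
set `s` of elements of `N` there is a map `N → K` that respects the ring operations on `s`: a
finitely generated subextension has a separating transcendence basis, so it embeds into an ultrapower
of `K`. -/
theorem exists_partial_hom {K : Type*} {N : Type v} [Field K] [Field N] [Algebra K N]
    [IsSepClosed K] [Infinite K] (p : ℕ) [Fact p.Prime] [CharP K p]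
    (hsep : ∀ {β : Type v} {v : β → N}, LinearIndependent K v → LinearIndependent K fun i => v i ^ p)
    (s : Finset N) : ∃ φ : N → K, (∀ x ∈ s, ∀ y ∈ s, φ (x + y) = φ x + φ y ∧ φ (x * y) = φ x * φ y) ∧
      ∀ a, algebraMap K N a ∈ s → φ (algebraMap K N a) = a := by
  classical
  let L := IntermediateField.adjoin K (s : Set N)
  have hess : Algebra.EssFiniteType K L := IntermediateField.essFiniteType_iff.2 ⟨s, rfl⟩
  have H : ∀ s : Finset L, LinearIndepOn K _root_.id (s : Set L) →
      LinearIndepOn K (· ^ p) (s : Set L) := by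
    intro s hs
    have h1 : LinearIndependent K fun x : s => ((x : L) : N) :=
      LinearIndependent.map' (v := fun x : s => (x : L)) hs L.val.toLinearMap
        (LinearMap.ker_eq_bot.2 L.val.injective)
    exact LinearIndependent.of_comp L.val.toLinearMap (hsep h1)
  obtain ⟨t, ht, hts⟩ :=
    exists_isTranscendenceBasis_and_isSeparable_of_linearIndepOn_pow_of_essFiniteType p Fact.out H
  -- the generic point of affine space over `K` lies in an ultrapower of `K`
  let 𝓕 : Filter (t → K) := ⨅ g : {g : MvPolynomial t K // g ≠ 0},
    Filter.principal {P | MvPolynomial.eval P g.1 ≠ 0}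
  have : 𝓕.NeBot := by
    have : Nonempty {g : MvPolynomial t K // g ≠ 0} := ⟨⟨1, one_ne_zero⟩⟩
    refine Filter.iInf_neBot_of_directed' (fun g g' => ⟨⟨g.1 * g'.1, mul_ne_zero g.2 g'.2⟩, ?_, ?_⟩)
      fun g => Filter.principal_neBot_iff.2 ?_
    · refine Filter.principal_mono.2 fun P hP => ?_
      rw [Set.mem_ofPred_eq, map_mul] at hP
      exact left_ne_zero_of_mul hP
    · refine Filter.principal_mono.2 fun P hP => ?_
      rw [Set.mem_ofPred_eq, map_mul] at hP
      exact right_ne_zero_of_mul hP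
    · by_contra hempty
      refine g.2 (MvPolynomial.funext fun P => ?_)
      by_contra hP
      exact hempty ⟨P, by simpa using hP⟩
  let U : Ultrafilter (t → K) := Ultrafilter.of 𝓕
  have hU : ∀ g : MvPolynomial t K, g ≠ 0 → ∀ᶠ P in (U : Filter (t → K)), MvPolynomial.eval P g ≠ 0 :=
    fun g hg => Ultrafilter.of_le 𝓕 (Filter.mem_iInf_of_mem ⟨g, hg⟩ (Filter.mem_principal_self _))
  let ev : MvPolynomial t K →+* Filter.Germ (U : Filter (t → K)) K :=
    (Filter.Germ.coeRingHom _).comp (RingHom.pi fun P => MvPolynomial.eval P)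
  have hev : Function.Injective ev := by
    rw [injective_iff_map_eq_zero]
    intro g hg
    by_contra hne
    obtain ⟨P, hP, hP'⟩ := ((hU g hne).and (Filter.Germ.coe_eq.1 hg)).exists
    exact hP hP'
  let ψ₀ : FractionRing (MvPolynomial t K) →+* Filter.Germ (U : Filter (t → K)) K :=
    IsFractionRing.lift hev
  have hψ₀ : ∀ a : K, ψ₀ (algebraMap K _ a) = ((fun _ => a : (t → K) → K) : Filter.Germ _ K) := by
    intro a
    rw [IsScalarTower.algebraMap_apply K (MvPolynomial t K), IsFractionRing.lift_algebraMap]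
    change (Filter.Germ.coeRingHom _) (RingHom.pi _ (MvPolynomial.C a)) = _
    exact Filter.Germ.coe_eq.2 (Filter.Eventually.of_forall fun P => MvPolynomial.eval_C a)
  rw [← Subtype.range_coe (s := (t : Set L))] at hts
  let ψ : IntermediateField.adjoin K (Set.range ((↑) : t → L)) →+* Filter.Germ (U : Filter (t → K)) K :=
    ψ₀.comp ht.1.aevalEquivField.symm.toRingEquiv.toRingHom
  let _ : Algebra (IntermediateField.adjoin K (Set.range ((↑) : t → L)))
    (Filter.Germ (U : Filter (t → K)) K) := ψ.toAlgebra
  let Φ : L →ₐ[IntermediateField.adjoin K (Set.range ((↑) : t → L))]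
    Filter.Germ (U : Filter (t → K)) K := IsSepClosed.lift
  have hΦ : ∀ a : K, Φ (algebraMap K L a) = ((fun _ => a : (t → K) → K) : Filter.Germ _ K) := by
    intro a
    rw [IsScalarTower.algebraMap_apply K
      (IntermediateField.adjoin K (Set.range ((↑) : t → L))) L, Φ.commutes, ← hψ₀]
    exact congrArg ψ₀ (ht.1.aevalEquivField.symm.commutes a)
  choose r hr using fun x : L => (Quotient.exists_rep (Φ x))
  have hr' : ∀ x, (r x : Filter.Germ (U : Filter (t → K)) K) = Φ x := hr
  have hmem : ∀ x ∈ s, x ∈ L := fun x hx => IntermediateField.subset_adjoin K _ hx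
  have hadd : ∀ x y : L, ∀ᶠ P in (U : Filter (t → K)), r (x + y) P = r x P + r y P ∧
      r (x * y) P = r x P * r y P := fun x y => by
    refine (Filter.Germ.coe_eq.1 ?_).and (Filter.Germ.coe_eq.1 ?_)
    · exact (hr' _).trans (by rw [map_add, ← hr', ← hr']; rfl)
    · exact (hr' _).trans (by rw [map_mul, ← hr', ← hr']; rfl)
  have hconst : ∀ a : K, ∀ᶠ P in (U : Filter (t → K)), r (algebraMap K L a) P = a := fun a =>
    Filter.Germ.coe_eq.1 ((hr' _).trans (hΦ a))
  have hconst' : ∀ x : s, ∀ᶠ P in (U : Filter (t → K)),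
      ∀ a, algebraMap K N a = x → r (algebraMap K L a) P = a := by
    intro x
    by_cases hx : ∃ a, algebraMap K N a = x
    · obtain ⟨a, ha⟩ := hx
      filter_upwards [hconst a] with P hP b hb
      rwa [← (algebraMap K N).injective (ha.trans hb.symm)]
    · exact Filter.Eventually.of_forall fun P a ha => absurd ⟨a, ha⟩ hx
  obtain ⟨P, hP, hP'⟩ := ((Filter.eventually_all.2 fun x : s => Filter.eventually_all.2 fun y : s =>
    hadd ⟨x, hmem x x.2⟩ ⟨y, hmem y y.2⟩).and (Filter.eventually_all.2 hconst')).exists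
  have hφ : ∀ x : L, (if h : (x : N) ∈ L then r ⟨x, h⟩ P else 0) = r x P := fun x => dif_pos x.2
  refine ⟨fun x => if h : x ∈ L then r ⟨x, h⟩ P else 0, fun x hx y hy => ?_, fun a ha => ?_⟩
  · have h1 := hP ⟨x, hx⟩ ⟨y, hy⟩
    exact ⟨(hφ (⟨x, hmem x hx⟩ + ⟨y, hmem y hy⟩)).trans
        (h1.1.trans (congrArg₂ _ (hφ ⟨x, hmem x hx⟩).symm (hφ ⟨y, hmem y hy⟩).symm)),
      (hφ (⟨x, hmem x hx⟩ * ⟨y, hmem y hy⟩)).trans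
        (h1.2.trans (congrArg₂ _ (hφ ⟨x, hmem x hx⟩).symm (hφ ⟨y, hmem y hy⟩).symm))⟩
  · exact (hφ (algebraMap K L a)).trans (hP' ⟨_, ha⟩ a rfl)

end Points

/-! ### Quantifier elimination and model completeness -/

section ModelTheory

open Language Cardinal

variable {L : FirstOrder.Language.{u, v}}

lemma isQF_foldr_inf {α : Type*} (l : List (L.Formula α)) (hl : ∀ ψ ∈ l, BoundedFormula.IsQF ψ) :
    BoundedFormula.IsQF (l.foldr (· ⊓ ·) (⊤ : L.Formula α)) := by
  induction l with
  | nil => exact BoundedFormula.IsQF.top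
  | cons ψ l ih =>
    exact (hl ψ List.mem_cons_self).inf (ih fun χ hχ => hl χ (List.mem_cons_of_mem _ hχ))

lemma realize_foldr_inf' {α M : Type*} [L.Structure M] (l : List (L.Formula α)) (x : α → M) :
    Formula.Realize (l.foldr (· ⊓ ·) (⊤ : L.Formula α)) x ↔ ∀ ψ ∈ l, ψ.Realize x := by
  rw [Formula.Realize, BoundedFormula.realize_foldr_inf]
  rfl

/-- Compactness for formulas in finitely many free variables. -/
lemma exists_list_of_forall_realize (T : L.Theory) {n : ℕ} (Γ : Set (L.Formula (Fin n)))
    (φ : L.Formula (Fin n))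
    (h : ∀ (M : Theory.ModelType.{u, v, max u v} T) (x : Fin n → M), (∀ ψ ∈ Γ, ψ.Realize x) →
      φ.Realize x) :
    ∃ l : List (L.Formula (Fin n)), (∀ ψ ∈ l, ψ ∈ Γ) ∧
      ∀ (M : Theory.ModelType.{u, v, max u v} T) (x : Fin n → M), (∀ ψ ∈ l, ψ.Realize x) →
        φ.Realize x := by
  classical
  let T' : L[[Fin n]].Theory :=
    (L.lhomWithConstants (Fin n)).onTheory T ∪ Formula.equivSentence '' Γ
  have hT' : T' ⊨ᵇ Formula.equivSentence φ := by
    rw [Theory.models_sentence_iff]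
    intro M
    let _ : L.Structure M := (L.lhomWithConstants (Fin n)).reduct M
    have hM : M ⊨ T' := M.is_model
    have h1 : M ⊨ T := (LHom.onTheory_model (L.lhomWithConstants (Fin n)) T).1
      (hM.mono Set.subset_union_left)
    rw [Formula.realize_equivSentence]
    refine h (Theory.ModelType.of T M) _ fun ψ hψ => ?_
    refine (Formula.realize_equivSentence M ψ).1 ?_
    exact hM.realize_of_mem _ (Set.mem_union_right _ ⟨ψ, hψ, rfl⟩)
  obtain ⟨T₀, hT₀, hφ⟩ := Theory.models_iff_finset_models.1 hT'
  let l := (T₀.toList.map Formula.equivSentence.symm).filter (· ∈ Γ)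
  refine ⟨l, fun ψ hψ => by simpa using (List.mem_filter.1 hψ).2, fun M x hx => ?_⟩
  let _ : (constantsOn (Fin n)).Structure M := constantsOn.structure x
  refine (Formula.realize_equivSentence M φ).1 ?_
  have hM : M ⊨ (T₀ : L[[Fin n]].Theory) := by
    refine (Theory.model_iff _).2 fun s hs => ?_
    rcases hT₀ hs with hs' | ⟨ψ, hψ, rfl⟩
    · exact ((LHom.onTheory_model (L.lhomWithConstants (Fin n)) T).2 M.is_model).realize_of_mem s hs'
    · refine (Formula.realize_equivSentence M ψ).2 (hx ψ ?_)
      refine List.mem_filter.2 ⟨List.mem_map.2 ⟨_, Finset.mem_toList.2 hs, ?_⟩, by simpa using hψ⟩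
      rw [Equiv.symm_apply_apply]
  exact hφ.realize_sentence M

/-- A theory eliminates quantifiers if the quantifier-free type of a tuple in a model determines its
type. -/
theorem hasQE_of_qf_type (T : L.Theory)
    (h : ∀ (M N : Theory.ModelType.{u, v, max u v} T) (n : ℕ) (x : Fin n → M) (y : Fin n → N),
      (∀ ψ : L.Formula (Fin n), BoundedFormula.IsQF ψ → (ψ.Realize x ↔ ψ.Realize y)) →
      ∀ φ : L.Formula (Fin n), φ.Realize x → φ.Realize y) : HasQE T := by
  intro n φ
  let Γ : Set (L.Formula (Fin n)) := {ψ | BoundedFormula.IsQF ψ ∧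
    ∀ (M : Theory.ModelType.{u, v, max u v} T) (x : Fin n → M), φ.Realize x → ψ.Realize x}
  have hΓ : ∀ (N : Theory.ModelType.{u, v, max u v} T) (y : Fin n → N), (∀ ψ ∈ Γ, ψ.Realize y) →
      φ.Realize y := by
    intro N y hy
    by_contra hφ
    obtain ⟨l, hl, hl'⟩ := exists_list_of_forall_realize T
      {ψ | BoundedFormula.IsQF ψ ∧ ψ.Realize y} φ.not fun M x hx hφx => by
        refine hφ (h M N n x y (fun ψ hψ => ⟨fun h1 => ?_, fun h1 => hx ψ ⟨hψ, h1⟩⟩) φ hφx)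
        by_contra h2
        exact hx ψ.not ⟨hψ.not, h2⟩ h1
    have h1 := hy (Formula.not (l.foldr (· ⊓ ·) ⊤))
      ⟨(isQF_foldr_inf l fun ψ hψ => (hl ψ hψ).1).not, fun M x hx hc =>
        hl' M x ((realize_foldr_inf' l x).1 hc) hx⟩
    exact h1 ((realize_foldr_inf' l y).2 fun ψ hψ => (hl ψ hψ).2)
  obtain ⟨l, hl, hl'⟩ := exists_list_of_forall_realize T Γ φ hΓ
  refine ⟨l.foldr (· ⊓ ·) ⊤, isQF_foldr_inf l fun ψ hψ => (hl ψ hψ).1, fun M x xs => ?_⟩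
  rw [BoundedFormula.realize_iff, Subsingleton.elim xs default]
  exact ⟨fun hφ => (realize_foldr_inf' l x).2 fun ψ hψ => (hl ψ hψ).2 M x hφ, fun hc =>
    hl' M x ((realize_foldr_inf' l x).1 hc)⟩

/-- Robinson's test: if the target of every embedding of models embeds back into an elementary
extension of the source, then embeddings between models are elementary. -/
theorem realize_comp_of_robinson (T : L.Theory)
    (h : ∀ (M N : Type w) [L.Structure M] [L.Structure N] [M ⊨ T] [N ⊨ T] [Nonempty M] (f : M ↪[L] N),
      ∃ (M' : Type w) (_ : L.Structure M') (i : M ↪ₑ[L] M') (g : N ↪[L] M'), ∀ x, g (f x) = i x)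
    {α : Type*} {n : ℕ} (φ : L.BoundedFormula α n) (M N : Type w) [L.Structure M] [L.Structure N]
    [M ⊨ T] [N ⊨ T] [Nonempty M] (f : M ↪[L] N) (x : α → M) (xs : Fin n → M) :
    φ.Realize (f ∘ x) (f ∘ xs) ↔ φ.Realize x xs := by
  induction φ generalizing M N with
  | falsum => exact Iff.rfl
  | equal t₁ t₂ =>
    simp only [BoundedFormula.Realize]
    rw [← Sum.comp_elim, HomClass.realize_term, HomClass.realize_term, f.injective.eq_iff]
  | rel R ts =>
    simp only [BoundedFormula.Realize]
    rw [← Sum.comp_elim]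
    simp only [HomClass.realize_term]
    exact f.map_rel R _
  | imp φ ψ ihφ ihψ =>
    rw [BoundedFormula.realize_imp, BoundedFormula.realize_imp, ihφ M N, ihψ M N]
  | all φ ih =>
    rw [BoundedFormula.realize_all, BoundedFormula.realize_all]
    constructor
    · intro hN a
      have := hN (f a)
      rwa [← Fin.comp_snoc, ih M N] at this
    · intro hM b
      obtain ⟨M', _, i, g, hg⟩ := h M N f
      have hM' : M' ⊨ T := (i.elementarilyEquivalent.theory_model_iff).1 ‹_›
      have : Nonempty N := ⟨b⟩
      rw [← ih N M' g]
      have h1 : (φ.all).Realize (i ∘ x) (i ∘ xs) := (i.map_boundedFormula _ _ _).2 hM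
      have h2 := h1 (g b)
      convert h2 using 1
      · exact funext fun a => hg _
      · rw [Fin.comp_snoc]
        congr 1
        exact funext fun a => hg _

end ModelTheory

/-! ### The algebraic meaning of the axioms -/

section Interpretation

open Language Structure

variable {k : Type u} [CommRing k] {e p m : ℕ}

/-- The inclusion of the ring language. -/
def ringLHom (k : Type u) (e p m : ℕ) : Language.ring →ᴸ hsLang k e p m := LHom.sumInl

/-- The inclusion of the language without `λ`. -/
def hsLHom (k : Type u) (e p m : ℕ) : hsLang k e p m →ᴸ hsLamLang k e p m := LHom.sumInl

lemma gDF_eq (W : FormalGroupLaw e k) : gDF W p m =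
    (ringLHom k e p m).onTheory Theory.field
    ∪ Set.range (fun cd : k × k => constAddAx e p m cd.1 cd.2)
    ∪ Set.range (fun cd : k × k => constMulAx e p m cd.1 cd.2)
    ∪ {constOneAx k e p m}
    ∪ Set.range (derZeroAx k e p m)
    ∪ Set.range (derAddAx k)
    ∪ Set.range (fun ic : Idx e p m × k => derSMulAx ic.1 ic.2)
    ∪ Set.range (derMulAx k)
    ∪ Set.range (fun ij : Idx e p m × Idx e p m => iterAx W ij.1 ij.2) := rfl

/-- The structure on `M` is the one given by field operations, a homomorphism `ι : k → M` and maps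
`D_i : M → M`. -/
structure Interp {M : Type*} [(hsLang k e p m).Structure M] [Field M] (ι : k →+* M)
    (D : Idx e p m → M → M) : Prop where
  zero : ∀ x, funMap (L := hsLang k e p m) (Sum.inl ringFunc.zero) x = (0 : M)
  one : ∀ x, funMap (L := hsLang k e p m) (Sum.inl ringFunc.one) x = (1 : M)
  neg : ∀ x, funMap (L := hsLang k e p m) (Sum.inl ringFunc.neg) x = (-x 0 : M)
  add : ∀ x, funMap (L := hsLang k e p m) (Sum.inl ringFunc.add) x = (x 0 + x 1 : M)
  mul : ∀ x, funMap (L := hsLang k e p m) (Sum.inl ringFunc.mul) x = (x 0 * x 1 : M)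
  const : ∀ c x, funMap (L := hsLang k e p m) (Sum.inr (OpFunc.const c)) x = ι c
  der : ∀ i x, funMap (L := hsLang k e p m) (Sum.inr (OpFunc.der i)) x = D i (x 0)

variable {M : Type*} [(hsLang k e p m).Structure M] [Field M] {ι : k →+* M} {D : Idx e p m → M → M}
  {α : Type*}

lemma Interp.realize_cst (h : Interp ι D) (x : α → M) (c : k) : (cst c : (hsLang k e p m).Term α).realize x = ι c :=
  h.const c _

lemma Interp.realize_der (h : Interp ι D) (x : α → M) (i : Idx e p m)
    (t : (hsLang k e p m).Term α) :
    (GDCF.der i t).realize x = D i (t.realize x) := h.der i _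

lemma Interp.realize_zero (h : Interp ι D) (x : α → M) : (0 : (hsLang k e p m).Term α).realize x = 0 := h.zero _

lemma Interp.realize_one (h : Interp ι D) (x : α → M) : (1 : (hsLang k e p m).Term α).realize x = 1 := h.one _

lemma Interp.realize_add (h : Interp ι D) (x : α → M)
    (s t : (hsLang k e p m).Term α) :
    (s + t).realize x = s.realize x + t.realize x := h.add _

lemma Interp.realize_mul (h : Interp ι D) (x : α → M)
    (s t : (hsLang k e p m).Term α) :
    (s * t).realize x = s.realize x * t.realize x := h.mul _

lemma Interp.realize_tpow (h : Interp ι D) (x : α → M) (n : ℕ)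
    (t : (hsLang k e p m).Term α) :
    (tpow n t).realize x = t.realize x ^ n := by
  induction n with
  | zero => exact (h.realize_one x).trans (pow_zero _).symm
  | succ n ih => rw [pow_succ, ← ih]; exact h.realize_mul x _ _

lemma Interp.realize_sumT (h : Interp ι D) (x : α → M) {β : Type*} (s : Finset β)
    (t : β → (hsLang k e p m).Term α) :
    (sumT s t).realize x = ∑ b ∈ s, (t b).realize x := by
  rw [sumT, ← Finset.sum_map_toList]
  induction s.toList with
  | nil => exact h.realize_zero x
  | cons b l ih =>
    rw [List.map_cons, List.map_cons, List.sum_cons, List.sum_cons, ← ih]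
    exact h.realize_add x _ _

lemma Interp.realize_derZeroAx (h : Interp ι D) (i : Idx e p m) :
    M ⊨ derZeroAx k e p m i ↔ ((∀ a, (i a : ℕ) = 0) → ∀ x, D i x = x) := by
  rw [derZeroAx]
  split_ifs with hi
  · simp [Sentence.Realize, Formula.Realize, h.realize_der, Fin.snoc, hi]
  · simp [Sentence.Realize, Formula.Realize, hi]

lemma Interp.realize_derAddAx (h : Interp ι D) (i : Idx e p m) :
    M ⊨ derAddAx k i ↔ ∀ x y, D i (x + y) = D i x + D i y := by
  simp [derAddAx, Sentence.Realize, Formula.Realize, h.realize_der, h.realize_add, Fin.snoc]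

lemma Interp.realize_derSMulAx (h : Interp ι D) (i : Idx e p m) (c : k) :
    M ⊨ derSMulAx i c ↔ ∀ x, D i (ι c * x) = ι c * D i x := by
  simp [derSMulAx, Sentence.Realize, Formula.Realize, h.realize_der, h.realize_mul, h.realize_cst,
    Fin.snoc]

lemma Interp.realize_derMulAx (h : Interp ι D) (i : Idx e p m) :
    M ⊨ derMulAx k i ↔ ∀ x y, D i (x * y) = ∑ jl ∈ splits i, D jl.1 x * D jl.2 y := by
  simp [derMulAx, Sentence.Realize, Formula.Realize, h.realize_der, h.realize_mul, h.realize_sumT,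
    Fin.snoc, splits]
  congr!

lemma Interp.realize_iterAx (h : Interp ι D) (W : FormalGroupLaw e k) (i j : Idx e p m) :
    M ⊨ iterAx W i j ↔ ∀ x, D j (D i x) = ∑ l, ι (W.structConst p m i j l) * D l x := by
  simp [iterAx, Sentence.Realize, Formula.Realize, h.realize_der, h.realize_mul, h.realize_cst,
    h.realize_sumT, Fin.snoc]

lemma Interp.realize_strictAx [Fact p.Prime] (h : Interp ι D) :
    M ⊨ strictAx k e p m ↔ Strict D := by
  simp [strictAx, Sentence.Realize, Formula.Realize, h.realize_der, h.realize_zero, Strict,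
    h.realize_tpow, Fin.snoc]

lemma Interp.realize_imperfAx (h : Interp ι D) :
    M ⊨ imperfAx k e p m ↔ HasPowerBasis M p (p ^ e) := by
  simp [imperfAx, Sentence.Realize, Formula.Realize, h.realize_zero, HasPowerBasis, h.realize_mul,
    h.realize_sumT, h.realize_tpow]
  exact exists_congr fun b => and_congr Iff.rfl ⟨fun h y => h fun _ => y, fun h i => h _⟩

open Polynomial in
lemma Interp.realize_sepClosedAx (h : Interp ι D) :
    (∀ n, M ⊨ sepClosedAx k e p m n) ↔ IsSepClosed M := by
  have h1 : ∀ n, M ⊨ sepClosedAx k e p m n ↔ ∀ c : Fin (n + 1) → M,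
      (∃ i : Fin (n + 1), ((i : ℕ) : M) * c i ≠ 0) → ∃ x, ∑ i, c i * x ^ (i : ℕ) = 0 := by
    intro n
    simp [sepClosedAx, Sentence.Realize, Formula.Realize, h.realize_zero, h.realize_mul,
      h.realize_sumT, h.realize_tpow, h.realize_cst, Fin.snoc]
  simp only [h1]
  constructor
  · intro hM
    refine IsSepClosed.of_exists_root_of_derivative_ne_zero fun f hf => ?_
    obtain ⟨x, hx⟩ := hM f.natDegree (fun i => f.coeff i) (by
      by_contra! hcon
      refine hf (Polynomial.ext fun n => ?_)
      rw [coeff_derivative, coeff_zero]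
      by_cases hn : n + 1 < f.natDegree + 1
      · have := hcon ⟨n + 1, hn⟩
        rw [mul_comm]
        simpa using this
      · rw [coeff_eq_zero_of_natDegree_lt (by omega), zero_mul])
    refine ⟨x, ?_⟩
    rw [eval_eq_sum_range, ← Fin.sum_univ_eq_sum_range (fun i => f.coeff i * x ^ i)]
    exact hx
  · intro _ n c ⟨i, hi⟩
    have hcoeff : ∀ j : Fin (n + 1), (∑ i : Fin (n + 1), monomial (i : ℕ) (c i)).coeff j = c j := fun j => by
      simp [finsetSum_coeff, coeff_monomial, Fin.val_inj]
    obtain ⟨x, hx⟩ := IsSepClosed.exists_root_of_derivative_ne_zero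
      (∑ i : Fin (n + 1), monomial (i : ℕ) (c i)) fun h0 => by
        rcases Nat.eq_zero_or_pos (i : ℕ) with hi0 | hi0
        · rw [hi0] at hi
          simp at hi
        · refine hi ?_
          have := congrArg (fun q : M[X] => q.coeff ((i : ℕ) - 1)) h0
          simp only [coeff_derivative, coeff_zero, Nat.sub_add_cancel hi0, hcoeff] at this
          rw [mul_comm, ← this]
          congr 1
          rw [← Nat.cast_add_one, Nat.sub_add_cancel hi0]
    refine ⟨x, ?_⟩
    rw [← hx, eval_finsetSum]
    simp

lemma Interp.model_gDF [Fact p.Prime] (h : Interp ι D) (W : FormalGroupLaw e k)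
    (hfield : M ⊨ (ringLHom k e p m).onTheory Theory.field) :
    M ⊨ gDF W p m ↔ GAct W p m ι D := by
  rw [gDF_eq]
  simp only [Theory.model_union_iff]
  simp only [Theory.model_iff, Set.forall_mem_range,
    Set.mem_singleton_iff, forall_eq, h.realize_derZeroAx, h.realize_derAddAx, h.realize_derSMulAx,
    h.realize_derMulAx, h.realize_iterAx, Prod.forall]
  constructor
  · rintro ⟨⟨⟨⟨⟨-, h0⟩, ha⟩, hs⟩, hm⟩, hi⟩
    exact ⟨h0 0 fun _ => rfl, ha, hs, hm, hi⟩
  · intro hG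
    refine ⟨⟨⟨⟨⟨⟨⟨⟨(Theory.model_iff _).1 hfield, fun c d => ?_⟩, fun c d => ?_⟩, ?_⟩, fun i hi => ?_⟩,
      hG.add⟩, hG.smul⟩, hG.mul⟩, hG.iter⟩
    · simp [constAddAx, Sentence.Realize, Formula.Realize, h.realize_cst, h.realize_add]
    · simp [constMulAx, Sentence.Realize, Formula.Realize, h.realize_cst, h.realize_mul]
    · simp [constOneAx, Sentence.Realize, Formula.Realize, h.realize_cst, h.realize_one]
    · rw [show i = 0 from funext fun a => Fin.ext (hi a)]
      exact hG.zero

/-- Fields with the structure given by the ring operations satisfy the field axioms. -/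
lemma Interp.model_field (h : Interp ι D) :
    M ⊨ (ringLHom k e p m).onTheory Theory.field := by
  let r : Language.ring.Structure M := (ringLHom k e p m).reduct M
  rw [LHom.onTheory_model]
  let c : Ring.CompatibleRing M :=
    { r with
      funMap_add := h.add
      funMap_mul := h.mul
      funMap_neg := h.neg
      funMap_zero := h.zero
      funMap_one := h.one }
  exact (inferInstance : @Theory.Model Language.ring M c.toStructure Theory.field)

/-- A structure satisfying the axioms of `W[m]`-fields is a `W[m]`-field. -/
theorem exists_interp {M : Type*} [(hsLang k e p m).Structure M] [Fact p.Prime] [CharP k p]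
    (W : FormalGroupLaw e k) (hM : M ⊨ gDF W p m) :
    ∃ (_ : Field M) (_ : CharP M p) (ι : k →+* M) (D : Idx e p m → M → M),
      Interp ι D ∧ GAct W p m ι D := by
  have hM' := hM
  rw [gDF_eq] at hM'
  simp only [Theory.model_union_iff] at hM'
  simp only [Theory.model_iff, Set.forall_mem_range,
    Set.mem_singleton_iff, forall_eq, Prod.forall] at hM'
  obtain ⟨⟨⟨⟨⟨⟨⟨⟨hf, hca⟩, hcm⟩, hc1⟩, -⟩, -⟩, -⟩, -⟩, -⟩ := hM'
  have hfield := (Theory.model_iff _).2 hf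
  let r : Language.ring.Structure M := (ringLHom k e p m).reduct M
  have : M ⊨ Theory.field := (LHom.onTheory_model _ _).1 hfield
  let _ : Field M := Field.fieldOfModelField M
  let _ : Ring.CompatibleRing M := Field.compatibleRingOfModelField M
  let D : Idx e p m → M → M := fun i x =>
    funMap (L := hsLang k e p m) (Sum.inr (OpFunc.der i)) ![x]
  let ι₀ : k → M := fun c => funMap (L := hsLang k e p m) (Sum.inr (OpFunc.const c)) ![]
  have hcst : ∀ (c : k) (x : Empty ⊕ Fin 0 → M),
      (cst c : (hsLang k e p m).Term (Empty ⊕ Fin 0)).realize x = ι₀ c := fun c x =>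
    congrArg (funMap (L := hsLang k e p m) (Sum.inr (OpFunc.const c))) (Subsingleton.elim _ _)
  have hadd : ∀ a b, ι₀ (a + b) = ι₀ a + ι₀ b := fun a b => by
    have h1 := hca a b
    simp only [constAddAx, Sentence.Realize, Formula.Realize, BoundedFormula.realize_bdEqual] at h1
    rw [hcst] at h1
    refine h1.trans ((Ring.CompatibleRing.funMap_add _).trans ?_)
    exact congrArg₂ _ (hcst a _) (hcst b _)
  have hmul : ∀ a b, ι₀ (a * b) = ι₀ a * ι₀ b := fun a b => by
    have h1 := hcm a b
    simp only [constMulAx, Sentence.Realize, Formula.Realize, BoundedFormula.realize_bdEqual] at h1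
    rw [hcst] at h1
    refine h1.trans ((Ring.CompatibleRing.funMap_mul _).trans ?_)
    exact congrArg₂ _ (hcst a _) (hcst b _)
  have hone : ι₀ 1 = 1 := by
    have h1 := hc1
    simp only [constOneAx, Sentence.Realize, Formula.Realize, BoundedFormula.realize_bdEqual] at h1
    rw [hcst] at h1
    exact h1.trans (Ring.CompatibleRing.funMap_one _)
  let ι : k →+* M := RingHom.mk' ⟨⟨ι₀, hone⟩, hmul⟩ hadd
  have hI : Interp ι D :=
    { zero := Ring.CompatibleRing.funMap_zero
      one := Ring.CompatibleRing.funMap_one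
      neg := Ring.CompatibleRing.funMap_neg
      add := Ring.CompatibleRing.funMap_add
      mul := Ring.CompatibleRing.funMap_mul
      const := fun c x => congrArg _ (Subsingleton.elim _ _)
      der := fun i x => congrArg _ (funext fun j => by rw [Subsingleton.elim j 0]; rfl) }
  have hp : (p : M) = 0 := by rw [← map_natCast ι, CharP.cast_eq_zero, map_zero]
  exact ⟨inferInstance, (CharP.charP_iff_prime_eq_zero Fact.out).2 hp, ι, D, hI,
    (hI.model_gDF W hfield).1 hM⟩

/-- The structure given by a homomorphism `ι` and maps `D_i`. -/
@[reducible]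
def hsStructure {M : Type*} [Field M] (ι : k →+* M) (D : Idx e p m → M → M) :
    (hsLang k e p m).Structure M where
  funMap := fun {_} f x => match f with
    | Sum.inl ringFunc.zero => 0
    | Sum.inl ringFunc.one => 1
    | Sum.inl ringFunc.neg => -x 0
    | Sum.inl ringFunc.add => x 0 + x 1
    | Sum.inl ringFunc.mul => x 0 * x 1
    | Sum.inr (OpFunc.const c) => ι c
    | Sum.inr (OpFunc.der i) => D i (x 0)
  RelMap := fun {_} r _ => r.elim Empty.elim Empty.elim

lemma interp_hsStructure {M : Type*} [Field M] (ι : k →+* M) (D : Idx e p m → M → M) :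
    let _ := hsStructure ι D
    Interp ι D := by
  intro _
  exact ⟨fun _ => rfl, fun _ => rfl, fun _ => rfl, fun _ => rfl, fun _ => rfl, fun _ _ => rfl,
    fun _ _ => rfl⟩

lemma Interp.model_gDCF [Fact p.Prime] (h : Interp ι D) (W : FormalGroupLaw e k) :
    M ⊨ gDCF W p m ↔
      GAct W p m ι D ∧ Strict D ∧ IsSepClosed M ∧ HasPowerBasis M p (p ^ e) := by
  rw [gDCF, Theory.model_union_iff, Theory.model_union_iff, Theory.model_union_iff,
    h.model_gDF W h.model_field, Theory.model_singleton_iff, Theory.model_singleton_iff,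
    h.realize_strictAx, h.realize_imperfAx, Theory.model_iff, Set.forall_mem_range,
    h.realize_sepClosedAx, and_assoc, and_assoc]

/-- A function commuting with the function symbols is a ring homomorphism compatible with `ι` and
`D`. -/
lemma Interp.exists_ringHom (h : Interp ι D) {N : Type*} [(hsLang k e p m).Structure N] [Field N]
    {ι' : k →+* N} {D' : Idx e p m → N → N} (h' : Interp ι' D') (f : M → N)
    (hf : ∀ {n} (F : (hsLang k e p m).Functions n) x, f (funMap F x) = funMap F (f ∘ x)) :
    ∃ φ : M →+* N, (∀ x, φ x = f x) ∧ φ.comp ι = ι' ∧ ∀ i x, D' i (φ x) = φ (D i x) := by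
  refine ⟨⟨⟨⟨f, ?_⟩, fun x y => ?_⟩, ?_, fun x y => ?_⟩, fun x => rfl, RingHom.ext fun c => ?_,
    fun i x => ?_⟩
  · exact (congrArg f (h.one ![]).symm).trans ((hf _ _).trans (h'.one _))
  · exact (congrArg f (h.mul ![x, y]).symm).trans ((hf _ _).trans (h'.mul _))
  · change f 0 = 0
    exact (congrArg f (h.zero ![]).symm).trans ((hf _ _).trans (h'.zero _))
  · exact (congrArg f (h.add ![x, y]).symm).trans ((hf _ _).trans (h'.add _))
  · exact (congrArg f (h.const c ![]).symm).trans ((hf _ _).trans (h'.const c _))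
  · exact ((congrArg f (h.der i ![x]).symm).trans ((hf _ _).trans (h'.der i _))).symm

/-- A ring homomorphism compatible with `ι` and `D` commutes with the function symbols. -/
lemma Interp.map_funMap (h : Interp ι D) {N : Type*} [(hsLang k e p m).Structure N] [Field N]
    {ι' : k →+* N} {D' : Idx e p m → N → N} (h' : Interp ι' D') (φ : M →+* N)
    (hι : φ.comp ι = ι') (hD : ∀ i x, D' i (φ x) = φ (D i x)) {n : ℕ}
    (F : (hsLang k e p m).Functions n) (x : Fin n → M) : φ (funMap F x) = funMap F (φ ∘ x) := by
  subst hι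
  match n, F with
  | _, Sum.inl ringFunc.zero => rw [h.zero, h'.zero, map_zero]
  | _, Sum.inl ringFunc.one => rw [h.one, h'.one, map_one]
  | _, Sum.inl ringFunc.neg => rw [h.neg, h'.neg, map_neg]; rfl
  | _, Sum.inl ringFunc.add => rw [h.add, h'.add, map_add]; rfl
  | _, Sum.inl ringFunc.mul => rw [h.mul, h'.mul, map_mul]; rfl
  | _, Sum.inr (OpFunc.const c) => rw [h.const, h'.const]; rfl
  | _, Sum.inr (OpFunc.der i) => rw [h.der, h'.der, ← hD]; rfl

instance isEmpty_relations_hsLang (n : ℕ) : IsEmpty ((hsLang k e p m).Relations n) :=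
  ⟨fun r => Sum.elim Empty.elim Empty.elim r⟩

instance isEmpty_relations_hsLamLang (n : ℕ) : IsEmpty ((hsLamLang k e p m).Relations n) :=
  ⟨fun r => Sum.elim isEmptyElim Empty.elim r⟩

/-- A ring homomorphism compatible with `ι` and `D` is an embedding of structures. -/
lemma Interp.exists_embedding (h : Interp ι D) {N : Type*} [(hsLang k e p m).Structure N] [Field N]
    {ι' : k →+* N} {D' : Idx e p m → N → N} (h' : Interp ι' D') (φ : M →+* N)
    (hι : φ.comp ι = ι') (hD : ∀ i x, D' i (φ x) = φ (D i x)) :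
    ∃ g : M ↪[hsLang k e p m] N, ∀ x, g x = φ x :=
  ⟨{ toFun := φ
     inj' := φ.injective
     map_fun' := fun F x => h.map_funMap h' φ hι hD F x
     map_rel' := fun r => isEmptyElim r }, fun _ => rfl⟩

end Interpretation

section Lambda

open Language Structure

/-- The function `λ`: inverse to Frobenius on the `p`-th powers, and zero elsewhere. -/
def IsLam {K : Type*} [Field K] (p : ℕ) (lam : K → K) : Prop :=
  ∀ x, lam x ^ p = x ∨ lam x = 0 ∧ ¬∃ y, y ^ p = x

lemma exists_isLam (K : Type*) [Field K] (p : ℕ) : ∃ lam : K → K, IsLam p lam := by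
  refine ⟨fun x => open scoped Classical in if h : ∃ y, y ^ p = x then h.choose else 0, fun x => ?_⟩
  dsimp only
  split_ifs with h
  · exact Or.inl h.choose_spec
  · exact Or.inr ⟨rfl, h⟩

lemma lamAx_eq (k : Type u) (e p m : ℕ) : lamAx k e p m =
    ∀' ∀' ((Functions.apply₁ (L := hsLamLang k e p m) (Sum.inr LamFunc.lam)
        (Term.var (Sum.inr 0)) =' Term.var (Sum.inr 1)) ⟹
      (hsLHom k e p m).onBoundedFormula
        ((tpow p (Term.var (Sum.inr 1)) =' Term.var (Sum.inr 0)) ⊔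
          ((Term.var (Sum.inr 1) =' 0) ⊓
            ∼(∃' (tpow p (Term.var (Sum.inr 2)) =' Term.var (Sum.inr 0)))))) := rfl

variable {k : Type u} [CommRing k] {e p m : ℕ}

/-- Homomorphisms from strict `W[m]`-fields respect `λ`: an element that is not a `p`-th power is not
a constant, and this is preserved. -/
lemma IsLam.map_comm [Fact p.Prime] {W : FormalGroupLaw e k} (hm : 0 < m) {K N : Type*} [Field K]
    [Field N] [CharP N p] {D : Idx e p m → K → K} (hstr : Strict D) {ι' : k →+* N}
    {D' : Idx e p m → N → N} (h' : GAct W p m ι' D') {φ : K →+* N}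
    (hD : ∀ i x, D' i (φ x) = φ (D i x)) {lam : K → K} {lam' : N → N} (hl : IsLam p lam)
    (hl' : IsLam p lam') (x : K) : lam' (φ x) = φ (lam x) := by
  rcases hl x with h1 | ⟨h1, h2⟩
  · rcases hl' (φ x) with h3 | ⟨-, h4⟩
    · refine frobenius_inj N p ?_
      rw [frobenius_def, frobenius_def, h3, ← map_pow, h1]
    · exact absurd ⟨φ (lam x), by rw [← map_pow, h1]⟩ h4
  · rcases hl' (φ x) with h3 | ⟨h4, -⟩
    · refine absurd (hstr x fun a => φ.injective ?_) h2
      rw [map_zero, ← hD, ← h3, h'.unitIdx_pow hm]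
    · rw [h4, h1, map_zero]

/-- The structure on `M` is the one given by field operations, a homomorphism `ι : k → M`, maps `D_i`
and a map `lam`. -/
structure InterpLam {M : Type*} [(hsLamLang k e p m).Structure M] [Field M] (ι : k →+* M)
    (D : Idx e p m → M → M) (lam : M → M) : Prop where
  base : let _ := (hsLHom k e p m).reduct M
    Interp ι D
  lam : ∀ x, funMap (L := hsLamLang k e p m) (Sum.inr LamFunc.lam) x = lam (x 0)

variable {M : Type*} [(hsLamLang k e p m).Structure M] [Field M] {ι : k →+* M}
  {D : Idx e p m → M → M} {lam : M → M}

lemma InterpLam.realize_lamAx (h : InterpLam ι D lam) : M ⊨ lamAx k e p m ↔ IsLam p lam := by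
  let _ := (hsLHom k e p m).reduct M
  have hb := h.base
  have hl : ∀ (t : (hsLamLang k e p m).Term (Empty ⊕ Fin 2)) (x : Empty ⊕ Fin 2 → M),
      (Functions.apply₁ (L := hsLamLang k e p m) (Sum.inr LamFunc.lam) t).realize x =
        lam (t.realize x) := fun t x => h.lam _
  rw [lamAx_eq]
  simp [Sentence.Realize, Formula.Realize, BoundedFormula.realize_all, hl,
    BoundedFormula.realize_imp, BoundedFormula.realize_bdEqual, LHom.realize_onBoundedFormula,
    hb.realize_tpow, hb.realize_zero, Fin.snoc, IsLam]

lemma model_gDFLam_iff [Fact p.Prime] (W : FormalGroupLaw e k) (M : Type*)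
    [(hsLamLang k e p m).Structure M] : M ⊨ gDFLam W p m ↔
      (let _ := (hsLHom k e p m).reduct M
      M ⊨ gDF W p m ∧ M ⊨ strictAx k e p m) ∧ M ⊨ lamAx k e p m := by
  let _ := (hsLHom k e p m).reduct M
  have : gDFLam W p m = (hsLHom k e p m).onTheory (gDF W p m ∪ {strictAx k e p m}) ∪
    {lamAx k e p m} := rfl
  rw [this, Theory.model_union_iff, LHom.onTheory_model, Theory.model_union_iff,
    Theory.model_singleton_iff, Theory.model_singleton_iff]

lemma model_gDCFLam_iff [Fact p.Prime] (W : FormalGroupLaw e k) (M : Type*)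
    [(hsLamLang k e p m).Structure M] : M ⊨ gDCFLam W p m ↔
      (let _ := (hsLHom k e p m).reduct M
      M ⊨ gDCF W p m) ∧ M ⊨ lamAx k e p m := by
  let _ := (hsLHom k e p m).reduct M
  have : gDCFLam W p m = (hsLHom k e p m).onTheory (gDCF W p m) ∪ {lamAx k e p m} := rfl
  rw [this, Theory.model_union_iff, LHom.onTheory_model, Theory.model_singleton_iff]

lemma model_gDF_of_gDCF [Fact p.Prime] (W : FormalGroupLaw e k) {M : Type*}
    [(hsLang k e p m).Structure M] (h : M ⊨ gDCF W p m) :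
    M ⊨ gDF W p m ∧ M ⊨ strictAx k e p m := by
  rw [gDCF, Theory.model_union_iff, Theory.model_union_iff, Theory.model_union_iff,
    Theory.model_singleton_iff] at h
  exact h.1.1

lemma model_gDFLam_of_gDCFLam [Fact p.Prime] (W : FormalGroupLaw e k) {M : Type*}
    [(hsLamLang k e p m).Structure M] (h : M ⊨ gDCFLam W p m) : M ⊨ gDFLam W p m := by
  rw [model_gDCFLam_iff] at h
  let _ := (hsLHom k e p m).reduct M
  exact (model_gDFLam_iff W M).2 ⟨model_gDF_of_gDCF W h.1, h.2⟩

theorem exists_interpLam [Fact p.Prime] [CharP k p] (W : FormalGroupLaw e k) (M : Type*)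
    [(hsLamLang k e p m).Structure M] (hM : M ⊨ gDFLam W p m) :
    ∃ (_ : Field M) (_ : CharP M p) (ι : k →+* M) (D : Idx e p m → M → M) (lam : M → M),
      InterpLam ι D lam ∧ GAct W p m ι D ∧ Strict D ∧ IsLam p lam := by
  rw [model_gDFLam_iff] at hM
  let _ := (hsLHom k e p m).reduct M
  obtain ⟨_, _, ι, D, hI, hG⟩ := exists_interp W hM.1.1
  have hL : InterpLam ι D fun x => funMap (L := hsLamLang k e p m) (Sum.inr LamFunc.lam) ![x] :=
    ⟨hI, fun x => congrArg (funMap (L := hsLamLang k e p m) (Sum.inr LamFunc.lam))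
      (funext fun j => by rw [Subsingleton.elim j 0]; rfl)⟩
  exact ⟨inferInstance, inferInstance, ι, D, _, hL, hG, hI.realize_strictAx.1 hM.1.2,
    hL.realize_lamAx.1 hM.2⟩

lemma InterpLam.model_gDCFLam [Fact p.Prime] (h : InterpLam ι D lam) (W : FormalGroupLaw e k) :
    M ⊨ gDCFLam W p m ↔ (GAct W p m ι D ∧ Strict D ∧ IsSepClosed M ∧ HasPowerBasis M p (p ^ e)) ∧
      IsLam p lam := by
  let _ := (hsLHom k e p m).reduct M
  rw [model_gDCFLam_iff, h.realize_lamAx, ← h.base.model_gDCF W]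

lemma InterpLam.exists_ringHom (h : InterpLam ι D lam) {N : Type*}
    [(hsLamLang k e p m).Structure N] [Field N] {ι' : k →+* N} {D' : Idx e p m → N → N} {lam' : N → N}
    (h' : InterpLam ι' D' lam') (f : M ↪[hsLamLang k e p m] N) :
    ∃ φ : M →+* N, (∀ x, φ x = f x) ∧ φ.comp ι = ι' ∧ ∀ i x, D' i (φ x) = φ (D i x) := by
  let _ := (hsLHom k e p m).reduct M
  let _ := (hsLHom k e p m).reduct N
  exact h.base.exists_ringHom h'.base f fun F x => f.map_fun (Sum.inl F) x

lemma InterpLam.exists_embedding (h : InterpLam ι D lam) {N : Type*}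
    [(hsLamLang k e p m).Structure N] [Field N] {ι' : k →+* N} {D' : Idx e p m → N → N} {lam' : N → N}
    (h' : InterpLam ι' D' lam') (φ : M →+* N) (hι : φ.comp ι = ι')
    (hD : ∀ i x, D' i (φ x) = φ (D i x)) (hlam : ∀ x, lam' (φ x) = φ (lam x)) :
    ∃ g : M ↪[hsLamLang k e p m] N, ∀ x, g x = φ x := by
  let _ := (hsLHom k e p m).reduct M
  let _ := (hsLHom k e p m).reduct N
  refine ⟨⟨⟨φ, φ.injective⟩, fun {n} F x => ?_, fun r => isEmptyElim r⟩, fun _ => rfl⟩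
  match n, F with
  | _, Sum.inl F => exact h.base.map_funMap h'.base φ hι hD F x
  | _, Sum.inr LamFunc.lam =>
    exact (congrArg φ (h.lam x)).trans ((hlam _).symm.trans (h'.lam (φ ∘ x)).symm)

/-- Expansion of a structure by a function `lam`. -/
@[reducible]
def lamStructure {M : Type*} [(hsLang k e p m).Structure M] (lam : M → M) :
    (hsLamLang k e p m).Structure M where
  funMap := fun {_} f x => match f with
    | Sum.inl F => funMap F x
    | Sum.inr LamFunc.lam => lam (x 0)
  RelMap := fun {_} r _ => r.elim isEmptyElim Empty.elim

lemma Interp.lamStructure {M : Type*} [s : (hsLang k e p m).Structure M] [Field M] {ι : k →+* M}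
    {D : Idx e p m → M → M} (h : Interp ι D) (lam : M → M) :
    let _ := lamStructure (k := k) (e := e) (p := p) (m := m) lam
    InterpLam ι D lam := by
  intro _
  exact ⟨@Interp.mk k _ e p m M ((hsLHom k e p m).reduct M) _ ι D h.zero h.one h.neg h.add h.mul
    h.const h.der, fun _ => rfl⟩

end Lambda

/-! ### Model completeness -/

section Ultrapower

open Language

variable {L : FirstOrder.Language.{u, v}} {I M : Type*} [L.Structure M] [Nonempty M]

/-- The diagonal embedding into an ultrapower. -/
def ultrapowerEmbedding (U : Ultrafilter I) :
    M ↪ₑ[L] (U : Filter I).Product fun _ => M where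
  toFun x := ((fun _ => x : I → M) : (U : Filter I).Product fun _ => M)
  map_formula' _ φ x := (Ultraproduct.realize_formula_cast φ fun i _ => x i).trans
    Filter.eventually_const

end Ultrapower

section ModelComplete

open Language Structure

variable {k : Type u} [CommRing k] {e p m : ℕ} [Fact p.Prime] [CharP k p]

lemma infinite_of_isSepClosed (K : Type*) [Field K] [IsSepClosed K] : Infinite K := by
  refine Infinite.of_not_fintype fun _ => ?_
  -- `X^q - X + 1` has no root in the field with `q` elements
  let f : Polynomial K := Polynomial.X ^ Fintype.card K - Polynomial.X + 1
  obtain ⟨x, hx⟩ := IsSepClosed.exists_root_of_derivative_ne_zero f (by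
    simp [f, Polynomial.derivative_X_pow])
  simp [f, FiniteField.pow_card] at hx

/-- For every embedding `M → N` of models of `𝔤-DCF_λ`, the structure `N` embeds over `M` into an
ultrapower of `M`. -/
theorem exists_embedding_ultrapower (W : FormalGroupLaw e k) (hm : 0 < m) (M N : Type w)
    [(hsLamLang k e p m).Structure M] [(hsLamLang k e p m).Structure N] [hM : M ⊨ gDCFLam W p m]
    [hN : N ⊨ gDCFLam W p m] [Nonempty M] (f : M ↪[hsLamLang k e p m] N) :
    ∃ (M' : Type w) (_ : (hsLamLang k e p m).Structure M') (i : M ↪ₑ[hsLamLang k e p m] M')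
      (g : N ↪[hsLamLang k e p m] M'), ∀ x, g (f x) = i x := by
  classical
  -- maps `N → M` that respect the ring operations on ever larger finite sets converge to a
  -- homomorphism into the ultrapower along an ultrafilter on the finite subsets of `N`
  let U : Ultrafilter (Finset N) := Ultrafilter.of Filter.atTop
  let M' := (U : Filter (Finset N)).Product fun _ => M
  let i : M ↪ₑ[hsLamLang k e p m] M' := ultrapowerEmbedding U
  have hM' : M' ⊨ gDCFLam W p m := (i.elementarilyEquivalent.theory_model_iff).1 hM
  obtain ⟨_, _, ι, D, lam, hI, hG, hstr, hlam⟩ :=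
    exists_interpLam W M (model_gDFLam_of_gDCFLam W hM)
  obtain ⟨_, _, ιN, DN, lamN, hIN, hGN, hstrN, hlamN⟩ :=
    exists_interpLam W N (model_gDFLam_of_gDCFLam W hN)
  obtain ⟨_, _, ι', D', lam', hI', hG', hstr', hlam'⟩ :=
    exists_interpLam W M' (model_gDFLam_of_gDCFLam W hM')
  obtain ⟨⟨-, -, hsep, hbasis⟩, -⟩ := (hI.model_gDCFLam W).1 hM
  obtain ⟨⟨-, -, -, hbasisN⟩, -⟩ := (hIN.model_gDCFLam W).1 hN
  obtain ⟨j, hj, rfl, hjD⟩ := hI.exists_ringHom hIN f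
  obtain ⟨i₀, hi₀, rfl, hiD⟩ := hI.exists_ringHom hI' i.toEmbedding
  have := infinite_of_isSepClosed M
  let _ : Algebra M N := j.toAlgebra
  choose φ hφ hφc using fun s : Finset N => exists_partial_hom (K := M) (N := N) p
    (fun hv => hG.linearIndependent_pow hstr hGN hm hjD hv) s
  let q : (Finset N → M) → M' := fun c => (c : (U : Filter (Finset N)).Product fun _ => M)
  have hq : ∀ {c d : Finset N → M}, (∀ᶠ s in (U : Filter (Finset N)), c s = d s) → q c = q d :=
    fun h => Quotient.sound h
  have hmem : ∀ y : N, ∀ᶠ s in (U : Filter (Finset N)), y ∈ s := fun y => by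
    have h1 : ∀ᶠ s in (Filter.atTop : Filter (Finset N)), {y} ⊆ s := Filter.eventually_ge_atTop {y}
    exact (h1.filter_mono (Ultrafilter.of_le _)).mono fun s hs => by simpa using hs
  let _ := (hsLHom k e p m).reduct M
  let _ := (hsLHom k e p m).reduct M'
  have hqadd : ∀ c d, q (fun s => c s + d s) = q c + q d := fun c d =>
    ((hI'.base.add ![q c, q d]).symm.trans ((congrArg _ (funext fun a => by
      fin_cases a <;> rfl)).trans ((Ultraproduct.funMap_cast (L := hsLamLang k e p m)
        (Sum.inl (Sum.inl ringFunc.add)) ![c, d]).trans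
        (hq (.of_forall fun s => hI.base.add _))))).symm
  have hqmul : ∀ c d, q (fun s => c s * d s) = q c * q d := fun c d =>
    ((hI'.base.mul ![q c, q d]).symm.trans ((congrArg _ (funext fun a => by
      fin_cases a <;> rfl)).trans ((Ultraproduct.funMap_cast (L := hsLamLang k e p m)
        (Sum.inl (Sum.inl ringFunc.mul)) ![c, d]).trans
        (hq (.of_forall fun s => hI.base.mul _))))).symm
  have hgj : ∀ x, q (fun s => φ s (j x)) = i₀ x := fun x => by
    rw [hi₀]
    exact hq ((hmem (j x)).mono fun s hs => hφc s x hs)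
  let g : N →+* M' :=
    { toFun := fun y => q fun s => φ s y
      map_one' := by rw [← map_one j, hgj, map_one]
      map_zero' := by rw [← map_zero j, hgj, map_zero]
      map_add' := fun x y => by
        rw [← hqadd]
        exact hq (((hmem x).and (hmem y)).mono fun s hs => (hφ s x hs.1 y hs.2).1)
      map_mul' := fun x y => by
        rw [← hqmul]
        exact hq (((hmem x).and (hmem y)).mono fun s hs => (hφ s x hs.1 y hs.2).2) }
  have hgj' : ∀ x, g (j x) = i₀ x := hgj
  -- the imperfection degree forces compatibility with the action
  have hgD : ∀ i y, D' i (g y) = g (DN i y) := hG.map_comm_of_comp hGN hG' hm hjD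
    (fun i x => by rw [hgj', hgj', hiD]) hstr hbasis hbasisN
  obtain ⟨g', hg'⟩ := hIN.exists_embedding hI' g (RingHom.ext fun c => hgj' (ι c)) hgD
    (IsLam.map_comm hm hstrN hG' hgD hlamN hlam')
  refine ⟨M', inferInstance, i, g', fun x => ?_⟩
  rw [hg', ← hj, hgj', hi₀]
  rfl

/-- Embeddings of models of `𝔤-DCF_λ` are elementary. -/
theorem realize_comp_gDCFLam (W : FormalGroupLaw e k) (hm : 0 < m) {M N : Type w}
    [(hsLamLang k e p m).Structure M] [(hsLamLang k e p m).Structure N] (hM : M ⊨ gDCFLam W p m)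
    (hN : N ⊨ gDCFLam W p m) [Nonempty M] (f : M ↪[hsLamLang k e p m] N) {n : ℕ}
    (φ : (hsLamLang k e p m).Formula (Fin n)) (x : Fin n → M) :
    φ.Realize (f ∘ x) ↔ φ.Realize x := by
  have := realize_comp_of_robinson (gDCFLam W p m)
    (fun M N _ _ _ _ _ f => exists_embedding_ultrapower W hm M N f) φ M N f x default
  rw [← Formula.Realize] at this
  rw [← this, Formula.Realize]
  congr!

/-- Embeddings of models of `𝔤-DCF` are elementary: they respect `λ`. -/
theorem realize_comp_gDCF (W : FormalGroupLaw e k) (hm : 0 < m) {M N : Type w}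
    [(hsLang k e p m).Structure M] [(hsLang k e p m).Structure N] (hM : M ⊨ gDCF W p m)
    (hN : N ⊨ gDCF W p m) [Nonempty M] (f : M ↪[hsLang k e p m] N) {n : ℕ}
    (φ : (hsLang k e p m).Formula (Fin n)) (x : Fin n → M) :
    φ.Realize (f ∘ x) ↔ φ.Realize x := by
  obtain ⟨_, _, ι, D, hI, hG⟩ := exists_interp W (model_gDF_of_gDCF W hM).1
  obtain ⟨_, _, ιN, DN, hIN, hGN⟩ := exists_interp W (model_gDF_of_gDCF W hN).1
  obtain ⟨lam, hlam⟩ := exists_isLam M p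
  obtain ⟨lamN, hlamN⟩ := exists_isLam N p
  let _ := lamStructure (k := k) (e := e) (p := p) (m := m) lam
  let _ := lamStructure (k := k) (e := e) (p := p) (m := m) lamN
  have hL := hI.lamStructure lam
  have hLN := hIN.lamStructure lamN
  obtain ⟨j, hj, hjι, hjD⟩ := hI.exists_ringHom hIN f fun F x => f.map_fun F x
  have hM' := (hI.model_gDCF W).1 hM
  obtain ⟨g, hg⟩ := hL.exists_embedding hLN j hjι hjD
    (IsLam.map_comm hm hM'.2.1 hGN hjD hlam hlamN)
  have h1 := realize_comp_gDCFLam W hm ((hL.model_gDCFLam W).2 ⟨hM', hlam⟩)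
    ((hLN.model_gDCFLam W).2 ⟨(hIN.model_gDCF W).1 hN, hlamN⟩) g ((hsLHom k e p m).onFormula φ) x
  have hexp : (hsLHom k e p m).IsExpansionOn M := ⟨fun _ _ => rfl, fun r => isEmptyElim r⟩
  have hexpN : (hsLHom k e p m).IsExpansionOn N := ⟨fun _ _ => rfl, fun r => isEmptyElim r⟩
  rw [LHom.realize_onFormula, LHom.realize_onFormula] at h1
  rw [← h1]
  have : (f : M → N) = g := funext fun x => by rw [hg, hj]
  rw [this]

end ModelComplete

/-! ### Types and embeddings -/

section Types

open Language Structure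

variable {k : Type u} [CommRing k] {e p m : ℕ} [Fact p.Prime]

/-- A subring of a product that is stable under the action carries the product action. -/
lemma GAct.restrict_prod {W : FormalGroupLaw e k} {K₁ K₂ : Type*} [CommRing K₁] [CommRing K₂]
    {ι₁ : k →+* K₁} {ι₂ : k →+* K₂} {D₁ : Idx e p m → K₁ → K₁} {D₂ : Idx e p m → K₂ → K₂}
    (h₁ : GAct W p m ι₁ D₁) (h₂ : GAct W p m ι₂ D₂) (A : Subring (K₁ × K₂))
    (hι : ∀ c, (ι₁.prod ι₂) c ∈ A) (hD : ∀ i, ∀ a ∈ A, (D₁ i a.1, D₂ i a.2) ∈ A) :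
    GAct W p m ((ι₁.prod ι₂).codRestrict A hι)
      fun i a => (⟨(D₁ i a.1.1, D₂ i a.1.2), hD i a a.2⟩ : A) where
  zero x := Subtype.ext (Prod.ext (h₁.zero _) (h₂.zero _))
  add i x y := Subtype.ext (Prod.ext (h₁.add _ _ _) (h₂.add _ _ _))
  smul i c x := Subtype.ext (Prod.ext (h₁.smul _ _ _) (h₂.smul _ _ _))
  mul i x y := Subtype.ext (Prod.ext
    ((h₁.mul _ _ _).trans (by simp [Prod.fst_sum]))
    ((h₂.mul _ _ _).trans (by simp [Prod.snd_sum])))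
  iter i j x := Subtype.ext (Prod.ext
    ((h₁.iter _ _ _).trans (by simp [Prod.fst_sum]))
    ((h₂.iter _ _ _).trans (by simp [Prod.snd_sum])))

variable [CharP k p]

/-- Tuples with the same quantifier-free type have the same type: the structures that they generate
are isomorphic strict `W[m]`-rings, over which the two models can be amalgamated. -/
theorem realize_of_qf_type (W : FormalGroupLaw e k) (hm : 0 < m) {M N : Type w}
    [(hsLamLang k e p m).Structure M] [(hsLamLang k e p m).Structure N] (hM : M ⊨ gDCFLam W p m)
    (hN : N ⊨ gDCFLam W p m) [Nonempty M] [Nonempty N] {n : ℕ} (x : Fin n → M) (y : Fin n → N)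
    (hxy : ∀ ψ : (hsLamLang k e p m).Formula (Fin n), BoundedFormula.IsQF ψ →
      (ψ.Realize x ↔ ψ.Realize y)) (φ : (hsLamLang k e p m).Formula (Fin n)) :
    φ.Realize x ↔ φ.Realize y := by
  obtain ⟨_, _, ι₁, D₁, lam₁, hI₁, hG₁, hstr₁, hlam₁⟩ :=
    exists_interpLam W M (model_gDFLam_of_gDCFLam W hM)
  obtain ⟨_, _, ι₂, D₂, lam₂, hI₂, hG₂, hstr₂, hlam₂⟩ :=
    exists_interpLam W N (model_gDFLam_of_gDCFLam W hN)
  let _ := (hsLHom k e p m).reduct M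
  let _ := (hsLHom k e p m).reduct N
  -- the isomorphism between the generated structures, as a subring of `M × N`
  let S : Set (M × N) := Set.range fun t : (hsLamLang k e p m).Term (Fin n) =>
    (t.realize x, t.realize y)
  have hS : ∀ {r : ℕ} (F : (hsLamLang k e p m).Functions r) (a : Fin r → M) (b : Fin r → N) {c : M}
      {d : N}, funMap F a = c → funMap F b = d → (∀ i, (a i, b i) ∈ S) → (c, d) ∈ S := by
    intro r F a b c d hc hd hab
    choose t ht using hab
    refine ⟨Term.func F t, Prod.ext (Eq.trans ?_ hc) (Eq.trans ?_ hd)⟩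
    · exact congrArg (funMap F) (funext fun i => congrArg Prod.fst (ht i))
    · exact congrArg (funMap F) (funext fun i => congrArg Prod.snd (ht i))
  let A : Subring (M × N) :=
    { carrier := S
      zero_mem' := hS (Sum.inl (Sum.inl ringFunc.zero)) ![] ![] (hI₁.base.zero _) (hI₂.base.zero _)
        fun i => i.elim0
      one_mem' := hS (Sum.inl (Sum.inl ringFunc.one)) ![] ![] (hI₁.base.one _) (hI₂.base.one _)
        fun i => i.elim0
      neg_mem' := fun {a} ha => hS (Sum.inl (Sum.inl ringFunc.neg)) ![a.1] ![a.2] (hI₁.base.neg _)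
        (hI₂.base.neg _) fun i => by fin_cases i; exact ha
      add_mem' := fun {a b} ha hb => hS (Sum.inl (Sum.inl ringFunc.add)) ![a.1, b.1] ![a.2, b.2]
        (hI₁.base.add _) (hI₂.base.add _) fun i => by fin_cases i; exacts [ha, hb]
      mul_mem' := fun {a b} ha hb => hS (Sum.inl (Sum.inl ringFunc.mul)) ![a.1, b.1] ![a.2, b.2]
        (hI₁.base.mul _) (hI₂.base.mul _) fun i => by fin_cases i; exacts [ha, hb] }
  have hι : ∀ c, (ι₁.prod ι₂) c ∈ A := fun c => hS (Sum.inl (Sum.inr (OpFunc.const c))) ![] ![]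
    (hI₁.base.const c _) (hI₂.base.const c _) fun i => i.elim0
  have hD : ∀ i, ∀ a ∈ A, (D₁ i a.1, D₂ i a.2) ∈ A := fun i a ha =>
    hS (Sum.inl (Sum.inr (OpFunc.der i))) ![a.1] ![a.2] (hI₁.base.der i _) (hI₂.base.der i _)
      fun i => by fin_cases i; exact ha
  have hlam : ∀ a ∈ A, (lam₁ a.1, lam₂ a.2) ∈ A := fun a ha =>
    hS (Sum.inr LamFunc.lam) ![a.1] ![a.2] (hI₁.lam _) (hI₂.lam _)
      fun i => by fin_cases i; exact ha
  -- whether a term vanishes is part of the quantifier-free type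
  have hzero : ∀ a ∈ A, a.1 = 0 ↔ a.2 = 0 := by
    intro a ha
    obtain ⟨t, rfl⟩ := ha
    obtain ⟨s, hs⟩ := A.zero_mem
    have h1 := hxy (t.equal s) (BoundedFormula.IsAtomic.equal _ _).isQF
    rw [Formula.realize_equal, Formula.realize_equal, show s.realize x = 0 from congrArg Prod.fst hs,
      show s.realize y = 0 from congrArg Prod.snd hs] at h1
    exact h1
  let j₁ : A →+* M := (RingHom.fst M N).comp A.subtype
  let j₂ : A →+* N := (RingHom.snd M N).comp A.subtype
  have hj₁ : Function.Injective j₁ := (injective_iff_map_eq_zero _).2 fun a ha =>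
    Subtype.ext (Prod.ext ha ((hzero a a.2).1 ha))
  have hj₂ : Function.Injective j₂ := (injective_iff_map_eq_zero _).2 fun a ha =>
    Subtype.ext (Prod.ext ((hzero a a.2).2 ha) ha)
  have : CharP A p := j₁.charP hj₁ p
  have hA := hG₁.restrict_prod hG₂ A hι hD
  -- closure under `λ` makes the constants `p`-th powers
  have hstrA : ∀ a : A, (∀ b, (⟨(D₁ (unitIdx b) a.1.1, D₂ (unitIdx b) a.1.2), hD _ a a.2⟩ : A) = 0) →
      ∃ b, b ^ p = a := by
    intro a ha
    obtain ⟨b, hb⟩ := hstr₁ a.1.1 fun i => congrArg (fun c : A => c.1.1) (ha i)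
    obtain ⟨c, hc⟩ := hstr₂ a.1.2 fun i => congrArg (fun c : A => c.1.2) (ha i)
    refine ⟨⟨_, hlam a a.2⟩, Subtype.ext (Prod.ext ?_ ?_)⟩
    · exact (hlam₁ a.1.1).resolve_right fun h => h.2 ⟨b, hb⟩
    · exact (hlam₂ a.1.2).resolve_right fun h => h.2 ⟨c, hc⟩
  obtain ⟨L, _, _, f₁, f₂, D, hG, hf, hf₁, hf₂⟩ := hA.exists_amalgam_of_ring hm hstrA hj₁ hj₂
    (D₁ := D₁) (D₂ := D₂) hG₁ hG₂ (fun _ _ => rfl) fun _ _ => rfl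
  obtain ⟨K, _, _, j, D', hG', hjD, hstr', hsep, hbasis⟩ := hG.exists_sepClosed hm
  obtain ⟨lam, hlam'⟩ := exists_isLam K p
  let _ := hsStructure (j.comp (f₁.comp ι₁)) D'
  let _ := lamStructure (k := k) (e := e) (p := p) (m := m) lam
  have hI := (interp_hsStructure (j.comp (f₁.comp ι₁)) D').lamStructure lam
  have hK : K ⊨ gDCFLam W p m := (hI.model_gDCFLam W).2 ⟨⟨hG', hstr', hsep, hbasis⟩, hlam'⟩
  have hg₁ : ∀ i a, D' i ((j.comp f₁) a) = (j.comp f₁) (D₁ i a) := fun i a =>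
    (hjD i _).trans (congrArg j (hf₁ i a))
  have hg₂ : ∀ i a, D' i ((j.comp f₂) a) = (j.comp f₂) (D₂ i a) := fun i a =>
    (hjD i _).trans (congrArg j (hf₂ i a))
  obtain ⟨g₁, hg₁'⟩ := hI₁.exists_embedding hI (j.comp f₁) rfl hg₁
    (IsLam.map_comm hm hstr₁ hG' hg₁ hlam₁ hlam')
  obtain ⟨g₂, hg₂'⟩ := hI₂.exists_embedding hI (j.comp f₂)
    (RingHom.ext fun c => congrArg j (RingHom.congr_fun hf ⟨_, hι c⟩).symm) hg₂
    (IsLam.map_comm hm hstr₂ hG' hg₂ hlam₂ hlam')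
  have hgxy : g₁ ∘ x = g₂ ∘ y := funext fun i => by
    rw [Function.comp_apply, Function.comp_apply, hg₁', hg₂']
    exact congrArg j (RingHom.congr_fun hf ⟨(x i, y i), Term.var i, rfl⟩)
  rw [← realize_comp_gDCFLam W hm hM hK g₁, ← realize_comp_gDCFLam W hm hN hK g₂, hgxy]

end Types

end

end GDCF

/-- Here `𝔤 = W[m]` for an `e`-dimensional formal group law `W` over a perfect ring `k` of
characteristic `p > 0`. -/
theorem theorem4p6 {k : Type u} [CommRing k] (p : ℕ) [Fact p.Prime] [CharP k p]
    [PerfectRing k p] (e m : ℕ) (he : 0 < e) (hm : 0 < m) (W : GDCF.FormalGroupLaw e k) :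
    GDCF.HasQE (GDCF.gDCFLam W p m) ∧
    GDCF.ModelsEmbed.{u, 0, w} (GDCF.gDF W p m) (GDCF.gDCF W p m) ∧
    GDCF.IsModelCompanion.{u, 0, w} (GDCF.gDCF W p m) (GDCF.gDF W p m) ∧
    GDCF.IsModelCompletion.{u, 0, w} (GDCF.gDCFLam W p m) (GDCF.gDFLam W p m) := by
  have hembed : GDCF.ModelsEmbed.{u, 0, w} (GDCF.gDF W p m) (GDCF.gDCF W p m) := by
    intro M
    obtain ⟨_, _, ι, D, hI, hG⟩ := GDCF.exists_interp W M.is_model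
    obtain ⟨K, _, _, j, D', hG', hjD, hstr, hsep, hbasis⟩ := hG.exists_sepClosed hm
    let _ := GDCF.hsStructure (j.comp ι) D'
    have hI' := GDCF.interp_hsStructure (j.comp ι) D'
    have hK : K ⊨ GDCF.gDCF W p m := (hI'.model_gDCF W).2 ⟨hG', hstr, hsep, hbasis⟩
    obtain ⟨g, -⟩ := hI.exists_embedding hI' j rfl hjD
    exact ⟨Language.Theory.ModelType.of _ K, ⟨g⟩⟩
  refine ⟨GDCF.hasQE_of_qf_type _ fun M N n x y h φ =>
    (GDCF.realize_of_qf_type W hm M.is_model N.is_model x y h φ).1, hembed, ⟨hembed, fun M => ?_,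
    fun M N f n φ x => GDCF.realize_comp_gDCF W hm M.is_model N.is_model f φ x⟩,
    ⟨fun N => GDCF.model_gDFLam_of_gDCFLam W N.is_model, fun M => ?_, fun M N₁ N₂ f₁ f₂ n φ x => ?_⟩⟩
  · have : M ⊨ GDCF.gDF W p m := (GDCF.model_gDF_of_gDCF W M.is_model).1
    exact ⟨Language.Theory.ModelType.of _ M, ⟨Language.Embedding.refl _ _⟩⟩
  · obtain ⟨_, _, ι, D, lam, hI, hG, hstr, hlam⟩ := GDCF.exists_interpLam W M M.is_model
    obtain ⟨K, _, _, j, D', hG', hjD, hstr', hsep, hbasis⟩ := hG.exists_sepClosed hm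
    obtain ⟨lam', hlam'⟩ := GDCF.exists_isLam K p
    let _ := GDCF.hsStructure (j.comp ι) D'
    let _ := GDCF.lamStructure (k := k) (e := e) (p := p) (m := m) lam'
    have hI' := (GDCF.interp_hsStructure (j.comp ι) D').lamStructure lam'
    have hK : K ⊨ GDCF.gDCFLam W p m :=
      (hI'.model_gDCFLam W).2 ⟨⟨hG', hstr', hsep, hbasis⟩, hlam'⟩
    obtain ⟨g, -⟩ := hI.exists_embedding hI' j rfl hjD
      (GDCF.IsLam.map_comm hm hstr hG' hjD hlam hlam')
    exact ⟨Language.Theory.ModelType.of _ K, ⟨g⟩⟩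
  · refine GDCF.realize_of_qf_type W hm N₁.is_model N₂.is_model _ _ (fun ψ hψ => ?_) φ
    have h₁ := hψ.realize_embedding f₁ (v := x) (xs := default)
    have h₂ := hψ.realize_embedding f₂ (v := x) (xs := default)
    rw [Subsingleton.elim (f₁ ∘ default) default] at h₁
    rw [Subsingleton.elim (f₂ ∘ default) default] at h₂
    exact h₁.trans h₂.symm
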